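/- Let $\mathscr V=(\mathscr V_0,\otimes,I)$ be a complete and cocomplete symmetric monoidal closed category with internal hom $[-,-]$. **Sifted colimits and presentability.** A small category $\mathscr D$ is *sifted* if $\mathscr D$-colimits commute with finite products in $\mathbf{Set}$ (equivalently, $\mathscr D$ is non-empty and its diagonal $\mathscr D\to\mathscr D\times\mathscr D$ is final). An object $X$ of $\mathscr V_0$ is *strongly finitely presentable in $\mathscr V_0$* if $\mathscr V_0(X,-):\mathscr V_0\to\mathbf{Set}$ preserves sifted colimits. $\mathscr V$ is *locally strongly finitely presentable as a $\otimes$-category* if $\mathscr V_0$ has a small set $\mathscr G$ of objects strongly finitely presentable in $\mathscr V_0$ such that every object of $\mathscr V_0$ is a sifted colimit of objects in $\mathscr G$, and the strongly finitely presentable objects of $\mathscr V_0$ are closed under $\otimes$ (the unit $I$ is not required to be one of them). Let $\mathscr V_{sf}$ consist of the objects $X$ for which the internal hom $[X,-]:\mathscr V\to\mathscr V$ preserves sifted colimits. **Weights.** A *weight* is a $\mathscr V$-functor $W:\mathscr A\to\mathscr V$ with $\mathscr A$ a small $\mathscr V$-category. The limit $\{W,S\}$ of $S:\mathscr A\to\mathscr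 K$ and the colimit $W*R$ of $R:\mathscr A^{\mathrm{op}}\to\mathscr K$ are defined by natural isomorphisms $\mathscr K(X,\{W,S\})\cong[\mathscr A,\mathscr V](W,\mathscr K(X,S-))$ and $\mathscr K(W*R,X)\cong[\mathscr A,\mathscr V](W,\mathscr K(R-,X))$ in $\mathscr V$. A class of weights is *saturated* if it contains the representables and if, for each small $\mathscr A$, those of its members with domain $\mathscr A$ are closed in $[\mathscr A,\mathscr V]$ under colimits weighted by members of the class; the *saturation* of a class is the smallest saturated class containing it. Let $\Phi$ be the saturation of the class consisting of the weights for finite products and the weights for powers by objects of $\mathscr V_{sf}$; the limits weighted by members of $\Phi$ are the *strongly finite limits*. A $\mathscr V$-category is *$\Phi$-complete* if it has all limits weighted by members of $\Phi$, and a $\mathscr V$-functor is *$\Phi$-continuous* if it preserves all such limits that exist. A $\mathscr V$-functor $F:\mathscr T\to\mathscr V$ with $\mathscr T$ small is *$\Phi$-flat* if $F$-weighted colimits commute in $\mathscr V$ with $\Phi$-limits, that is, if for every $W:\mathscr A\to\mathscr V$ in $\Phi$ and every $\mathscr V$-functor $S$ of two variables $a\in\mathscr A$, $t\in\mathscr T^{\mathrm{op}}$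 with values in $\mathscr V$ the canonical comparison $F*\{W,S\}\to\{W,F*S\}$ is invertible. **Theorem.** Let $\mathscr V$ be locally strongly finitely presentable as a $\otimes$-category, and let $\Phi$ be as above. Let $\mathscr T$ be a small $\Phi$-complete $\mathscr V$-category. For a $\mathscr V$-functor $F:\mathscr T\to\mathscr V$ the following are equivalent: 1. $F$ is a sifted colimit of representables, i.e. $F$ is the (conical) colimit in $[\mathscr T,\mathscr V]$ of a diagram, indexed by a small sifted category, of representables $\mathscr T(t,-)$; 2. $F$ is $\Phi$-flat; 3. $F$ is $\Phi$-continuous. In particular Axiom A holds for $\Phi$: whenever $\mathscr T$ is a small $\Phi$-complete $\mathscr V$-category and $F:\mathscr T\to\mathscr V$ is $\Phi$-continuous, the $\mathscr V$-functor $F*-:[\mathscr T^{\mathrm{op}},\mathscr V]\to\mathscr V$ is $\Phi$-continuous. -/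

import Mathlib

open CategoryTheory MonoidalCategory Limits Opposite

universe u v w w'

attribute [local instance] MonoidalClosed.enrichedCategorySelf

namespace EnrichedTheories

noncomputable section

section Calculus

variable {V : Type v} [Category.{u} V] [MonoidalCategory V] {K : Type w} [EnrichedCategory V K]

theorem eId_tensorHom_eComp {X Y : K} {P : V} (f : P ⟶ (X ⟶[V] Y)) :
    (eId V X ⊗ₘ f) ≫ eComp V X X Y = (λ_ P).hom ≫ f := by
  have h := e_id_comp V X Y
  rw [Iso.inv_comp_eq, Category.comp_id] at h
  rw [tensorHom_def', Category.assoc, h, leftUnitor_naturality]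

theorem tensorHom_eId_eComp {X Y : K} {P : V} (f : P ⟶ (X ⟶[V] Y)) :
    (f ⊗ₘ eId V Y) ≫ eComp V X Y Y = (ρ_ P).hom ≫ f := by
  have h := e_comp_id V X Y
  rw [Iso.inv_comp_eq, Category.comp_id] at h
  rw [MonoidalCategory.tensorHom_def, Category.assoc, h, rightUnitor_naturality]

theorem eComp_tensorHom_eComp {W X Y Y' : K} {P Q R : V} (f : P ⟶ (W ⟶[V] X))
    (g : Q ⟶ (X ⟶[V] Y)) (h : R ⟶ (Y ⟶[V] Y')) :
    (((f ⊗ₘ g) ≫ eComp V W X Y) ⊗ₘ h) ≫ eComp V W Y Y' =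
      (α_ P Q R).hom ≫ (f ⊗ₘ ((g ⊗ₘ h) ≫ eComp V X Y Y')) ≫ eComp V W X Y' := by
  have h1 : ((f ⊗ₘ g) ≫ eComp V W X Y) ⊗ₘ h = ((f ⊗ₘ g) ⊗ₘ h) ≫ eComp V W X Y ▷ _ := by
    rw [← tensorHom_id, tensorHom_comp_tensorHom, Category.comp_id]
  have h2 : (f ⊗ₘ ((g ⊗ₘ h) ≫ eComp V X Y Y')) = (f ⊗ₘ (g ⊗ₘ h)) ≫ _ ◁ eComp V X Y Y' := by
    rw [← id_tensorHom, tensorHom_comp_tensorHom, Category.comp_id]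
  rw [h1, h2, Category.assoc, Category.assoc, ← e_assoc', associator_naturality_assoc]

theorem comp_tensorHom {P P' Q R S : V} (e : P ⟶ P') (f : P' ⟶ Q) (g : R ⟶ S) :
    (e ≫ f) ⊗ₘ g = e ▷ R ≫ (f ⊗ₘ g) := by
  rw [← tensorHom_id, tensorHom_comp_tensorHom, Category.id_comp]

theorem tensorHom_comp' {P P' Q R S : V} (e : P ⟶ P') (f : P' ⟶ Q) (g : R ⟶ S) :
    g ⊗ₘ (e ≫ f) = R ◁ e ≫ (g ⊗ₘ f) := by
  rw [← id_tensorHom, tensorHom_comp_tensorHom, Category.id_comp]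

end Calculus

section Closed

variable {V : Type v} [Category.{u} V] [MonoidalCategory V] [MonoidalClosed V]

theorem uncurry_eId (X : V) : MonoidalClosed.uncurry (eId V X) = (ρ_ X).hom :=
  MonoidalClosed.uncurry_curry _

theorem uncurry_tensorHom_eComp {X Y Z P Q : V} (g : P ⟶ (ihom X).obj Y) (f : Q ⟶ (ihom Y).obj Z) :
    MonoidalClosed.uncurry ((g ⊗ₘ f) ≫ eComp V X Y Z) =
      (α_ X P Q).inv ≫ MonoidalClosed.uncurry g ▷ Q ≫ MonoidalClosed.uncurry f := by
  change MonoidalClosed.uncurry ((g ⊗ₘ f) ≫ MonoidalClosed.curry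
    (MonoidalClosed.compTranspose X Y Z)) = _
  rw [MonoidalClosed.uncurry_natural_left, MonoidalClosed.uncurry_curry,
    MonoidalClosed.compTranspose_eq, MonoidalClosed.uncurry_eq, MonoidalClosed.uncurry_eq,
    ← id_tensorHom, associator_inv_naturality_assoc, comp_whiskerRight_assoc, ← whisker_exchange_assoc,
    tensorHom_def', id_tensorHom, Category.assoc, whisker_exchange_assoc]

end Closed

section FunctorCategory

variable {V : Type v} [Category.{u} V] [MonoidalCategory V] [SymmetricCategory V]
  [MonoidalClosed V] [HasLimits V]
variable {A : Type u} [EnrichedCategory V A] {K : Type w} [EnrichedCategory V K]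

/-- The morphism `∏ₐ K(Fa, Ga) ⟶ ∏ₐᵦ [A(a,b), K(Fa, Gb)]` given by precomposition with `F`. -/
def natObjLeft (F G : EnrichedFunctor V A K) :
    (∏ᶜ fun a : A => (F.obj a ⟶[V] G.obj a)) ⟶
      ∏ᶜ fun p : A × A => (ihom (p.1 ⟶[V] p.2)).obj (F.obj p.1 ⟶[V] G.obj p.2) :=
  Pi.lift fun p => Pi.π _ p.2 ≫ MonoidalClosed.curry
    (F.map p.1 p.2 ▷ (F.obj p.2 ⟶[V] G.obj p.2) ≫ eComp V (F.obj p.1) (F.obj p.2) (G.obj p.2))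

/-- The morphism `∏ₐ K(Fa, Ga) ⟶ ∏ₐᵦ [A(a,b), K(Fa, Gb)]` given by postcomposition with `G`. -/
def natObjRight (F G : EnrichedFunctor V A K) :
    (∏ᶜ fun a : A => (F.obj a ⟶[V] G.obj a)) ⟶
      ∏ᶜ fun p : A × A => (ihom (p.1 ⟶[V] p.2)).obj (F.obj p.1 ⟶[V] G.obj p.2) :=
  Pi.lift fun p => Pi.π _ p.1 ≫ MonoidalClosed.curry
    ((β_ (p.1 ⟶[V] p.2) (F.obj p.1 ⟶[V] G.obj p.1)).hom ≫
      (F.obj p.1 ⟶[V] G.obj p.1) ◁ G.map p.1 p.2 ≫ eComp V (F.obj p.1) (G.obj p.1) (G.obj p.2))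

/-- The `V`-object `[A, K](F, G) = ∫ₐ K(Fa, Ga)` of `V`-natural transformations. -/
def natObj (F G : EnrichedFunctor V A K) : V := equalizer (natObjLeft F G) (natObjRight F G)

/-- The projections `[A, K](F, G) ⟶ K(Fa, Ga)`. -/
def natObjπ (F G : EnrichedFunctor V A K) (a : A) : natObj F G ⟶ (F.obj a ⟶[V] G.obj a) :=
  equalizer.ι (natObjLeft F G) (natObjRight F G) ≫ Pi.π _ a

/-- `V`-naturality of a family `φ a : Z ⟶ K(Fa, Ga)`. -/
def IsNatFamily (F G : EnrichedFunctor V A K) {Z : V} (φ : ∀ a, Z ⟶ (F.obj a ⟶[V] G.obj a)) :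
    Prop :=
  ∀ a b : A, (F.map a b ⊗ₘ φ b) ≫ eComp V (F.obj a) (F.obj b) (G.obj b) =
    (β_ (a ⟶[V] b) Z).hom ≫ (φ a ⊗ₘ G.map a b) ≫ eComp V (F.obj a) (G.obj a) (G.obj b)

theorem natFamily_iff (F G : EnrichedFunctor V A K) {Z : V}
    (l : Z ⟶ ∏ᶜ fun a : A => (F.obj a ⟶[V] G.obj a)) :
    IsNatFamily F G (fun a => l ≫ Pi.π _ a) ↔ l ≫ natObjLeft F G = l ≫ natObjRight F G := by
  have key : ∀ a b : A,
      ((F.map a b ⊗ₘ (l ≫ Pi.π _ b)) ≫ eComp V (F.obj a) (F.obj b) (G.obj b) =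
        (β_ (a ⟶[V] b) Z).hom ≫ ((l ≫ Pi.π _ a) ⊗ₘ G.map a b) ≫
          eComp V (F.obj a) (G.obj a) (G.obj b)) ↔
      ((l ≫ natObjLeft F G) ≫ Pi.π _ (a, b) = (l ≫ natObjRight F G) ≫ Pi.π _ (a, b)) := by
    intro a b
    have h1 : (l ≫ natObjLeft F G) ≫ Pi.π _ (a, b) = MonoidalClosed.curry
        ((F.map a b ⊗ₘ (l ≫ Pi.π _ b)) ≫ eComp V (F.obj a) (F.obj b) (G.obj b)) := by
      simp only [natObjLeft, Category.assoc, limit.lift_π, Fan.mk_π_app]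
      rw [← Category.assoc, ← MonoidalClosed.curry_natural_left, tensorHom_def',
        Category.assoc]
    have h2 : (l ≫ natObjRight F G) ≫ Pi.π _ (a, b) = MonoidalClosed.curry
        ((β_ (a ⟶[V] b) Z).hom ≫ ((l ≫ Pi.π _ a) ⊗ₘ G.map a b) ≫
          eComp V (F.obj a) (G.obj a) (G.obj b)) := by
      simp only [natObjRight, Category.assoc, limit.lift_π, Fan.mk_π_app]
      rw [← Category.assoc, ← MonoidalClosed.curry_natural_left, MonoidalCategory.tensorHom_def,
        Category.assoc, BraidedCategory.braiding_naturality_right_assoc]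
    rw [h1, h2]
    exact MonoidalClosed.curry_injective.eq_iff.symm
  constructor
  · intro h
    apply Pi.hom_ext
    rintro ⟨a, b⟩
    exact (key a b).1 (h a b)
  · intro h a b
    exact (key a b).2 (by rw [h])

theorem natObjπ_isNatFamily (F G : EnrichedFunctor V A K) :
    IsNatFamily F G (natObjπ F G) :=
  (natFamily_iff F G _).2 (equalizer.condition _ _)

/-- The universal property of `[A, K](F, G)`. -/
def natObjLift (F G : EnrichedFunctor V A K) {Z : V} (φ : ∀ a, Z ⟶ (F.obj a ⟶[V] G.obj a))
    (h : IsNatFamily F G φ) : Z ⟶ natObj F G :=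
  equalizer.lift (Pi.lift φ) ((natFamily_iff F G _).1 (by simpa using h))

@[simp]
theorem natObjLift_π (F G : EnrichedFunctor V A K) {Z : V}
    (φ : ∀ a, Z ⟶ (F.obj a ⟶[V] G.obj a)) (h : IsNatFamily F G φ) (a : A) :
    natObjLift F G φ h ≫ natObjπ F G a = φ a := by
  exact (equalizer.lift_ι_assoc _ _ _).trans (by simp)

theorem natObj_hom_ext {F G : EnrichedFunctor V A K} {Z : V} {f g : Z ⟶ natObj F G}
    (h : ∀ a, f ≫ natObjπ F G a = g ≫ natObjπ F G a) : f = g := by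
  apply equalizer.hom_ext
  apply Pi.hom_ext
  intro a
  exact (Category.assoc _ _ _).trans ((h a).trans (Category.assoc _ _ _).symm)

theorem id_isNatFamily (F : EnrichedFunctor V A K) :
    IsNatFamily F F (fun a => eId V (F.obj a)) := by
  intro a b
  rw [eId_tensorHom_eComp, tensorHom_eId_eComp, braiding_leftUnitor_assoc]

theorem comp_isNatFamily (F G H : EnrichedFunctor V A K) :
    IsNatFamily F H (fun a => (natObjπ F G a ⊗ₘ natObjπ G H a) ≫
      eComp V (F.obj a) (G.obj a) (H.obj a)) := by
  intro a b
  have h1 := eComp_tensorHom_eComp (F.map a b) (natObjπ F G b) (natObjπ G H b)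
  have h2 := eComp_tensorHom_eComp (natObjπ F G a) (G.map a b) (natObjπ G H b)
  have h3 := eComp_tensorHom_eComp (natObjπ F G a) (natObjπ G H a) (H.map a b)
  rw [← Iso.inv_comp_eq] at h1
  rw [natObjπ_isNatFamily F G a b] at h1
  rw [natObjπ_isNatFamily G H a b] at h2
  rw [← h1, BraidedCategory.braiding_tensor_right_hom]
  simp only [Category.assoc]
  rw [h3, Iso.inv_hom_id_assoc, comp_tensorHom, Category.assoc, h2, tensorHom_comp',
    Category.assoc]

/-- The `V`-category `[A, K]` of `V`-functors from a small `V`-category `A` to `K`. -/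
instance functorEnrichedCategory : EnrichedCategory V (EnrichedFunctor V A K) where
  Hom F G := natObj F G
  id F := natObjLift F F _ (id_isNatFamily F)
  comp F G H := natObjLift F H _ (comp_isNatFamily F G H)
  id_comp F G := by
    apply natObj_hom_ext
    intro a
    rw [Category.assoc, Category.assoc, natObjLift_π, ← Category.assoc (_ ▷ _),
      ← comp_tensorHom, natObjLift_π, eId_tensorHom_eComp, Iso.inv_hom_id_assoc,
      Category.id_comp]
  comp_id F G := by
    apply natObj_hom_ext
    intro a
    rw [Category.assoc, Category.assoc, natObjLift_π, ← Category.assoc (_ ◁ _),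
      ← tensorHom_comp', natObjLift_π, tensorHom_eId_eComp, Iso.inv_hom_id_assoc,
      Category.id_comp]
  assoc F G H J := by
    apply natObj_hom_ext
    intro a
    simp only [Category.assoc, natObjLift_π]
    rw [← Category.assoc (_ ▷ _), ← Category.assoc (_ ◁ _), ← comp_tensorHom,
      ← tensorHom_comp', natObjLift_π, natObjLift_π, eComp_tensorHom_eComp,
      Iso.inv_hom_id_assoc]

/-- The projections `[A, K](F, G) ⟶ K(Fa, Ga)` out of the hom-objects of `[A, K]`. -/
def evalπ (F G : EnrichedFunctor V A K) (a : A) : (F ⟶[V] G) ⟶ (F.obj a ⟶[V] G.obj a) :=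
  natObjπ F G a

theorem evalπ_natural (F G : EnrichedFunctor V A K) (a b : A) :
    (F.map a b ⊗ₘ evalπ F G b) ≫ eComp V (F.obj a) (F.obj b) (G.obj b) =
      (β_ (a ⟶[V] b) (F ⟶[V] G)).hom ≫ (evalπ F G a ⊗ₘ G.map a b) ≫
        eComp V (F.obj a) (G.obj a) (G.obj b) :=
  natObjπ_isNatFamily F G a b

theorem eId_evalπ (F : EnrichedFunctor V A K) (a : A) :
    eId V F ≫ evalπ F F a = eId V (F.obj a) :=
  natObjLift_π F F _ (id_isNatFamily F) a

theorem eComp_evalπ (F G H : EnrichedFunctor V A K) (a : A) :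
    eComp V F G H ≫ evalπ F H a =
      (evalπ F G a ⊗ₘ evalπ G H a) ≫ eComp V (F.obj a) (G.obj a) (H.obj a) :=
  natObjLift_π F H _ (comp_isNatFamily F G H) a

/-- The `V`-functor `[A, K] ⟶ K` of evaluation at `a`. -/
def evaluation (a : A) : EnrichedFunctor V (EnrichedFunctor V A K) K where
  obj F := F.obj a
  map F G := evalπ F G a
  map_id F := eId_evalπ F a
  map_comp F G H := eComp_evalπ F G H a

end FunctorCategory

section WeightedLimits

variable {V : Type v} [Category.{u} V] [MonoidalCategory V] [SymmetricCategory V]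
  [MonoidalClosed V]
variable {A : Type u} [EnrichedCategory V A] {K : Type w} [EnrichedCategory V K]
  {K' : Type w'} [EnrichedCategory V K']

/-- The action `W a ⊗ A(a, b) ⟶ W b` of a `V`-functor `W : A ⟶ V`. -/
def act (W : EnrichedFunctor V A V) (a b : A) : W.obj a ⊗ (a ⟶[V] b) ⟶ W.obj b :=
  MonoidalClosed.uncurry (W.map a b)

/-- A `W`-weighted cone over `S : A ⟶ K` with vertex `L`: a `V`-natural transformation
`W ⟶ K(L, S-)`. -/
structure WeightedCone (W : EnrichedFunctor V A V) (S : EnrichedFunctor V A K) (L : K) where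
  /-- The components of the cone. -/
  app (a : A) : W.obj a ⟶ (L ⟶[V] S.obj a)
  naturality (a b : A) :
    act W a b ≫ app b = (app a ⊗ₘ S.map a b) ≫ eComp V L (S.obj a) (S.obj b)

/-- `V`-naturality in `a` of a family `φ a : Z ⊗ W a ⟶ K(X, S a)`; such families correspond to the
morphisms `Z ⟶ [A, V](W, K(X, S-))`. -/
def IsGradedCone (W : EnrichedFunctor V A V) (S : EnrichedFunctor V A K) {X : K} {Z : V}
    (φ : ∀ a, Z ⊗ W.obj a ⟶ (X ⟶[V] S.obj a)) : Prop :=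
  ∀ a b : A, Z ◁ act W a b ≫ φ b =
    (α_ Z (W.obj a) (a ⟶[V] b)).inv ≫ (φ a ⊗ₘ S.map a b) ≫ eComp V X (S.obj a) (S.obj b)

/-- The cone exhibits `L` as the weighted limit `{W, S}`: for all `X` the induced morphism
`K(X, L) ⟶ [A, V](W, K(X, S-))` is invertible in `V`, i.e. it is bijective on generalized
elements `Z ⟶ K(X, L)`. -/
def WeightedCone.IsLimit {W : EnrichedFunctor V A V} {S : EnrichedFunctor V A K} {L : K}
    (c : WeightedCone W S L) : Prop :=
  ∀ (X : K) (Z : V) (φ : ∀ a, Z ⊗ W.obj a ⟶ (X ⟶[V] S.obj a)), IsGradedCone W S φ →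
    ∃! f : Z ⟶ (X ⟶[V] L), ∀ a, (f ⊗ₘ c.app a) ≫ eComp V X L (S.obj a) = φ a

/-- The image of a weighted cone under a `V`-functor. -/
def WeightedCone.map {W : EnrichedFunctor V A V} {S : EnrichedFunctor V A K} {L : K}
    (c : WeightedCone W S L) (G : EnrichedFunctor V K K') :
    WeightedCone W (S.comp V G) (G.obj L) where
  app a := c.app a ≫ G.map L (S.obj a)
  naturality a b := by
    change act W a b ≫ c.app b ≫ G.map L (S.obj b) = ((c.app a ≫ G.map L (S.obj a)) ⊗ₘ
      (S.map a b ≫ G.map (S.obj a) (S.obj b))) ≫ eComp V (G.obj L) (G.obj (S.obj a))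
        (G.obj (S.obj b))
    rw [← Category.assoc, c.naturality, Category.assoc, EnrichedFunctor.map_comp,
      tensorHom_comp_tensorHom_assoc]

/-- A `W`-weighted cocone under `R : Aᵒᵖ ⟶ K` with vertex `C`: a `V`-natural transformation
`W ⟶ K(R-, C)`. -/
structure WeightedCocone (W : EnrichedFunctor V A V) (R : EnrichedFunctor V Aᵒᵖ K) (C : K) where
  /-- The components of the cocone. -/
  app (a : A) : W.obj a ⟶ (R.obj (op a) ⟶[V] C)
  naturality (a b : A) : ((β_ (a ⟶[V] b) (W.obj a)).hom ≫ act W a b) ≫ app b =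
    (R.map (op b) (op a) ⊗ₘ app a) ≫ eComp V (R.obj (op b)) (R.obj (op a)) C

/-- `V`-naturality in `a` of a family `φ a : W a ⊗ Z ⟶ K(R a, X)`; such families correspond to the
morphisms `Z ⟶ [A, V](W, K(R-, X))`. -/
def IsGradedCocone (W : EnrichedFunctor V A V) (R : EnrichedFunctor V Aᵒᵖ K) {X : K} {Z : V}
    (φ : ∀ a, W.obj a ⊗ Z ⟶ (R.obj (op a) ⟶[V] X)) : Prop :=
  ∀ a b : A, (α_ (a ⟶[V] b) (W.obj a) Z).inv ≫
      ((β_ (a ⟶[V] b) (W.obj a)).hom ≫ act W a b) ▷ Z ≫ φ b =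
    (R.map (op b) (op a) ⊗ₘ φ a) ≫ eComp V (R.obj (op b)) (R.obj (op a)) X

/-- The cocone exhibits `C` as the weighted colimit `W * R`: for all `X` the induced morphism
`K(C, X) ⟶ [A, V](W, K(R-, X))` is invertible in `V`, i.e. it is bijective on generalized
elements `Z ⟶ K(C, X)`. -/
def WeightedCocone.IsColimit {W : EnrichedFunctor V A V} {R : EnrichedFunctor V Aᵒᵖ K} {C : K}
    (c : WeightedCocone W R C) : Prop :=
  ∀ (X : K) (Z : V) (φ : ∀ a, W.obj a ⊗ Z ⟶ (R.obj (op a) ⟶[V] X)), IsGradedCocone W R φ →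
    ∃! f : Z ⟶ (C ⟶[V] X), ∀ a, (c.app a ⊗ₘ f) ≫ eComp V (R.obj (op a)) C X = φ a

theorem WeightedCocone.isGradedCocone {W : EnrichedFunctor V A V} {R : EnrichedFunctor V Aᵒᵖ K}
    {C : K} (c : WeightedCocone W R C) {X : K} {Z : V} (f : Z ⟶ (C ⟶[V] X)) :
    IsGradedCocone W R (fun a => (c.app a ⊗ₘ f) ≫ eComp V (R.obj (op a)) C X) := by
  intro a b
  have h := eComp_tensorHom_eComp (R.map (op b) (op a)) (c.app a) f
  rw [← c.naturality, comp_tensorHom, Category.assoc] at h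
  exact (Iso.inv_comp_eq _).2 h

theorem WeightedCocone.IsColimit.hom_ext {W : EnrichedFunctor V A V}
    {R : EnrichedFunctor V Aᵒᵖ K} {C : K} {c : WeightedCocone W R C} (hc : c.IsColimit) {X : K}
    {Z : V} {f g : Z ⟶ (C ⟶[V] X)}
    (h : ∀ a, (c.app a ⊗ₘ f) ≫ eComp V (R.obj (op a)) C X =
      (c.app a ⊗ₘ g) ≫ eComp V (R.obj (op a)) C X) : f = g :=
  (hc X Z _ (c.isGradedCocone g)).unique h (fun _ => rfl)

end WeightedLimits

section ColimitFunctor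

variable {V : Type v} [Category.{u} V] [MonoidalCategory V] [SymmetricCategory V]
  [MonoidalClosed V] [HasLimits V]
variable {T : Type u} [EnrichedCategory V T] {K : Type w} [EnrichedCategory V K]
  (F : EnrichedFunctor V T V)

theorem colimitFunctor_aux {H H' : EnrichedFunctor V Tᵒᵖ K} {C : K} (c : WeightedCocone F H' C) :
    IsGradedCocone F H (fun t => (β_ (F.obj t) (H ⟶[V] H')).hom ≫
      (evalπ H H' (op t) ⊗ₘ c.app t) ≫ eComp V (H.obj (op t)) (H'.obj (op t)) C) := by
  intro a b
  have h1 := evalπ_natural H H' (op b) (op a)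
  have h1' : (evalπ H H' (op b) ⊗ₘ H'.map (op b) (op a)) ≫
      eComp V (H.obj (op b)) (H'.obj (op b)) (H'.obj (op a)) =
      (β_ (H ⟶[V] H') (a ⟶[V] b)).hom ≫ (H.map (op b) (op a) ⊗ₘ evalπ H H' (op a)) ≫
        eComp V (H.obj (op b)) (H.obj (op a)) (H'.obj (op a)) := by
    rw [h1]
    exact (SymmetricCategory.symmetry_assoc _ _ _).symm
  have h2 := eComp_tensorHom_eComp (evalπ H H' (op b)) (H'.map (op b) (op a)) (c.app a)
  have h3 := eComp_tensorHom_eComp (H.map (op b) (op a)) (evalπ H H' (op a)) (c.app a)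
  rw [← Iso.inv_comp_eq, h1', ← c.naturality, comp_tensorHom, Category.assoc, h3,
    tensorHom_comp' ((β_ (a ⟶[V] b) (F.obj a)).hom ≫ act F a b), Category.assoc] at h2
  have h4 : (H.map (op b) (op a) ⊗ₘ (β_ (F.obj a) (H ⟶[V] H')).hom ≫
      (evalπ H H' (op a) ⊗ₘ c.app a) ≫ eComp V (H.obj (op a)) (H'.obj (op a)) C) = _ :=
    tensorHom_comp' (β_ (F.obj a) (H ⟶[V] H')).hom _ _
  dsimp only
  rw [h4, Category.assoc, BraidedCategory.braiding_naturality_left_assoc, ← h2,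
    BraidedCategory.braiding_tensor_left_hom]
  simp only [Category.assoc]
  have h5 : ∀ {Y : V} (k : ((a ⟶[V] b) ⊗ (H ⟶[V] H')) ⊗ F.obj a ⟶ Y),
      (β_ (a ⟶[V] b) (H ⟶[V] H')).hom ▷ F.obj a ≫ (α_ _ _ _).hom ≫ (α_ _ _ _).inv ≫
        (β_ (H ⟶[V] H') (a ⟶[V] b)).hom ▷ F.obj a ≫ k = k := by
    intro Y k
    rw [Iso.hom_inv_id_assoc, ← Category.assoc, ← comp_whiskerRight, SymmetricCategory.symmetry,
      id_whiskerRight, Category.id_comp]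
  rw [Iso.inv_hom_id_assoc]
  erw [h5, Iso.inv_hom_id_assoc]
  rfl

theorem colimitFunctor_aux' {P : EnrichedFunctor V Tᵒᵖ K → K} (c : ∀ H, WeightedCocone F H (P H))
    (hc : ∀ H, (c H).IsColimit) (H H' : EnrichedFunctor V Tᵒᵖ K) (t : T) :
    ((c H).app t ⊗ₘ (hc H (P H') (H ⟶[V] H') _ (colimitFunctor_aux F (c H'))).choose) ≫
      eComp V (H.obj (op t)) (P H) (P H') = (β_ (F.obj t) (H ⟶[V] H')).hom ≫
      (evalπ H H' (op t) ⊗ₘ (c H').app t) ≫ eComp V (H.obj (op t)) (H'.obj (op t)) (P H') :=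
  (hc H (P H') (H ⟶[V] H') _ (colimitFunctor_aux F (c H'))).choose_spec.1 t

/-- Given a choice of all colimits weighted by `F`, the `V`-functor `F * - : [Tᵒᵖ, K] ⟶ K`. -/
def colimitFunctor (P : EnrichedFunctor V Tᵒᵖ K → K) (c : ∀ H, WeightedCocone F H (P H))
    (hc : ∀ H, (c H).IsColimit) : EnrichedFunctor V (EnrichedFunctor V Tᵒᵖ K) K where
  obj := P
  map H H' := (hc H (P H') (H ⟶[V] H') _ (colimitFunctor_aux F (c H'))).choose
  map_id H := by
    apply (hc H).hom_ext
    intro t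
    rw [tensorHom_comp', Category.assoc, colimitFunctor_aux',
      BraidedCategory.braiding_naturality_right_assoc, ← Category.assoc (eId V H ▷ _),
      ← comp_tensorHom, eId_evalπ, eId_tensorHom_eComp, tensorHom_eId_eComp, braiding_leftUnitor_assoc]
  map_comp H H' H'' := by
    apply (hc H).hom_ext
    intro t
    have h1 := eComp_tensorHom_eComp ((c H).app t)
      (hc H (P H') (H ⟶[V] H') _ (colimitFunctor_aux F (c H'))).choose
      (hc H' (P H'') (H' ⟶[V] H'') _ (colimitFunctor_aux F (c H''))).choose
    rw [← Iso.inv_comp_eq] at h1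
    rw [← h1, tensorHom_comp', Category.assoc, colimitFunctor_aux', colimitFunctor_aux',
      BraidedCategory.braiding_naturality_right_assoc, ← Category.assoc (eComp V H H' H'' ▷ _),
      ← comp_tensorHom, eComp_evalπ, eComp_tensorHom_eComp, comp_tensorHom, Category.assoc,
      eComp_tensorHom_eComp, colimitFunctor_aux',
      tensorHom_comp' (β_ (F.obj t) (H' ⟶[V] H'')).hom,
      BraidedCategory.braiding_tensor_right_hom]
    simp only [Category.assoc, Iso.inv_hom_id_assoc]

end ColimitFunctor

section Coend

variable {V : Type v} [Category.{u} V] [MonoidalCategory V] [SymmetricCategory V]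
  [MonoidalClosed V] [HasColimits V]
variable {T : Type u} [EnrichedCategory V T]

section

variable (F : EnrichedFunctor V T V) (H : EnrichedFunctor V Tᵒᵖ V)

/-- The action `H t ⊗ T(s, t) ⟶ H s` of a `V`-functor `H : Tᵒᵖ ⟶ V`. -/
def opAct (s t : T) : H.obj (op t) ⊗ (s ⟶[V] t) ⟶ H.obj (op s) :=
  MonoidalClosed.uncurry (H.map (op t) (op s))

/-- The first morphism of the coequalizer presenting the coend `∫ᵗ H t ⊗ F t`. -/
def coendLeft : (∐ fun p : T × T => H.obj (op p.2) ⊗ (F.obj p.1 ⊗ (p.1 ⟶[V] p.2))) ⟶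
    ∐ fun t : T => H.obj (op t) ⊗ F.obj t :=
  Sigma.desc fun p => H.obj (op p.2) ◁ act F p.1 p.2 ≫
    Sigma.ι (fun t : T => H.obj (op t) ⊗ F.obj t) p.2

/-- The second morphism of the coequalizer presenting the coend `∫ᵗ H t ⊗ F t`. -/
def coendRight : (∐ fun p : T × T => H.obj (op p.2) ⊗ (F.obj p.1 ⊗ (p.1 ⟶[V] p.2))) ⟶
    ∐ fun t : T => H.obj (op t) ⊗ F.obj t :=
  Sigma.desc fun p => H.obj (op p.2) ◁ (β_ (F.obj p.1) (p.1 ⟶[V] p.2)).hom ≫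
    (α_ _ _ _).inv ≫ opAct H p.1 p.2 ▷ F.obj p.1 ≫
    Sigma.ι (fun t : T => H.obj (op t) ⊗ F.obj t) p.1

/-- The coend `∫ᵗ H t ⊗ F t`. -/
def coendObj : V := coequalizer (coendLeft F H) (coendRight F H)

/-- The coprojections `H t ⊗ F t ⟶ ∫ᵗ H t ⊗ F t`. -/
def coendι (t : T) : H.obj (op t) ⊗ F.obj t ⟶ coendObj F H :=
  Sigma.ι (fun t : T => H.obj (op t) ⊗ F.obj t) t ≫
    coequalizer.π (coendLeft F H) (coendRight F H)

theorem coend_condition (s t : T) : H.obj (op t) ◁ act F s t ≫ coendι F H t =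
    H.obj (op t) ◁ (β_ (F.obj s) (s ⟶[V] t)).hom ≫ (α_ _ _ _).inv ≫
      opAct H s t ▷ F.obj s ≫ coendι F H s := by
  have h := Sigma.ι (fun p : T × T => H.obj (op p.2) ⊗ (F.obj p.1 ⊗ (p.1 ⟶[V] p.2))) (s, t) ≫=
    coequalizer.condition (coendLeft F H) (coendRight F H)
  rw [← Category.assoc, ← Category.assoc] at h
  simp only [coendLeft, coendRight, colimit.ι_desc, Cofan.mk_ι_app, Category.assoc] at h
  exact h

theorem coend_hom_ext {X : V} {f g : coendObj F H ⟶ X}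
    (h : ∀ t, coendι F H t ≫ f = coendι F H t ≫ g) : f = g := by
  apply coequalizer.hom_ext
  apply Sigma.hom_ext
  intro t
  exact (Category.assoc _ _ _).symm.trans ((h t).trans (Category.assoc _ _ _))

theorem coend_desc {X : V} (φ : ∀ t, H.obj (op t) ⊗ F.obj t ⟶ X)
    (h : ∀ s t, H.obj (op t) ◁ act F s t ≫ φ t =
      H.obj (op t) ◁ (β_ (F.obj s) (s ⟶[V] t)).hom ≫ (α_ _ _ _).inv ≫
        opAct H s t ▷ F.obj s ≫ φ s) :
    ∃ f : coendObj F H ⟶ X, ∀ t, coendι F H t ≫ f = φ t := by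
  refine ⟨coequalizer.desc (Sigma.desc φ) ?_, fun t => ?_⟩
  · apply Sigma.hom_ext
    rintro ⟨s, t⟩
    simpa [coendLeft, coendRight] using h s t
  · exact (Category.assoc _ _ _).trans ((congrArg _ (coequalizer.π_desc _ _)).trans (by simp))

/-- The coprojections of the coend, as a weighted cocone. -/
def coendCocone : WeightedCocone F H (coendObj F H) where
  app t := MonoidalClosed.curry (coendι F H t)
  naturality s t := by
    apply MonoidalClosed.uncurry_injective
    rw [uncurry_tensorHom_eComp, MonoidalClosed.uncurry_natural_left,
      MonoidalClosed.uncurry_curry, MonoidalClosed.uncurry_curry, whiskerLeft_comp,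
      Category.assoc, coend_condition, ← whiskerLeft_comp_assoc, SymmetricCategory.symmetry,
      whiskerLeft_id, Category.id_comp]
    rfl

theorem coendCocone_isColimit : (coendCocone F H).IsColimit := by
  intro X Z φ hφ
  have key : ∀ (f : Z ⟶ (ihom (coendObj F H)).obj X) (t : T),
      MonoidalClosed.uncurry (((coendCocone F H).app t ⊗ₘ f) ≫
        eComp V (H.obj (op t)) (coendObj F H) X) =
      (α_ _ _ _).inv ≫ coendι F H t ▷ Z ≫ MonoidalClosed.uncurry f := by
    intro f t
    rw [uncurry_tensorHom_eComp]
    simp only [coendCocone, MonoidalClosed.uncurry_curry]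
  have hφ' : ∀ s t, (H.obj (op t) ◁ act F s t) ▷ Z ≫ (α_ _ _ _).hom ≫
      MonoidalClosed.uncurry (φ t) =
      (H.obj (op t) ◁ (β_ (F.obj s) (s ⟶[V] t)).hom ≫ (α_ _ _ _).inv ≫
        opAct H s t ▷ F.obj s) ▷ Z ≫ (α_ _ _ _).hom ≫ MonoidalClosed.uncurry (φ s) := by
    intro s t
    have h := congrArg MonoidalClosed.uncurry (hφ s t)
    rw [uncurry_tensorHom_eComp, ← Category.assoc, MonoidalClosed.uncurry_natural_left] at h
    have h' := ((α_ _ _ _).hom ≫ H.obj (op t) ◁ ((β_ (F.obj s) (s ⟶[V] t)).hom ▷ Z ≫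
      (α_ _ _ _).hom)) ≫= h
    have e : ∀ {Y : V} (k : H.obj (op t) ⊗ (F.obj s ⊗ (s ⟶[V] t)) ⊗ Z ⟶ Y),
        H.obj (op t) ◁ (β_ (F.obj s) (s ⟶[V] t)).hom ▷ Z ≫
          H.obj (op t) ◁ (β_ (s ⟶[V] t) (F.obj s)).hom ▷ Z ≫ k = k := by
      intro Y k
      rw [← whiskerLeft_comp_assoc, ← comp_whiskerRight, SymmetricCategory.symmetry,
        id_whiskerRight, whiskerLeft_id, Category.id_comp]
    simp only [whiskerLeft_comp, comp_whiskerRight, Category.assoc,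
      whiskerLeft_hom_inv_assoc, e] at h'
    rw [← associator_naturality_middle_assoc] at h'
    rw [h']
    simp only [opAct]
    monoidal
  obtain ⟨g, hg⟩ := coend_desc F H (X := (ihom Z).obj X)
    (fun t => MonoidalClosed.curry ((β_ Z (H.obj (op t) ⊗ F.obj t)).hom ≫ (α_ _ _ _).hom ≫
      MonoidalClosed.uncurry (φ t))) (by
      intro s t
      apply MonoidalClosed.uncurry_injective
      rw [← Category.assoc (α_ _ _ _).inv, ← Category.assoc (H.obj (op t) ◁ _),
        MonoidalClosed.uncurry_natural_left, MonoidalClosed.uncurry_natural_left,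
        MonoidalClosed.uncurry_curry, MonoidalClosed.uncurry_curry,
        BraidedCategory.braiding_naturality_right_assoc,
        BraidedCategory.braiding_naturality_right_assoc, hφ'])
  refine ⟨MonoidalClosed.curry ((β_ (coendObj F H) Z).hom ≫ MonoidalClosed.uncurry g), ?_, ?_⟩
  · intro t
    apply MonoidalClosed.uncurry_injective
    rw [key, MonoidalClosed.uncurry_curry, BraidedCategory.braiding_naturality_left_assoc,
      ← MonoidalClosed.uncurry_natural_left, hg, MonoidalClosed.uncurry_curry,
      SymmetricCategory.symmetry_assoc, Iso.inv_hom_id_assoc]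
  · intro f hf
    apply MonoidalClosed.uncurry_injective
    rw [MonoidalClosed.uncurry_curry, ← cancel_epi (β_ Z (coendObj F H)).hom,
      SymmetricCategory.symmetry_assoc]
    apply MonoidalClosed.curry_injective
    rw [MonoidalClosed.curry_uncurry]
    apply coend_hom_ext
    intro t
    rw [hg, ← MonoidalClosed.curry_natural_left, BraidedCategory.braiding_naturality_right_assoc]
    rw [← hf t, key, Iso.hom_inv_id_assoc]

/-- The `V`-category `V` has all small weighted colimits, computed as coends `∫ᵗ H t ⊗ F t`. -/
theorem exists_isColimit : ∃ (C : V) (c : WeightedCocone F H C), c.IsColimit :=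
  ⟨_, _, coendCocone_isColimit F H⟩

end

end Coend

section Examples

variable {V : Type v} [Category.{u} V] [MonoidalCategory V] [MonoidalClosed V]

/-- The representable `V`-functor `T(t, -) : T ⟶ V`. -/
def representable {T : Type u} [EnrichedCategory V T] (t : T) : EnrichedFunctor V T V where
  obj s := t ⟶[V] s
  map r s := MonoidalClosed.curry (eComp V t r s)
  map_id r := by
    apply MonoidalClosed.uncurry_injective
    rw [MonoidalClosed.uncurry_natural_left, MonoidalClosed.uncurry_curry]
    have h := tensorHom_eId_eComp (𝟙 (t ⟶[V] r))
    rw [id_tensorHom, Category.comp_id] at h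
    exact h.trans (uncurry_eId _).symm
  map_comp r s s' := by
    apply MonoidalClosed.uncurry_injective
    rw [uncurry_tensorHom_eComp, MonoidalClosed.uncurry_natural_left,
      MonoidalClosed.uncurry_curry, MonoidalClosed.uncurry_curry, MonoidalClosed.uncurry_curry]
    exact (e_assoc V t r s s').symm

/-- The type of objects of the unit `V`-category, with one object whose endomorphism object is the
unit object of `V`. -/
def UnitCat : Type u := PUnit

instance unitCat : EnrichedCategory V UnitCat.{u} where
  Hom _ _ := 𝟙_ V
  id _ := 𝟙 _
  comp _ _ _ := (λ_ (𝟙_ V)).hom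
  id_comp _ _ := by simp
  comp_id _ _ := by simp [unitors_equal]
  assoc _ _ _ _ := by simp [unitors_equal]

/-- The weight on the unit `V`-category given by an object `X` of `V`; limits weighted by it are
`X`-powers. -/
def powerWeight (X : V) : EnrichedFunctor V UnitCat.{u} V where
  obj _ := X
  map _ _ := eId V X
  map_id _ := Category.id_comp _
  map_comp _ _ _ := (eId_tensorHom_eComp _).symm

variable [SymmetricCategory V] [HasColimits V]

/-- The type of objects of the free `V`-category on an ordinary category `D`. -/
def FreeCat (D : Type u) : Type u := D

section

variable {D : Type u} [SmallCategory D]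

variable (V) in
/-- The hom-object `∐_{d ⟶ e} I` of the free `V`-category on `D`. -/
def FreeCat.Hom (d e : D) : V := ∐ fun _ : d ⟶ e => 𝟙_ V

variable (V) in
/-- The morphism `I ⟶ ∐_{d ⟶ e} I` corresponding to `f : d ⟶ e`. -/
def FreeCat.ι {d e : D} (f : d ⟶ e) : 𝟙_ V ⟶ FreeCat.Hom V d e :=
  Sigma.ι (fun _ : d ⟶ e => 𝟙_ V) f

/-- Morphisms out of `∐_{d ⟶ e} I`. -/
def FreeCat.desc {d e : D} {X : V} (φ : (d ⟶ e) → (𝟙_ V ⟶ X)) : FreeCat.Hom V d e ⟶ X :=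
  Sigma.desc φ

theorem FreeCat.ι_desc {d e : D} {X : V} (φ : (d ⟶ e) → (𝟙_ V ⟶ X)) (f : d ⟶ e) :
    FreeCat.ι V f ≫ FreeCat.desc φ = φ f :=
  Sigma.ι_desc _ _

theorem FreeCat.hom_ext {d e : D} {X : V} {h k : FreeCat.Hom V d e ⟶ X}
    (H : ∀ f : d ⟶ e, FreeCat.ι V f ≫ h = FreeCat.ι V f ≫ k) : h = k :=
  Sigma.hom_ext _ _ H

theorem FreeCat.hom_ext_left {d e : D} {X Y : V} {h k : FreeCat.Hom V d e ⊗ X ⟶ Y}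
    (H : ∀ f : d ⟶ e, FreeCat.ι V f ▷ X ≫ h = FreeCat.ι V f ▷ X ≫ k) : h = k := by
  rw [← cancel_epi (β_ X (FreeCat.Hom V d e)).hom]
  apply MonoidalClosed.curry_injective
  apply FreeCat.hom_ext
  intro f
  rw [← MonoidalClosed.curry_natural_left, ← MonoidalClosed.curry_natural_left,
    BraidedCategory.braiding_naturality_right_assoc,
    BraidedCategory.braiding_naturality_right_assoc, H]

theorem FreeCat.hom_ext_right {d e : D} {X Y : V} {h k : X ⊗ FreeCat.Hom V d e ⟶ Y}
    (H : ∀ f : d ⟶ e, X ◁ FreeCat.ι V f ≫ h = X ◁ FreeCat.ι V f ≫ k) : h = k := by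
  apply MonoidalClosed.curry_injective
  apply FreeCat.hom_ext
  intro f
  rw [← MonoidalClosed.curry_natural_left, ← MonoidalClosed.curry_natural_left, H]

variable (V) in
/-- The composition of the free `V`-category on `D`. -/
def FreeCat.comp (a b c : D) : FreeCat.Hom V a b ⊗ FreeCat.Hom V b c ⟶ FreeCat.Hom V a c :=
  MonoidalClosed.uncurry (FreeCat.desc fun g => MonoidalClosed.curry
    ((ρ_ _).hom ≫ FreeCat.desc fun f => FreeCat.ι V (f ≫ g)))

theorem FreeCat.whiskerLeft_ι_comp {a b c : D} (g : b ⟶ c) :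
    FreeCat.Hom V a b ◁ FreeCat.ι V g ≫ FreeCat.comp V a b c =
      (ρ_ _).hom ≫ FreeCat.desc fun f => FreeCat.ι V (f ≫ g) := by
  rw [FreeCat.comp, ← MonoidalClosed.uncurry_natural_left, FreeCat.ι_desc,
    MonoidalClosed.uncurry_curry]

theorem FreeCat.ι_comp {a b c : D} (f : a ⟶ b) (g : b ⟶ c) :
    (FreeCat.ι V f ⊗ₘ FreeCat.ι V g) ≫ FreeCat.comp V a b c =
      (λ_ _).hom ≫ FreeCat.ι V (f ≫ g) := by
  rw [MonoidalCategory.tensorHom_def, Category.assoc, FreeCat.whiskerLeft_ι_comp,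
    rightUnitor_naturality_assoc, FreeCat.ι_desc, unitors_equal]

theorem FreeCat.hom_ext_tensor {a b c d : D} {Y : V}
    {h k : FreeCat.Hom V a b ⊗ FreeCat.Hom V c d ⟶ Y}
    (H : ∀ (f : a ⟶ b) (g : c ⟶ d), (FreeCat.ι V f ⊗ₘ FreeCat.ι V g) ≫ h =
      (FreeCat.ι V f ⊗ₘ FreeCat.ι V g) ≫ k) : h = k := by
  apply FreeCat.hom_ext_right
  intro g
  apply FreeCat.hom_ext_left
  intro f
  rw [← MonoidalCategory.tensorHom_def_assoc, ← MonoidalCategory.tensorHom_def_assoc, H]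

theorem FreeCat.id_comp (a b : D) : (λ_ (FreeCat.Hom V a b)).inv ≫
    FreeCat.ι V (𝟙 a) ▷ _ ≫ FreeCat.comp V a a b = 𝟙 _ := by
  rw [Iso.inv_comp_eq, Category.comp_id]
  apply FreeCat.hom_ext_right
  intro f
  rw [← tensorHom_def'_assoc, FreeCat.ι_comp, leftUnitor_naturality, Category.id_comp]

theorem FreeCat.comp_id (a b : D) : (ρ_ (FreeCat.Hom V a b)).inv ≫
    _ ◁ FreeCat.ι V (𝟙 b) ≫ FreeCat.comp V a b b = 𝟙 _ := by
  rw [Iso.inv_comp_eq, Category.comp_id]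
  apply FreeCat.hom_ext_left
  intro f
  rw [← MonoidalCategory.tensorHom_def_assoc, FreeCat.ι_comp, rightUnitor_naturality,
    Category.comp_id, unitors_equal]

theorem FreeCat.assoc (a b c d : D) :
    (α_ (FreeCat.Hom V a b) (FreeCat.Hom V b c) (FreeCat.Hom V c d)).inv ≫
      FreeCat.comp V a b c ▷ _ ≫ FreeCat.comp V a c d =
    _ ◁ FreeCat.comp V b c d ≫ FreeCat.comp V a b d := by
  rw [Iso.inv_comp_eq]
  apply FreeCat.hom_ext_right
  intro h
  rw [← cancel_epi (ρ_ _).inv]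
  apply FreeCat.hom_ext_tensor
  intro f g
  have h1 : (FreeCat.ι V f ⊗ₘ FreeCat.ι V g) ≫ (ρ_ _).inv ≫ _ ◁ FreeCat.ι V h =
      (ρ_ _).inv ≫ ((FreeCat.ι V f ⊗ₘ FreeCat.ι V g) ⊗ₘ FreeCat.ι V h) := by
    rw [← Category.assoc, rightUnitor_inv_naturality, Category.assoc,
      ← MonoidalCategory.tensorHom_def]
  have h2 : ((FreeCat.ι V f ⊗ₘ FreeCat.ι V g) ⊗ₘ FreeCat.ι V h) ≫
      FreeCat.comp V a b c ▷ _ ≫ FreeCat.comp V a c d =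
      (λ_ _).hom ▷ _ ≫ (λ_ _).hom ≫ FreeCat.ι V ((f ≫ g) ≫ h) := by
    rw [← tensorHom_id, tensorHom_comp_tensorHom_assoc, FreeCat.ι_comp, Category.comp_id,
      comp_tensorHom, Category.assoc, FreeCat.ι_comp]
  have h3 : (FreeCat.ι V f ⊗ₘ (FreeCat.ι V g ⊗ₘ FreeCat.ι V h)) ≫
      _ ◁ FreeCat.comp V b c d ≫ FreeCat.comp V a b d =
      _ ◁ (λ_ _).hom ≫ (λ_ _).hom ≫ FreeCat.ι V (f ≫ g ≫ h) := by
    rw [← id_tensorHom, tensorHom_comp_tensorHom_assoc, FreeCat.ι_comp, Category.comp_id,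
      tensorHom_comp', Category.assoc, FreeCat.ι_comp]
  rw [reassoc_of% h1, reassoc_of% h1, h2, associator_naturality_assoc, h3, Category.assoc]
  simp [unitors_equal]

/-- The free `V`-category on an ordinary category `D`. -/
instance freeCat : EnrichedCategory V (FreeCat D) where
  Hom d e := FreeCat.Hom V (D := D) d e
  id d := FreeCat.ι V (𝟙 (show D from d))
  comp a b c := FreeCat.comp V (D := D) a b c
  id_comp a b := FreeCat.id_comp (D := D) a b
  comp_id a b := FreeCat.comp_id (D := D) a b
  assoc a b c d := FreeCat.assoc (D := D) a b c d

theorem FreeCat.desc_comp (a b c : D) :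
    FreeCat.comp V a b c ≫ FreeCat.desc (fun _ => eId V (𝟙_ V)) =
      (FreeCat.desc (fun _ => eId V (𝟙_ V)) ⊗ₘ FreeCat.desc (fun _ => eId V (𝟙_ V))) ≫
        eComp V (𝟙_ V) (𝟙_ V) (𝟙_ V) := by
  apply FreeCat.hom_ext_tensor
  intro f g
  rw [← Category.assoc, FreeCat.ι_comp, Category.assoc, FreeCat.ι_desc,
    tensorHom_comp_tensorHom_assoc, FreeCat.ι_desc, FreeCat.ι_desc, eId_tensorHom_eComp]

variable (V D) in
/-- The weight `FD ⟶ V` constant at the unit object; limits weighted by it are the conical limits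
of shape `D`. -/
def conicalWeight : EnrichedFunctor V (FreeCat D) V where
  obj _ := 𝟙_ V
  map _ _ := FreeCat.desc (D := D) fun _ => eId V (𝟙_ V)
  map_id d := FreeCat.ι_desc (D := D) _ _
  map_comp a b c := FreeCat.desc_comp (D := D) a b c

end

end Examples

section Statement

variable (V : Type v) [Category.{u} V] [MonoidalCategory V] [SymmetricCategory V]
  [MonoidalClosed V]

/-- A class of weights: a class of `V`-functors `A ⟶ V` with `A` a small `V`-category. -/
abbrev WeightClass := ∀ (A : Type u) [EnrichedCategory V A], EnrichedFunctor V A V → Prop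

variable {V}

/-- `K` has all limits weighted by members of `Φ`. -/
def IsComplete (Φ : WeightClass V) (K : Type w) [EnrichedCategory V K] : Prop :=
  ∀ (A : Type u) [EnrichedCategory V A] (W : EnrichedFunctor V A V), Φ A W →
    ∀ S : EnrichedFunctor V A K, ∃ (L : K) (c : WeightedCone W S L), c.IsLimit

/-- `G` preserves all limits weighted by members of `Φ`. -/
def IsContinuous (Φ : WeightClass V) {K : Type w} [EnrichedCategory V K] {K' : Type w'}
    [EnrichedCategory V K'] (G : EnrichedFunctor V K K') : Prop :=
  ∀ (A : Type u) [EnrichedCategory V A] (W : EnrichedFunctor V A V), Φ A W →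
    ∀ (S : EnrichedFunctor V A K) (L : K) (c : WeightedCone W S L), c.IsLimit → (c.map G).IsLimit

section

variable [HasLimits V]

/-- A class of weights is saturated if it contains the representables and is closed, in each
presheaf `V`-category `[A, V]` with `A` small, under colimits weighted by its own members. -/
def IsSaturated (Φ : WeightClass V) : Prop :=
  (∀ (A : Type u) [EnrichedCategory V A] (a : A), Φ A (representable a)) ∧
  ∀ (A : Type u) [EnrichedCategory V A] (D : Type u) [EnrichedCategory V D]
    (S : EnrichedFunctor V Dᵒᵖ (EnrichedFunctor V A V)) (F : EnrichedFunctor V D V)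
    (C : EnrichedFunctor V A V) (c : WeightedCocone F S C),
    (∀ d : D, Φ A (S.obj (op d))) → Φ D F → c.IsColimit → Φ A C

/-- The saturation of a class of weights: the smallest saturated class containing it. -/
def saturation (Φ : WeightClass V) : WeightClass V := fun A _ W =>
  ∀ Ψ : WeightClass V, IsSaturated Ψ →
    (∀ (B : Type u) [EnrichedCategory V B] (W' : EnrichedFunctor V B V), Φ B W' → Ψ B W') → Ψ A W

end

/-- `X` is strongly finitely presentable in the `V`-category `V`: the internal hom `[X, -]`
preserves sifted colimits. -/
def IsStronglyFinite (X : V) : Prop :=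
  ∀ (D : Type u) [SmallCategory D] [IsSifted D], PreservesColimitsOfShape D (ihom X)

/-- The weights for finite products and for powers by strongly finitely presentable objects of the
`V`-category `V`. -/
inductive IsFiniteProductOrPower [HasColimits V] :
    ∀ (A : Type u) [EnrichedCategory V A], EnrichedFunctor V A V → Prop
  | finiteProduct (n : ℕ) :
      IsFiniteProductOrPower (FreeCat (Discrete (ULift.{u} (Fin n)))) (conicalWeight V _)
  | power (X : V) (hX : IsStronglyFinite X) : IsFiniteProductOrPower UnitCat.{u} (powerWeight X)

variable (V) in
/-- The class of strongly finite limits. -/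
def stronglyFiniteWeights [HasLimits V] [HasColimits V] : WeightClass V :=
  saturation fun A _ W => IsFiniteProductOrPower A W

/-- A cocone in the underlying category of a `V`-category `K` is a conical colimit if each
`K(-, X)` sends it to a limit in `V`. -/
def IsConicalColimit {K : Type w} [EnrichedCategory V K] {D : Type u} [SmallCategory D]
    {S : D ⥤ ForgetEnrichment V K} (c : Cocone S) : Prop :=
  ∀ X : ForgetEnrichment V K,
    Nonempty (IsLimit (((eHomFunctor V (ForgetEnrichment V K)).flip.obj X).mapCone c.op))

section

variable [HasLimits V]

/-- `F` is the conical colimit in `[T, V]` of a sifted diagram of representables. -/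
def IsSiftedColimitOfRepresentables {T : Type u} [EnrichedCategory V T]
    (F : EnrichedFunctor V T V) : Prop :=
  ∃ (D : Type u) (_ : SmallCategory D) (_ : IsSifted D)
    (S : D ⥤ ForgetEnrichment V (EnrichedFunctor V T V)) (c : Cocone S),
    (∀ d : D, ∃ t : T, Nonempty (S.obj d ≅ ForgetEnrichment.of V (representable t))) ∧
    c.pt = ForgetEnrichment.of V F ∧ IsConicalColimit c

variable [HasColimits V]

/-- The `V`-functor `F * - : [Tᵒᵖ, V] ⟶ V` of colimits weighted by `F : T ⟶ V`. -/
def weightedColimit {T : Type u} [EnrichedCategory V T] (F : EnrichedFunctor V T V) :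
    EnrichedFunctor V (EnrichedFunctor V Tᵒᵖ V) V :=
  colimitFunctor F (coendObj F) (coendCocone F) (coendCocone_isColimit F)

/-- `W`-weighted limits commute in `V` with `F`-weighted colimits: for every `V`-functor `S` of two
variables `a : A`, `t : Tᵒᵖ`, the canonical comparison `F * {W, S} ⟶ {W, F * S}` is invertible.
Here `S` is given as a `V`-functor `A ⟶ [Tᵒᵖ, V]`, `M t = {W, S(-, t)}` and `Q = {W, F * S}`. -/
def CommutesInV {A : Type u} [EnrichedCategory V A] (W : EnrichedFunctor V A V)
    {T : Type u} [EnrichedCategory V T] (F : EnrichedFunctor V T V) : Prop :=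
  ∀ (S : EnrichedFunctor V A (EnrichedFunctor V Tᵒᵖ V)) (M : EnrichedFunctor V Tᵒᵖ V)
    (c : WeightedCone W S M), (∀ t : Tᵒᵖ, (c.map (evaluation t)).IsLimit) →
    ∀ (Q : V) (d : WeightedCone W (S.comp V (weightedColimit F)) Q), d.IsLimit →
      ∃ h : (weightedColimit F).obj M ⟶ Q, IsIso h ∧
        ∀ a : A, d.app a ≫ (MonoidalClosed.pre h).app ((weightedColimit F).obj (S.obj a)) =
          (c.map (weightedColimit F)).app a

/-- `F` is `Φ`-flat: `F`-weighted colimits commute in `V` with `Φ`-limits. -/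
def IsFlat (Φ : WeightClass V) {T : Type u} [EnrichedCategory V T]
    (F : EnrichedFunctor V T V) : Prop :=
  ∀ (A : Type u) [EnrichedCategory V A] (W : EnrichedFunctor V A V), Φ A W → CommutesInV W F

/-- Axiom A for `Φ`: if `T` is small and has `Φ`-limits and `F : T ⟶ V` is `Φ`-continuous, then so
is `F * - : [Tᵒᵖ, V] ⟶ V`. -/
def AxiomA (Φ : WeightClass V) : Prop :=
  ∀ (T : Type u) [EnrichedCategory V T], IsComplete Φ T →
    ∀ F : EnrichedFunctor V T V, IsContinuous Φ F → IsContinuous Φ (weightedColimit F)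

end

end Statement

section Presentable

variable {C : Type v} [Category.{u} C]

/-- `X` is strongly finitely presentable in the ordinary category `C`: the functor `C(X, -)`
preserves sifted colimits. -/
def IsStronglyFinitelyPresentable (X : C) : Prop :=
  ∀ (D : Type u) [SmallCategory D] [IsSifted D], PreservesColimitsOfShape D (coyoneda.obj (op X))

variable (C) in
/-- `C` is locally strongly finitely presentable: it is cocomplete and there is a small set of
strongly finitely presentable objects such that every object is a sifted colimit of objects
isomorphic to members of the set. -/
def IsLocallyStronglyFinitelyPresentable : Prop :=
  HasColimits C ∧ ∃ (ι : Type u) (G : ι → C), (∀ i, IsStronglyFinitelyPresentable (G i)) ∧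
    ∀ X : C, ∃ (D : Type u) (_ : SmallCategory D) (_ : IsSifted D) (S : D ⥤ C) (c : Cocone S),
      (∀ d : D, ∃ i, Nonempty (S.obj d ≅ G i)) ∧ c.pt = X ∧ Nonempty (IsColimit c)

/-- `V` is locally strongly finitely presentable as a `⊗`-category: it is locally strongly finitely
presentable and its strongly finitely presentable objects are closed under the tensor product
(the unit object need not be strongly finitely presentable). -/
def IsLocallyStronglyFinitelyPresentableTensor (V : Type v) [Category.{u} V]
    [MonoidalCategory V] : Prop :=
  IsLocallyStronglyFinitelyPresentable V ∧
    ∀ X Y : V, IsStronglyFinitelyPresentable X → IsStronglyFinitelyPresentable Y →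
      IsStronglyFinitelyPresentable (X ⊗ Y)

end Presentable

end

end EnrichedTheories

set_option linter.unusedSectionVars false

namespace EnrichedTheories

noncomputable section

/-! ### `V`-functors to `V` as modules, and their hom-objects -/

section Modules

variable {V : Type v} [Category.{u} V] [MonoidalCategory V] [SymmetricCategory V]
  [MonoidalClosed V]
variable {A : Type u} [EnrichedCategory V A]

/-! (1) implies (2). The functor `[A, V](W, -)` preserves pointwise sifted colimits for every weight
`W` in the class `Φ` of strongly finite weights. Weights with this property form a saturated class:
a representable gives evaluation, by Yoneda, and `[A, V](G * S, X) ≅ [D, V](G, [A, V](S-, X))`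
handles weighted colimits. The generating weights belong to it: the powers by the definition of a
strongly finite object, the finite products because sifted colimits commute with finite products of
sets, which passes to `V` by testing against strongly finitely presentable objects
(`isColimit_of_coyoneda`). For a pointwise limit cone with vertex `M` over `S`, the comparison `F *
M ⟶ {W, F * S}` is natural in `F`, and both sides preserve sifted colimits in `F`. When `F = T(t,
-)` the functor `F * -` is evaluation at `t`, so the comparison is invertible there, and hence for
every sifted colimit of representables.

(2) implies (3). Flatness is applied to limit cones of `T` pushed along the Yoneda embedding `Y : T
⟶ [Tᵒᵖ, V]`, which preserves limits pointwise; since `F * Y- ≅ F`, the functor `F` preserves the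
original limits.

(3) implies (1). The diagram is the category `RepOver F` of representables over `F`, whose morphisms
are the `V`-natural maps over `F`. If `T` has a limit `L = {W, S}` and `N` preserves it, then by
Yoneda maps `T(L, -) ⟶ N` are the same as `V`-natural families `W a ⟶ N (S a)`
(`existsUnique_repHom`); this is used for `N = F` and for `N` representable. For finite products it
makes `RepOver F` non-empty with binary coproducts, hence sifted. For powers by a strongly finitely
presentable `G` it yields a universal map `G ⟶ T(L, s)`, through which each map from `G` into the
value at `s` of an `N` of this kind factors by a unique `T(L, -) ⟶ N`. So after applying `V₀(G, -)`
at `s`, each fibre of the canonical cocone has a weakly initial element and the cocone is a colimit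
of sets; such `G` detect sifted colimits. Closure under `⊗` makes `G` an admissible exponent,
because `V₀(H, [G, -]) ≅ V₀(G ⊗ H, -)`. Testing with all `G` instead of with `I` is why the unit
need not be presentable.

Axiom A follows from (3) implies (1) and the argument for (1) implies (2), as limits in `[Tᵒᵖ, V]`
are pointwise. -/

theorem act_id (X : EnrichedFunctor V A V) (a : A) :
    X.obj a ◁ eId V a ≫ act X a a = (ρ_ (X.obj a)).hom := by
  rw [act, ← MonoidalClosed.uncurry_natural_left, X.map_id, uncurry_eId]

theorem uncurry_map_comp {K : Type w} [EnrichedCategory V K] (Q : EnrichedFunctor V K V)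
    (a b c : K) : Q.obj a ◁ eComp V a b c ≫ MonoidalClosed.uncurry (Q.map a c) =
      (α_ _ _ _).inv ≫ MonoidalClosed.uncurry (Q.map a b) ▷ (b ⟶[V] c) ≫
        MonoidalClosed.uncurry (Q.map b c) := by
  rw [← MonoidalClosed.uncurry_natural_left, Q.map_comp, uncurry_tensorHom_eComp]

theorem act_comp (X : EnrichedFunctor V A V) (a b c : A) :
    X.obj a ◁ eComp V a b c ≫ act X a c =
      (α_ _ _ _).inv ≫ act X a b ▷ (b ⟶[V] c) ≫ act X b c :=
  uncurry_map_comp X a b c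

/-- The `V`-functor `A ⟶ V` with prescribed action `X a ⊗ A(a, b) ⟶ X b`. -/
def ofAct (X : A → V) (m : ∀ a b, X a ⊗ (a ⟶[V] b) ⟶ X b)
    (hid : ∀ a, X a ◁ eId V a ≫ m a a = (ρ_ (X a)).hom)
    (hcomp : ∀ a b c, X a ◁ eComp V a b c ≫ m a c =
      (α_ _ _ _).inv ≫ m a b ▷ (b ⟶[V] c) ≫ m b c) : EnrichedFunctor V A V where
  obj := X
  map a b := MonoidalClosed.curry (m a b)
  map_id a := by
    apply MonoidalClosed.uncurry_injective
    rw [MonoidalClosed.uncurry_natural_left, MonoidalClosed.uncurry_curry, hid, uncurry_eId]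
  map_comp a b c := by
    apply MonoidalClosed.uncurry_injective
    rw [uncurry_tensorHom_eComp, MonoidalClosed.uncurry_natural_left,
      MonoidalClosed.uncurry_curry, MonoidalClosed.uncurry_curry, MonoidalClosed.uncurry_curry,
      hcomp]

theorem act_ofAct (X : A → V) (m : ∀ a b, X a ⊗ (a ⟶[V] b) ⟶ X b) (hid hcomp) (a b : A) :
    act (ofAct X m hid hcomp) a b = m a b :=
  MonoidalClosed.uncurry_curry _

theorem act_representable (a b c : A) :
    act (representable (V := V) a) b c = eComp V a b c :=
  MonoidalClosed.uncurry_curry _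

/-- A `V`-natural transformation between `V`-functors `A ⟶ V`. -/
@[ext]
structure CopresheafHom (X Y : EnrichedFunctor V A V) where
  /-- The components. -/
  app (a : A) : X.obj a ⟶ Y.obj a
  naturality (a b : A) : act X a b ≫ app b = app a ▷ (a ⟶[V] b) ≫ act Y a b

/-- The ordinary category of `V`-functors `A ⟶ V` and `V`-natural transformations. -/
instance copresheafCategory : Category (EnrichedFunctor V A V) where
  Hom X Y := CopresheafHom X Y
  id X := ⟨fun _ => 𝟙 _, fun _ _ => by simp⟩
  comp f g := ⟨fun a => f.app a ≫ g.app a, fun a b => by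
    rw [reassoc_of% f.naturality a b, g.naturality, comp_whiskerRight, Category.assoc]⟩

/-- The components of a morphism of `[A, V]`. -/
def compo {X Y : EnrichedFunctor V A V} (f : X ⟶ Y) (a : A) :
    X.obj a ⟶ Y.obj a :=
  CopresheafHom.app f a

/-- The morphism of `[A, V]` with prescribed components. -/
def mkHom {X Y : EnrichedFunctor V A V} (φ : ∀ a, X.obj a ⟶ Y.obj a)
    (h : ∀ a b, act X a b ≫ φ b = φ a ▷ (a ⟶[V] b) ≫ act Y a b) :
    X ⟶ Y :=
  CopresheafHom.mk φ h

@[simp]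
theorem compo_mkHom {X Y : EnrichedFunctor V A V} (φ : ∀ a, X.obj a ⟶ Y.obj a) (h) (a : A) :
    compo (mkHom (X := X) (Y := Y) φ h) a = φ a := rfl

@[simp]
theorem compo_id (X : EnrichedFunctor V A V) (a : A) : compo (𝟙 X) a = 𝟙 _ := rfl

@[simp]
theorem compo_comp {X Y Z : EnrichedFunctor V A V} (f : X ⟶ Y) (g : Y ⟶ Z) (a : A) :
    compo (f ≫ g) a = compo f a ≫ compo g a := rfl

theorem copresheaf_hom_ext {X Y : EnrichedFunctor V A V} {f g : X ⟶ Y}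
    (h : ∀ a, compo f a = compo g a) : f = g :=
  CopresheafHom.ext (funext h)

theorem compo_naturality {X Y : EnrichedFunctor V A V} (f : X ⟶ Y) (a b : A) :
    act X a b ≫ compo f b = compo f a ▷ (a ⟶[V] b) ≫ act Y a b :=
  CopresheafHom.naturality f a b

theorem compo_naturality_assoc {X Y : EnrichedFunctor V A V} (f : X ⟶ Y) (a b : A) {Z : V}
    (k : Y.obj b ⟶ Z) :
    act X a b ≫ compo f b ≫ k = compo f a ▷ (a ⟶[V] b) ≫ act Y a b ≫ k := by
  rw [← Category.assoc, compo_naturality, Category.assoc]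

variable (V) in
/-- Evaluation at `a`, as an ordinary functor. -/
def evalAt (a : A) : EnrichedFunctor V A V ⥤ V where
  obj X := X.obj a
  map f := compo f a

/-- A morphism of `[A, V]` with invertible components is invertible. -/
theorem copresheaf_isIso {X Y : EnrichedFunctor V A V} (f : X ⟶ Y) [∀ a, IsIso (compo f a)] :
    IsIso f := by
  refine ⟨mkHom (fun a => inv (compo f a)) fun a b => ?_, copresheaf_hom_ext fun a => ?_,
    copresheaf_hom_ext fun a => ?_⟩
  · rw [← cancel_epi (compo f a ▷ (a ⟶[V] b)), ← compo_naturality_assoc, IsIso.hom_inv_id,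
      ← comp_whiskerRight_assoc, IsIso.hom_inv_id, id_whiskerRight, Category.id_comp,
      Category.comp_id]
  · rw [compo_comp, compo_mkHom, IsIso.hom_inv_id, compo_id]
  · rw [compo_comp, compo_mkHom, IsIso.inv_hom_id, compo_id]

/-- `V`-naturality of a family `ψ a : Z ⊗ W a ⟶ X a`. -/
def IsEquivariant (W X : EnrichedFunctor V A V) {Z : V} (ψ : ∀ a, Z ⊗ W.obj a ⟶ X.obj a) : Prop :=
  ∀ a b : A, Z ◁ act W a b ≫ ψ b = (α_ _ _ _).inv ≫ ψ a ▷ (a ⟶[V] b) ≫ act X a b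

theorem IsEquivariant.whiskerRight_comp {W X : EnrichedFunctor V A V} {Z Z' : V}
    {ψ : ∀ a, Z ⊗ W.obj a ⟶ X.obj a} (h : IsEquivariant W X ψ) (f : Z' ⟶ Z) :
    IsEquivariant W X (fun a => f ▷ W.obj a ≫ ψ a) := by
  intro a b
  dsimp only
  rw [whisker_exchange_assoc, h a b, comp_whiskerRight, Category.assoc,
    associator_inv_naturality_left_assoc]

theorem IsEquivariant.comp_compo {W X Y : EnrichedFunctor V A V} {Z : V}
    {ψ : ∀ a, Z ⊗ W.obj a ⟶ X.obj a}
    (h : IsEquivariant W X ψ) (f : X ⟶ Y) : IsEquivariant W Y (fun a => ψ a ≫ compo f a) := by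
  intro a b
  dsimp only
  rw [reassoc_of% (h a b), comp_whiskerRight, Category.assoc, compo_naturality]

variable [HasLimits V]

/-- Transposition turns the hom-valued naturality condition into compatibility with actions. The
braiding appears because `uncurry` places the argument `W a` on the left, whereas equivariant
families keep the parameter `Z` there. -/
theorem isNatFamily_iff (W X : EnrichedFunctor V A V) {Z : V}
    (φ : ∀ a, Z ⟶ (ihom (W.obj a)).obj (X.obj a)) :
    IsNatFamily W X φ ↔
      IsEquivariant W X (fun a => (β_ Z (W.obj a)).hom ≫ MonoidalClosed.uncurry (φ a)) := by
  refine forall_congr' fun a => forall_congr' fun b => ?_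
  rw [← MonoidalClosed.uncurry_injective.eq_iff, uncurry_tensorHom_eComp,
    MonoidalClosed.uncurry_natural_left, uncurry_tensorHom_eComp,
    -- The cancelled isomorphism moves `Z` past both other factors, to the place where the uncurried
    -- equation has it.
    ← cancel_epi ((β_ Z (W.obj a ⊗ (a ⟶[V] b))).hom ≫ (α_ _ _ _).hom)]
  have e1 : Z ◁ act W a b ≫ (β_ Z (W.obj b)).hom ≫ MonoidalClosed.uncurry (φ b) =
      ((β_ Z (W.obj a ⊗ (a ⟶[V] b))).hom ≫ (α_ _ _ _).hom) ≫ (α_ _ _ _).inv ≫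
        MonoidalClosed.uncurry (W.map a b) ▷ Z ≫ MonoidalClosed.uncurry (φ b) := by
    rw [BraidedCategory.braiding_naturality_right_assoc, Category.assoc, Iso.hom_inv_id_assoc]
    rfl
  have e2 : (α_ Z (W.obj a) (a ⟶[V] b)).inv ≫
      ((β_ Z (W.obj a)).hom ≫ MonoidalClosed.uncurry (φ a)) ▷ (a ⟶[V] b) ≫ act X a b =
      ((β_ Z (W.obj a ⊗ (a ⟶[V] b))).hom ≫ (α_ _ _ _).hom) ≫
        W.obj a ◁ (β_ (a ⟶[V] b) Z).hom ≫ (α_ _ _ _).inv ≫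
        MonoidalClosed.uncurry (φ a) ▷ (a ⟶[V] b) ≫ MonoidalClosed.uncurry (X.map a b) := by
    rw [BraidedCategory.braiding_tensor_right_hom]
    simp only [Category.assoc, Iso.inv_hom_id_assoc, comp_whiskerRight]
    rw [← whiskerLeft_comp_assoc, SymmetricCategory.symmetry, whiskerLeft_id, Category.id_comp,
      Iso.hom_inv_id_assoc]
    rfl
  dsimp only
  rw [e1, e2]

section

variable (W X : EnrichedFunctor V A V)

/-- The counit `[A, V](W, X) ⊗ W a ⟶ X a`. -/
def natEv (a : A) : natObj W X ⊗ W.obj a ⟶ X.obj a :=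
  (β_ _ _).hom ≫ MonoidalClosed.uncurry (natObjπ W X a)

theorem natEv_isEquivariant : IsEquivariant W X (natEv W X) :=
  (isNatFamily_iff W X _).1 (natObjπ_isNatFamily W X)

theorem curry_natEv (a : A) :
    MonoidalClosed.curry ((β_ _ _).hom ≫ natEv W X a) = natObjπ W X a := by
  rw [natEv, SymmetricCategory.symmetry_assoc, MonoidalClosed.curry_uncurry]

/-- The morphism `Z ⟶ [A, V](W, X)` corresponding to an equivariant family. -/
def natLift {Z : V} (ψ : ∀ a, Z ⊗ W.obj a ⟶ X.obj a) (h : IsEquivariant W X ψ) :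
    Z ⟶ natObj W X :=
  natObjLift W X (fun a => MonoidalClosed.curry ((β_ _ _).hom ≫ ψ a)) (by
    rw [isNatFamily_iff]
    simpa only [MonoidalClosed.uncurry_curry, SymmetricCategory.symmetry_assoc] using h)

@[simp]
theorem natLift_ev {Z : V} (ψ : ∀ a, Z ⊗ W.obj a ⟶ X.obj a) (h : IsEquivariant W X ψ) (a : A) :
    natLift W X ψ h ▷ W.obj a ≫ natEv W X a = ψ a := by
  rw [natEv, BraidedCategory.braiding_naturality_left_assoc, ← MonoidalClosed.uncurry_natural_left,
    natLift, natObjLift_π, MonoidalClosed.uncurry_curry, SymmetricCategory.symmetry_assoc]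

@[simp]
theorem natLift_ev_assoc {Z : V} (ψ : ∀ a, Z ⊗ W.obj a ⟶ X.obj a) (h : IsEquivariant W X ψ)
    (a : A) {Q : V} (k : X.obj a ⟶ Q) :
    natLift W X ψ h ▷ W.obj a ≫ natEv W X a ≫ k = ψ a ≫ k := by
  rw [← Category.assoc, natLift_ev]

variable {W X}

theorem natObj_ext {Z : V} {f g : Z ⟶ natObj W X}
    (h : ∀ a, f ▷ W.obj a ≫ natEv W X a = g ▷ W.obj a ≫ natEv W X a) : f = g := by
  apply natObj_hom_ext
  intro a
  rw [← curry_natEv, ← MonoidalClosed.curry_natural_left, ← MonoidalClosed.curry_natural_left,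
    BraidedCategory.braiding_naturality_right_assoc,
    BraidedCategory.braiding_naturality_right_assoc, h]

end

/-- The morphism `[A, V](W, X) ⟶ [A, V](W, Y)` induced by `f : X ⟶ Y`. -/
def natMap (W : EnrichedFunctor V A V) {X Y : EnrichedFunctor V A V} (f : X ⟶ Y) :
    natObj W X ⟶ natObj W Y :=
  natLift W Y _ ((natEv_isEquivariant W X).comp_compo f)

@[simp]
theorem natMap_ev (W : EnrichedFunctor V A V) {X Y : EnrichedFunctor V A V} (f : X ⟶ Y) (a : A) :
    natMap W f ▷ W.obj a ≫ natEv W Y a = natEv W X a ≫ compo f a :=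
  natLift_ev W Y _ ((natEv_isEquivariant W X).comp_compo f) a

@[simp]
theorem natMap_ev_assoc (W : EnrichedFunctor V A V) {X Y : EnrichedFunctor V A V} (f : X ⟶ Y)
    (a : A) {Q : V} (k : Y.obj a ⟶ Q) :
    natMap W f ▷ W.obj a ≫ natEv W Y a ≫ k = natEv W X a ≫ compo f a ≫ k := by
  rw [← Category.assoc, natMap_ev, Category.assoc]

/-- The ordinary functor `[A, V](W, -)`. -/
def natFunctor (W : EnrichedFunctor V A V) : EnrichedFunctor V A V ⥤ V where
  obj X := natObj W X
  map f := natMap W f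
  map_id X := by
    apply natObj_ext
    intro a
    simp
  map_comp f g := by
    apply natObj_ext
    intro a
    simp

/-- Composition in `[A, V]` is written in diagrammatic order, so the two hom-objects must be
exchanged before they act successively on `W a`. -/
theorem eComp_natEv (W X Y : EnrichedFunctor V A V) (a : A) :
    eComp V W X Y ▷ W.obj a ≫ natEv W Y a =
      (β_ (natObj W X) (natObj X Y)).hom ▷ W.obj a ≫ (α_ _ _ _).hom ≫
        natObj X Y ◁ natEv W X a ≫ natEv X Y a := by
  have h := congrArg MonoidalClosed.uncurry (eComp_evalπ W X Y a)
  rw [uncurry_tensorHom_eComp, MonoidalClosed.uncurry_natural_left] at h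
  have h1 : eComp V W X Y ▷ W.obj a ≫ natEv W Y a = (β_ (natObj W X ⊗ natObj X Y) _).hom ≫
      W.obj a ◁ eComp V W X Y ≫ MonoidalClosed.uncurry (evalπ W Y a) :=
    BraidedCategory.braiding_naturality_left_assoc _ _ _
  have h2 : ∀ P Q R : V, (β_ (P ⊗ Q) R).hom ≫ (α_ _ _ _).inv =
      (β_ P Q).hom ▷ R ≫ (α_ _ _ _).hom ≫ Q ◁ (β_ P R).hom ≫ (β_ Q (R ⊗ P)).hom := by
    intro P Q R
    rw [BraidedCategory.braiding_naturality_right, BraidedCategory.braiding_tensor_left_hom,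
      BraidedCategory.braiding_tensor_right_hom]
    simp only [Category.assoc, Iso.hom_inv_id_assoc, Iso.hom_inv_id, Category.comp_id]
    rw [← comp_whiskerRight_assoc, SymmetricCategory.symmetry, id_whiskerRight, Category.id_comp]
  rw [h1, h]
  simp only [natEv, Category.assoc, whiskerLeft_comp]
  rw [BraidedCategory.braiding_naturality_right_assoc]
  exact (reassoc_of% (h2 (natObj W X) (natObj X Y) (W.obj a))) _

end Modules

/-! ### Weighted limits in `V` -/

section Cones

variable {V : Type v} [Category.{u} V] [MonoidalCategory V] [SymmetricCategory V]
  [MonoidalClosed V]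
variable {A : Type u} [EnrichedCategory V A] {K : Type w} [EnrichedCategory V K]

/-- The family `L ⊗ W a ⟶ S a` corresponding to a weighted cone with vertex `L` in `V`. -/
def coneAct {W S : EnrichedFunctor V A V} {L : V} (c : WeightedCone W S L) (a : A) :
    L ⊗ W.obj a ⟶ S.obj a :=
  MonoidalClosed.uncurry (c.app a)

theorem coneAct_isEquivariant {W S : EnrichedFunctor V A V} {L : V} (c : WeightedCone W S L) :
    IsEquivariant W S (coneAct c) := by
  intro a b
  have h := congrArg MonoidalClosed.uncurry (c.naturality a b)
  rw [uncurry_tensorHom_eComp, MonoidalClosed.uncurry_natural_left] at h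
  exact h

/-- The weighted cone with vertex `L` in `V` corresponding to an equivariant family. -/
def coneOfAct {W S : EnrichedFunctor V A V} {L : V} (ψ : ∀ a, L ⊗ W.obj a ⟶ S.obj a)
    (h : IsEquivariant W S ψ) : WeightedCone W S L where
  app a := MonoidalClosed.curry (ψ a)
  naturality a b := by
    apply MonoidalClosed.uncurry_injective
    rw [uncurry_tensorHom_eComp, MonoidalClosed.uncurry_natural_left,
      MonoidalClosed.uncurry_curry, MonoidalClosed.uncurry_curry]
    exact h a b

theorem coneAct_coneOfAct {W S : EnrichedFunctor V A V} {L : V}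
    (ψ : ∀ a, L ⊗ W.obj a ⟶ S.obj a) (h : IsEquivariant W S ψ) (a : A) :
    coneAct (coneOfAct ψ h) a = ψ a :=
  MonoidalClosed.uncurry_curry _

/-- The test object `X` of the enriched universal property can be absorbed into the parameter by
transposition. This is why limits in `V` can be tested on families `Z ⊗ W a ⟶ S a` alone. -/
theorem isGradedCone_iff (W S : EnrichedFunctor V A V) {X Z : V}
    (φ : ∀ a, Z ⊗ W.obj a ⟶ (ihom X).obj (S.obj a)) :
    IsGradedCone W S φ ↔ IsEquivariant W S (Z := X ⊗ Z)
      (fun a => (α_ X Z (W.obj a)).hom ≫ MonoidalClosed.uncurry (φ a)) := by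
  refine forall_congr' fun a => forall_congr' fun b => ?_
  rw [← MonoidalClosed.uncurry_injective.eq_iff, MonoidalClosed.uncurry_natural_left,
    MonoidalClosed.uncurry_natural_left, uncurry_tensorHom_eComp,
    ← cancel_epi (α_ X Z (W.obj a ⊗ (a ⟶[V] b))).hom, ← associator_naturality_right_assoc,
    comp_whiskerRight, Category.assoc]
  have h : ∀ {P Q R S Y : V} (k : (P ⊗ Q ⊗ R) ⊗ S ⟶ Y),
      (α_ P Q (R ⊗ S)).hom ≫ P ◁ (α_ Q R S).inv ≫ (α_ P (Q ⊗ R) S).inv ≫ k =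
      (α_ (P ⊗ Q) R S).inv ≫ (α_ P Q R).hom ▷ S ≫ k := by
    intros
    monoidal
  rw [h]
  rfl

theorem uncurry_tensorHom_cone {W S : EnrichedFunctor V A V} {L : V} (c : WeightedCone W S L)
    {X Z : V} (f : Z ⟶ (ihom X).obj L) (a : A) :
    (α_ X Z (W.obj a)).hom ≫ MonoidalClosed.uncurry ((f ⊗ₘ c.app a) ≫ eComp V X L (S.obj a)) =
      MonoidalClosed.uncurry f ▷ W.obj a ≫ coneAct c a := by
  rw [uncurry_tensorHom_eComp, Iso.hom_inv_id_assoc]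
  rfl

/-- The elementary form of the universal property of a weighted limit in `V`. -/
theorem isLimit_iff {W S : EnrichedFunctor V A V} {L : V} (c : WeightedCone W S L) :
    c.IsLimit ↔ ∀ (Z : V) (ψ : ∀ a, Z ⊗ W.obj a ⟶ S.obj a), IsEquivariant W S ψ →
      ∃! f : Z ⟶ L, ∀ a, f ▷ W.obj a ≫ coneAct c a = ψ a := by
  have key : ∀ {X Z : V} (f : Z ⟶ (ihom X).obj L) (φ : ∀ a, Z ⊗ W.obj a ⟶ (ihom X).obj (S.obj a)),
      (∀ a, (f ⊗ₘ c.app a) ≫ eComp V X L (S.obj a) = φ a) ↔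
      ∀ a, MonoidalClosed.uncurry f ▷ W.obj a ≫ coneAct c a =
        (α_ X Z (W.obj a)).hom ≫ MonoidalClosed.uncurry (φ a) := by
    intro X Z f φ
    refine forall_congr' fun a => ?_
    rw [← uncurry_tensorHom_cone, cancel_epi]
    exact MonoidalClosed.uncurry_injective.eq_iff.symm
  constructor
  -- The elementary property is the enriched one at `X = I`, up to `I ⊗ Z ≅ Z`.
  · intro hc Z ψ hψ
    have hψ' := hψ.whiskerRight_comp (λ_ Z).hom
    let φ : ∀ a, Z ⊗ W.obj a ⟶ (ihom (𝟙_ V)).obj (S.obj a) := fun a =>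
      MonoidalClosed.curry ((α_ _ _ _).inv ≫ (λ_ Z).hom ▷ W.obj a ≫ ψ a)
    have hφ : ∀ a, (α_ (𝟙_ V) Z (W.obj a)).hom ≫ MonoidalClosed.uncurry (φ a) =
        (λ_ Z).hom ▷ W.obj a ≫ ψ a := by
      intro a
      rw [MonoidalClosed.uncurry_curry, Iso.hom_inv_id_assoc]
    obtain ⟨f, hf, hu⟩ := hc (𝟙_ V) Z φ ((isGradedCone_iff W S φ).2 (by simpa only [hφ] using hψ'))
    refine ⟨(λ_ Z).inv ≫ MonoidalClosed.uncurry f, fun a => ?_, fun g hg => ?_⟩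
    · have h := (key f φ).1 hf a
      rw [hφ] at h
      rw [comp_whiskerRight, Category.assoc, h, ← comp_whiskerRight_assoc, Iso.inv_hom_id,
        id_whiskerRight, Category.id_comp]
    · rw [Iso.eq_inv_comp]
      have := hu (MonoidalClosed.curry ((λ_ Z).hom ≫ g)) ((key _ φ).2 fun a => by
        rw [hφ, MonoidalClosed.uncurry_curry, comp_whiskerRight, Category.assoc, hg])
      rw [← this, MonoidalClosed.uncurry_curry]
  -- Conversely the enriched property at `X` and `Z` is the elementary one at `X ⊗ Z`.
  · intro hc X Z φ hφ
    obtain ⟨f, hf, hu⟩ := hc (X ⊗ Z) _ ((isGradedCone_iff W S φ).1 hφ)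
    refine ⟨MonoidalClosed.curry f, (key _ φ).2 ?_, fun g hg => ?_⟩
    · rwa [MonoidalClosed.uncurry_curry]
    · rw [← hu _ ((key g φ).1 hg), MonoidalClosed.curry_uncurry]

theorem coneAct_map {W : EnrichedFunctor V A V} {S : EnrichedFunctor V A K} {L : K}
    (c : WeightedCone W S L) (Q : EnrichedFunctor V K V) (a : A) :
    coneAct (c.map Q) a =
      Q.obj L ◁ c.app a ≫ MonoidalClosed.uncurry (Q.map L (S.obj a)) :=
  MonoidalClosed.uncurry_natural_left _ _

theorem act_comp_functor (S : EnrichedFunctor V A K) (Q : EnrichedFunctor V K V) (a b : A) :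
    act (S.comp V Q) a b = Q.obj (S.obj a) ◁ S.map a b ≫
      MonoidalClosed.uncurry (Q.map (S.obj a) (S.obj b)) :=
  MonoidalClosed.uncurry_natural_left _ _

/-- The `V`-functor `K(X, -) : K ⟶ V`. -/
def homFunctor (X : K) : EnrichedFunctor V K V where
  obj Y := X ⟶[V] Y
  map Y Z := MonoidalClosed.curry (eComp V X Y Z)
  map_id Y := by
    apply MonoidalClosed.uncurry_injective
    rw [MonoidalClosed.uncurry_natural_left, MonoidalClosed.uncurry_curry]
    have h := tensorHom_eId_eComp (𝟙 (X ⟶[V] Y))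
    rw [id_tensorHom, Category.comp_id] at h
    exact h.trans (uncurry_eId _).symm
  map_comp Y Y' Z := by
    apply MonoidalClosed.uncurry_injective
    rw [uncurry_tensorHom_eComp, MonoidalClosed.uncurry_natural_left,
      MonoidalClosed.uncurry_curry, MonoidalClosed.uncurry_curry, MonoidalClosed.uncurry_curry]
    exact (e_assoc V X Y Y' Z).symm

/-- The universal property of `L` is already expressed by generalized elements of `K(X, L)`, so it
transfers directly. -/
theorem isLimit_map_homFunctor {W : EnrichedFunctor V A V} {S : EnrichedFunctor V A K} {L : K}
    (c : WeightedCone W S L) (hc : c.IsLimit) (X : K) : (c.map (homFunctor X)).IsLimit := by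
  rw [isLimit_iff]
  intro Z ψ hψ
  have h1 : ∀ {P : V} (f : P ⟶ (X ⟶[V] L)) a, f ▷ W.obj a ≫ coneAct (c.map (homFunctor X)) a =
      (f ⊗ₘ c.app a) ≫ eComp V X L (S.obj a) := by
    intro P f a
    rw [coneAct_map, MonoidalCategory.tensorHom_def, Category.assoc]
    congr 2
    exact MonoidalClosed.uncurry_curry _
  have h2 : ∀ ψ : ∀ a, Z ⊗ W.obj a ⟶ (X ⟶[V] S.obj a),
      IsEquivariant W (S.comp V (homFunctor X)) ψ → IsGradedCone W S ψ := by
    intro ψ hψ a b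
    refine (hψ a b).trans ?_
    rw [MonoidalCategory.tensorHom_def, Category.assoc]
    congr 2
    refine (act_comp_functor _ _ _ _).trans ?_
    congr 1
    exact MonoidalClosed.uncurry_curry _
  obtain ⟨f, hf, hu⟩ := hc X Z ψ (h2 ψ hψ)
  exact ⟨f, fun a => (h1 f a).trans (hf a), fun g hg => hu g fun a => (h1 g a).symm.trans (hg a)⟩

variable [HasLimits V]

/-- The hom-object `[A, V](W, S)` with its counit is a universal cone. Being a limit thus becomes
invertibility of one comparison morphism, which can be followed along natural isomorphisms and
colimits. -/
theorem isLimit_iff_isIso {W S : EnrichedFunctor V A V} {L : V} (c : WeightedCone W S L) :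
    c.IsLimit ↔ IsIso (natLift W S (coneAct c) (coneAct_isEquivariant c)) := by
  rw [isLimit_iff]
  constructor
  · intro h
    obtain ⟨g, hg, -⟩ := h _ _ (natEv_isEquivariant W S)
    refine ⟨g, ?_, ?_⟩
    · refine (h L _ (coneAct_isEquivariant c)).unique (fun a => ?_) (fun a => ?_)
      · rw [comp_whiskerRight, Category.assoc, hg, natLift_ev]
      · rw [id_whiskerRight, Category.id_comp]
    · apply natObj_ext
      intro a
      rw [comp_whiskerRight, Category.assoc, natLift_ev, hg, id_whiskerRight, Category.id_comp]
  · intro h Z ψ hψ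
    refine ⟨natLift W S ψ hψ ≫ inv (natLift W S (coneAct c) (coneAct_isEquivariant c)),
      fun a => ?_, fun g hg => ?_⟩
    · rw [← natLift_ev W S (coneAct c) (coneAct_isEquivariant c), ← comp_whiskerRight_assoc,
        Category.assoc, IsIso.inv_hom_id, Category.comp_id, natLift_ev]
    · rw [IsIso.eq_comp_inv]
      apply natObj_ext
      intro a
      rw [comp_whiskerRight, Category.assoc, natLift_ev, natLift_ev, hg]

/-- Transport of limit cones along a `V`-natural isomorphism. -/
theorem isLimit_of_iso {W S S' : EnrichedFunctor V A V} {L L' : V} (c : WeightedCone W S L)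
    (c' : WeightedCone W S' L') (e : L ⟶ L') [IsIso e] (f : S ⟶ S') [IsIso f]
    (h : ∀ a, e ▷ W.obj a ≫ coneAct c' a = coneAct c a ≫ compo f a) (hc : c.IsLimit) :
    c'.IsLimit := by
  rw [isLimit_iff_isIso] at hc ⊢
  have h1 : natLift W S (coneAct c) (coneAct_isEquivariant c) ≫ natMap W f =
      e ≫ natLift W S' (coneAct c') (coneAct_isEquivariant c') := by
    apply natObj_ext
    intro a
    rw [comp_whiskerRight, comp_whiskerRight, Category.assoc, Category.assoc, natLift_ev, h,
      natMap_ev, natLift_ev_assoc]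
  have : IsIso (natMap W f) := inferInstanceAs (IsIso ((natFunctor W).map f))
  exact (IsIso.eq_inv_comp e).2 h1.symm ▸ inferInstance

/-- Transport of limit cones along a `V`-natural isomorphism between `V`-functors `K ⟶ V`. -/
theorem isLimit_map_of_natIso {W : EnrichedFunctor V A V} {S : EnrichedFunctor V A K} {L : K}
    (c : WeightedCone W S L) {Q Q' : EnrichedFunctor V K V} (θ : ∀ k, Q.obj k ⟶ Q'.obj k)
    [∀ k, IsIso (θ k)] (hθ : ∀ k l, MonoidalClosed.uncurry (Q.map k l) ≫ θ l =
      θ k ▷ (k ⟶[V] l) ≫ MonoidalClosed.uncurry (Q'.map k l))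
    (hc : (c.map Q).IsLimit) : (c.map Q').IsLimit := by
  let f : S.comp V Q ⟶ S.comp V Q' := mkHom (fun a => θ (S.obj a)) fun a b => by
    change MonoidalClosed.uncurry (S.map a b ≫ Q.map (S.obj a) (S.obj b)) ≫ θ (S.obj b) =
      θ (S.obj a) ▷ _ ≫ MonoidalClosed.uncurry (S.map a b ≫ Q'.map (S.obj a) (S.obj b))
    rw [MonoidalClosed.uncurry_natural_left, MonoidalClosed.uncurry_natural_left, Category.assoc,
      hθ, whisker_exchange_assoc]
  have : ∀ a, IsIso (compo f a) := fun a => inferInstanceAs (IsIso (θ (S.obj a)))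
  have := copresheaf_isIso f
  refine isLimit_of_iso (c.map Q) (c.map Q') (θ L) f (fun a => ?_) hc
  change θ L ▷ _ ≫ MonoidalClosed.uncurry (c.app a ≫ Q'.map L (S.obj a)) =
    MonoidalClosed.uncurry (c.app a ≫ Q.map L (S.obj a)) ≫ θ (S.obj a)
  rw [MonoidalClosed.uncurry_natural_left, MonoidalClosed.uncurry_natural_left, Category.assoc,
    hθ, whisker_exchange_assoc]

/-- `V` has all small weighted limits. -/
theorem exists_isLimit (W S : EnrichedFunctor V A V) :
    ∃ (L : V) (c : WeightedCone W S L), c.IsLimit := by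
  refine ⟨natObj W S, coneOfAct (natEv W S) (natEv_isEquivariant W S), ?_⟩
  rw [isLimit_iff]
  intro Z ψ hψ
  refine ⟨natLift W S ψ hψ, fun a => ?_, fun g hg => ?_⟩
  · rw [coneAct_coneOfAct, natLift_ev]
  · apply natObj_ext
    intro a
    rw [← coneAct_coneOfAct (natEv W S) (natEv_isEquivariant W S), hg, coneAct_coneOfAct,
      natLift_ev]

/-- Commutation of `F`-weighted colimits with `W`-weighted limits, in terms of the images of
pointwise limit cones. -/
theorem commutesInV_iff [HasColimits V] (W : EnrichedFunctor V A V) {T : Type u}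
    [EnrichedCategory V T] (F : EnrichedFunctor V T V) :
    CommutesInV W F ↔ ∀ (S : EnrichedFunctor V A (EnrichedFunctor V Tᵒᵖ V))
      (M : EnrichedFunctor V Tᵒᵖ V) (c : WeightedCone W S M),
      (∀ t : Tᵒᵖ, (c.map (evaluation t)).IsLimit) → (c.map (weightedColimit F)).IsLimit := by
  -- After uncurrying, `pre h` is whiskering by `h`, so the compatibility in the definition of
  -- commutation says that `h` is a morphism of cones.
  have key : ∀ {S : EnrichedFunctor V A V} {L Q : V} (h : L ⟶ Q) (c : WeightedCone W S L)
      (d : WeightedCone W S Q) (a : A), d.app a ≫ (MonoidalClosed.pre h).app (S.obj a) = c.app a ↔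
        h ▷ W.obj a ≫ coneAct d a = coneAct c a := by
    intro S L Q h c d a
    rw [← MonoidalClosed.uncurry_injective.eq_iff]
    exact Eq.congr (MonoidalClosed.uncurry_pre_app (S.obj a) (d.app a) h) rfl
  constructor
  · intro H S M c hc
    obtain ⟨Q, d, hd⟩ := exists_isLimit W (S.comp V (weightedColimit F))
    obtain ⟨h, hh, hcd⟩ := H S M c hc Q d hd
    rw [isLimit_iff] at hd ⊢
    intro Z ψ hψ
    obtain ⟨f, hf, hu⟩ := hd Z ψ hψ
    refine ⟨f ≫ inv h, fun a => ?_, fun g hg => ?_⟩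
    · rw [← (key h _ d a).1 (hcd a), ← comp_whiskerRight_assoc, Category.assoc, IsIso.inv_hom_id,
        Category.comp_id, hf]
    · rw [IsIso.eq_comp_inv]
      refine hu _ fun a => ?_
      rw [comp_whiskerRight, Category.assoc, (key h _ d a).1 (hcd a), hg]
  · intro H S M c hc Q d hd
    have hcl := (isLimit_iff _).1 (H S M c hc)
    rw [isLimit_iff] at hd
    obtain ⟨h, hh, -⟩ := hd _ _ (coneAct_isEquivariant (c.map (weightedColimit F)))
    obtain ⟨g, hg, -⟩ := hcl _ _ (coneAct_isEquivariant d)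
    refine ⟨h, ⟨g, ?_, ?_⟩, fun a => (key h _ d a).2 (hh a)⟩
    · refine (hcl _ _ (coneAct_isEquivariant (c.map (weightedColimit F)))).unique
        (fun a => ?_) (fun a => ?_)
      · rw [comp_whiskerRight, Category.assoc, hg, hh]
      · rw [id_whiskerRight, Category.id_comp]
    · refine (hd _ _ (coneAct_isEquivariant d)).unique (fun a => ?_) (fun a => ?_)
      · rw [comp_whiskerRight, Category.assoc, hh, hg]
      · rw [id_whiskerRight, Category.id_comp]

end Cones

/-! ### The enriched Yoneda lemma and pointwise limits -/

section Yoneda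

variable {V : Type v} [Category.{u} V] [MonoidalCategory V] [SymmetricCategory V]
  [MonoidalClosed V] [HasLimits V]
variable {B : Type u} [EnrichedCategory V B]

/-- The unit `I ⟶ B(b, b)` as a morphism to the value of the representable at `b`. -/
def repUnit (b : B) : 𝟙_ V ⟶ (representable (V := V) b).obj b := eId V b

/-- The action of `B` on `M` as a family of morphisms `M b ⊗ B(b, c) ⟶ M c`. -/
def repAct (b : B) (M : EnrichedFunctor V B V) (c : B) :
    M.obj b ⊗ (representable (V := V) b).obj c ⟶ M.obj c := act M b c

theorem repAct_isEquivariant (b : B) (M : EnrichedFunctor V B V) :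
    IsEquivariant (representable b) M (repAct b M) := by
  intro c d
  rw [act_representable]
  exact act_comp M b c d

theorem repUnit_repAct (b : B) (M : EnrichedFunctor V B V) :
    M.obj b ◁ repUnit b ≫ repAct b M b = (ρ_ (M.obj b)).hom :=
  act_id M b

/-- An equivariant family out of a representable is determined by its value on the identity: `ψ (z,
f) = ψ (z, 𝟙) · f`. This is the substance of the Yoneda lemma. -/
theorem IsEquivariant.repUnit_repAct {b : B} {M : EnrichedFunctor V B V} {Z : V}
    {ψ : ∀ c, Z ⊗ (representable (V := V) b).obj c ⟶ M.obj c}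
    (h : IsEquivariant (representable b) M ψ) (c : B) :
    ((ρ_ Z).inv ≫ Z ◁ repUnit b ≫ ψ b) ▷ (representable (V := V) b).obj c ≫ repAct b M c =
      ψ c := by
  have key : ∀ ψ : ∀ c, Z ⊗ (b ⟶[V] c) ⟶ M.obj c, IsEquivariant (representable b) M ψ →
      ((ρ_ Z).inv ≫ Z ◁ eId V b ≫ ψ b) ▷ (b ⟶[V] c) ≫ act M b c = ψ c := by
    intro ψ h
    have h1 : Z ◁ eComp V b b c ≫ ψ c = (α_ _ _ _).inv ≫ ψ b ▷ _ ≫ act M b c := by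
      rw [← act_representable]; exact h b c
    rw [eq_comm, Iso.inv_comp_eq] at h1
    have h2 := e_id_comp V b c
    rw [Iso.inv_comp_eq, Category.comp_id] at h2
    rw [comp_whiskerRight, comp_whiskerRight, Category.assoc, Category.assoc, h1,
      associator_naturality_middle_assoc, ← whiskerLeft_comp_assoc, h2]
    simp
  exact key ψ h

/-- The Yoneda morphism `[B, V](B(b, -), M) ⟶ M b`. -/
def yonedaEv (b : B) (M : EnrichedFunctor V B V) : natObj (representable b) M ⟶ M.obj b :=
  (ρ_ _).inv ≫ natObj (representable b) M ◁ repUnit b ≫ natEv (representable b) M b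

/-- The inverse `M b ⟶ [B, V](B(b, -), M)` of the Yoneda morphism. -/
def yonedaInv (b : B) (M : EnrichedFunctor V B V) : M.obj b ⟶ natObj (representable b) M :=
  natLift (representable b) M _ (repAct_isEquivariant b M)

theorem yonedaInv_ev (b : B) (M : EnrichedFunctor V B V) : yonedaInv b M ≫ yonedaEv b M = 𝟙 _ := by
  rw [yonedaEv, rightUnitor_inv_naturality_assoc, ← whisker_exchange_assoc, yonedaInv, natLift_ev,
    repUnit_repAct, Iso.inv_hom_id]

theorem yonedaEv_inv (b : B) (M : EnrichedFunctor V B V) : yonedaEv b M ≫ yonedaInv b M = 𝟙 _ := by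
  apply natObj_ext
  intro c
  rw [comp_whiskerRight, Category.assoc, yonedaInv, natLift_ev, id_whiskerRight, Category.id_comp,
    yonedaEv, (natEv_isEquivariant (representable b) M).repUnit_repAct]

theorem isIso_yonedaEv (b : B) (M : EnrichedFunctor V B V) : IsIso (yonedaEv b M) :=
  ⟨yonedaInv b M, yonedaEv_inv b M, yonedaInv_ev b M⟩

theorem natMap_yonedaEv (b : B) {M N : EnrichedFunctor V B V} (f : M ⟶ N) :
    natMap (representable b) f ≫ yonedaEv b N = yonedaEv b M ≫ compo f b := by
  rw [yonedaEv, yonedaEv, rightUnitor_inv_naturality_assoc, ← whisker_exchange_assoc, natMap_ev]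
  simp only [Category.assoc]

/-- This is the `V`-naturality in `M` of the Yoneda isomorphism, as needed to carry limit cones from
the hom functor out of `B(b, -)` to evaluation at `b`. -/
theorem eComp_yonedaEv (b : B) (M N : EnrichedFunctor V B V) :
    eComp V (representable b) M N ≫ yonedaEv b N =
      yonedaEv b M ▷ natObj M N ≫ MonoidalClosed.uncurry (evalπ M N b) := by
  have h0 : MonoidalClosed.uncurry (evalπ M N b) = (β_ (M.obj b) (natObj M N)).hom ≫
      natEv M N b := by
    rw [natEv, SymmetricCategory.symmetry_assoc]
    rfl
  have h1 : ∀ {P Q E X Y : V} (e : 𝟙_ V ⟶ E) (k : P ⊗ E ⟶ X) (l : Q ⊗ X ⟶ Y),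
      (ρ_ (P ⊗ Q)).inv ≫ (P ⊗ Q) ◁ e ≫ (β_ P Q).hom ▷ E ≫ (α_ _ _ _).hom ≫ Q ◁ k ≫ l =
      ((ρ_ P).inv ≫ P ◁ e ≫ k) ▷ Q ≫ (β_ X Q).hom ≫ l := by
    intro P Q E X Y e k l
    rw [BraidedCategory.braiding_naturality_left_assoc, whisker_exchange_assoc,
      ← rightUnitor_inv_naturality_assoc]
    simp
  have h2 : ∀ c : natObj (representable b) M ⊗ natObj M N ⟶ natObj (representable b) N,
      c ≫ yonedaEv b N = (ρ_ _).inv ≫ _ ◁ repUnit b ≫ c ▷ _ ≫ natEv (representable b) N b := by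
    intro c
    rw [yonedaEv, rightUnitor_inv_naturality_assoc, ← whisker_exchange_assoc]
  rw [h0]
  refine (h2 _).trans ?_
  erw [eComp_natEv]
  exact h1 _ _ _

/-- Weighted limits in `[B, V]` are computed pointwise. -/
theorem isLimit_map_evaluation {A : Type u} [EnrichedCategory V A] {W : EnrichedFunctor V A V}
    {S : EnrichedFunctor V A (EnrichedFunctor V B V)} {M : EnrichedFunctor V B V}
    (c : WeightedCone W S M) (hc : c.IsLimit) (b : B) : (c.map (evaluation b)).IsLimit := by
  -- Evaluation at `b` is isomorphic to the hom functor out of the representable at `b`, and hom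
  -- functors preserve weighted limits.
  have : ∀ M : EnrichedFunctor V B V, @IsIso V _ ((homFunctor (representable b)).obj M)
      ((evaluation b).obj M) (yonedaEv b M) := isIso_yonedaEv b
  refine isLimit_map_of_natIso c (Q := homFunctor (representable b)) (Q' := evaluation b)
    (fun M => yonedaEv b M) (fun M N => ?_) (isLimit_map_homFunctor c hc _)
  refine Eq.trans ?_ (eComp_yonedaEv b M N)
  congr 1
  exact MonoidalClosed.uncurry_curry _

/-- The functor `[B, V](B(b, -), -)` is evaluation at `b`. -/
def natFunctorRepresentable (b : B) : natFunctor (V := V) (representable b) ≅ evalAt V b :=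
  NatIso.ofComponents (fun M => @asIso _ _ _ _ (yonedaEv b M) (isIso_yonedaEv b M)) (fun f => natMap_yonedaEv b f)

end Yoneda

/-! ### Homs out of a weighted colimit -/

section HomFrom

variable {V : Type v} [Category.{u} V] [MonoidalCategory V] [SymmetricCategory V]
  [MonoidalClosed V]

/-- Both composites reverse the order of the three factors. -/
theorem braiding_shuffle (P Q R : V) :
    (α_ P Q R).inv ≫ (β_ P Q).hom ▷ R ≫ (β_ (Q ⊗ P) R).hom =
      (β_ P (Q ⊗ R)).hom ≫ (β_ Q R).hom ▷ P ≫ (α_ R Q P).hom := by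
  rw [BraidedCategory.braiding_tensor_left_hom, BraidedCategory.braiding_tensor_right_hom]
  simp

variable {D : Type u} [EnrichedCategory V D] {K : Type w} [EnrichedCategory V K]

/-- The action of `D` on the hom-objects `K(S d, X)`. -/
def homFromAct (S : EnrichedFunctor V Dᵒᵖ K) (X : K) (d e : D) :
    (S.obj (op d) ⟶[V] X) ⊗ (d ⟶[V] e) ⟶ (S.obj (op e) ⟶[V] X) :=
  (β_ _ _).hom ≫ (show (d ⟶[V] e) ⟶ _ from S.map (op e) (op d)) ▷ _ ≫ eComp V _ _ X

/-- The `V`-functor `K(S-, X) : D ⟶ V`. -/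
def homFrom (S : EnrichedFunctor V Dᵒᵖ K) (X : K) : EnrichedFunctor V D V :=
  ofAct (fun d => S.obj (op d) ⟶[V] X) (homFromAct S X)
    (fun d => by
      have h : eId V d ≫ (show (d ⟶[V] d) ⟶ _ from S.map (op d) (op d)) = eId V (S.obj (op d)) :=
        S.map_id (op d)
      rw [homFromAct, BraidedCategory.braiding_naturality_right_assoc, ← comp_whiskerRight_assoc, h,
        ← tensorHom_id, eId_tensorHom_eComp, braiding_leftUnitor_assoc, Category.comp_id])
    (fun d e f => by
      have h : eComp V d e f ≫ (show (d ⟶[V] f) ⟶ _ from S.map (op f) (op d)) =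
          (β_ _ _).hom ≫ ((show (e ⟶[V] f) ⟶ _ from S.map (op f) (op e)) ⊗ₘ
            (show (d ⟶[V] e) ⟶ _ from S.map (op e) (op d))) ≫ eComp V _ _ _ := by
        have h1 := S.map_comp (op f) (op e) (op d)
        rw [eComp_op_eq, Category.assoc] at h1
        rw [← h1]
        exact (SymmetricCategory.symmetry_assoc _ _ _).symm
      have h2 := eComp_tensorHom_eComp (show (e ⟶[V] f) ⟶ _ from S.map (op f) (op e))
        (show (d ⟶[V] e) ⟶ _ from S.map (op e) (op d)) (𝟙 (S.obj (op d) ⟶[V] X))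
      rw [homFromAct, BraidedCategory.braiding_naturality_right_assoc, ← comp_whiskerRight_assoc, h,
        ← tensorHom_id, comp_tensorHom, Category.assoc, h2,
        ← reassoc_of% (braiding_shuffle (S.obj (op d) ⟶[V] X) (d ⟶[V] e) (e ⟶[V] f))]
      simp only [homFromAct, comp_whiskerRight, Category.assoc,
        BraidedCategory.braiding_naturality_left_assoc, tensorHom_id]
      rw [tensorHom_def'_assoc, ]
      simp only [whiskerLeft_comp, Category.assoc])

theorem act_homFrom (S : EnrichedFunctor V Dᵒᵖ K) (X : K) (d e : D) :
    act (homFrom S X) d e = homFromAct S X d e :=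
  act_ofAct _ _ _ _ _ _

/-- Cocones under `S` with vertex `X` become equivariant families with values in the `V`-functor
`K(S-, X)`; colimits in `K` are thereby controlled by limits in `V`. -/
theorem isGradedCocone_iff (G : EnrichedFunctor V D V) (S : EnrichedFunctor V Dᵒᵖ K) {X : K} {Z : V}
    (φ : ∀ d, G.obj d ⊗ Z ⟶ (S.obj (op d) ⟶[V] X))
    (ψ : ∀ d, Z ⊗ G.obj d ⟶ (homFrom S X).obj d) (h : ∀ d, ψ d = (β_ Z (G.obj d)).hom ≫ φ d) :
    IsGradedCocone G S φ ↔ IsEquivariant G (homFrom S X) ψ := by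
  have key : ∀ a b : D, ((α_ (a ⟶[V] b) (G.obj a) Z).inv ≫
      ((β_ (a ⟶[V] b) (G.obj a)).hom ≫ act G a b) ▷ Z ≫ φ b =
        ((show (a ⟶[V] b) ⟶ _ from S.map (op b) (op a)) ⊗ₘ φ a) ≫
          eComp V (S.obj (op b)) (S.obj (op a)) X) ↔
      Z ◁ act G a b ≫ (β_ _ _).hom ≫ φ b = (α_ _ _ _).inv ≫ ((β_ _ _).hom ≫ φ a) ▷ _ ≫
        homFromAct S X a b := by
    intro a b
    rw [← cancel_epi ((α_ Z (G.obj a) (a ⟶[V] b)).inv ≫ (β_ _ _).hom ▷ _ ≫ (β_ _ _).hom)]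
    refine Eq.congr ?_ ?_
    · rw [braiding_shuffle]
      simp only [Category.assoc, Iso.hom_inv_id_assoc, comp_whiskerRight]
      rw [← comp_whiskerRight_assoc, SymmetricCategory.symmetry, id_whiskerRight, Category.id_comp,
        BraidedCategory.braiding_naturality_right_assoc]
    · simp only [homFromAct, comp_whiskerRight, Category.assoc,
        BraidedCategory.braiding_naturality_left_assoc]
      rw [tensorHom_def'_assoc]
  refine forall_congr' fun a => forall_congr' fun b => (key a b).trans ?_
  rw [act_homFrom, h, h]
  exact Iff.rfl

variable [HasLimits V]

section

variable {G : EnrichedFunctor V D V} {S : EnrichedFunctor V Dᵒᵖ K} {C : K}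
  (c : WeightedCocone G S C) (X : K)

/-- The family `K(C, X) ⊗ G d ⟶ K(S d, X)` induced by a weighted cocone. -/
def coconeAct (d : D) : (C ⟶[V] X) ⊗ G.obj d ⟶ (homFrom S X).obj d :=
  (β_ _ _).hom ≫ c.app d ▷ _ ≫ eComp V _ C X

theorem whiskerRight_coconeAct {Z : V} (f : Z ⟶ (C ⟶[V] X)) (d : D) :
    f ▷ G.obj d ≫ coconeAct c X d = (β_ _ _).hom ≫ (c.app d ⊗ₘ f) ≫ eComp V _ C X := by
  rw [tensorHom_def'_assoc, ← BraidedCategory.braiding_naturality_left_assoc]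
  rfl

theorem coconeAct_isEquivariant : IsEquivariant G (homFrom S X) (coconeAct c X) :=
  (isGradedCocone_iff G S _ _ fun d => by rw [tensorHom_id]; rfl).1
    (c.isGradedCocone (𝟙 (C ⟶[V] X)))

/-- In other words, `K(G * S, X)` is the limit `{G, K(S-, X)}` in `V`. -/
theorem existsUnique_coconeAct (hc : c.IsColimit) {Z : V}
    (φ : ∀ d, Z ⊗ G.obj d ⟶ (homFrom S X).obj d) (hφ : IsEquivariant G (homFrom S X) φ) :
    ∃! f : Z ⟶ (C ⟶[V] X), ∀ d, f ▷ G.obj d ≫ coconeAct c X d = φ d := by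
  have h := hc X Z (fun d => (β_ _ _).hom ≫ φ d) ((isGradedCocone_iff G S _ φ fun d => by
    exact (SymmetricCategory.symmetry_assoc _ _ _).symm).2 hφ)
  refine (existsUnique_congr fun f => forall_congr' fun d => ?_).1 h
  rw [whiskerRight_coconeAct, ← cancel_epi (β_ Z (G.obj d)).hom]
  exact Eq.congr rfl (SymmetricCategory.symmetry_assoc _ _ _)

/-- The comparison `K(C, X) ⟶ [D, V](G, K(S-, X))` of a weighted cocone. -/
def coconeComparison : (C ⟶[V] X) ⟶ natObj G (homFrom S X) :=
  natLift G (homFrom S X) _ (coconeAct_isEquivariant c X)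

theorem isIso_coconeComparison (hc : c.IsColimit) : IsIso (coconeComparison c X) := by
  obtain ⟨g, hg, -⟩ := existsUnique_coconeAct c X hc _ (natEv_isEquivariant G (homFrom S X))
  refine ⟨g, (existsUnique_coconeAct c X hc _ (coconeAct_isEquivariant c X)).unique
    (fun d => ?_) (fun d => ?_), ?_⟩
  · rw [comp_whiskerRight, Category.assoc, hg, coconeComparison, natLift_ev]
  · rw [id_whiskerRight, Category.id_comp]
  · apply natObj_ext
    intro d
    rw [comp_whiskerRight, Category.assoc, coconeComparison, natLift_ev, hg, id_whiskerRight,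
      Category.id_comp]

end

section

variable {A : Type u} [EnrichedCategory V A]

/-- Associativity of composition in `[A, V]`, with the last factor an ordinary morphism; the
naturality in `X` of `K(S-, X)` and of the colimit comparison both reduce to it. -/
theorem eComp_natMap (W X : EnrichedFunctor V A V) {Y Z : EnrichedFunctor V A V} (f : Y ⟶ Z) :
    eComp V W X Y ≫ natMap W f = natObj W X ◁ natMap X f ≫ eComp V W X Z := by
  apply natObj_ext
  intro a
  rw [comp_whiskerRight, comp_whiskerRight, Category.assoc, Category.assoc, natMap_ev]
  erw [reassoc_of% (eComp_natEv W X Y a), eComp_natEv W X Z a]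
  rw [← comp_whiskerRight_assoc, BraidedCategory.braiding_naturality_right, comp_whiskerRight,
    Category.assoc, associator_naturality_left_assoc, ← whisker_exchange_assoc, natMap_ev]

variable (S : EnrichedFunctor V Dᵒᵖ (EnrichedFunctor V A V))

/-- The morphism `[A, V](S-, X) ⟶ [A, V](S-, Y)` induced by `f : X ⟶ Y`. -/
def homFromMap {X Y : EnrichedFunctor V A V} (f : X ⟶ Y) : homFrom S X ⟶ homFrom S Y :=
  mkHom (fun d => natMap (S.obj (op d)) f) (fun d e => by
    rw [act_homFrom, act_homFrom]
    change ((β_ (natObj _ X) (d ⟶[V] e)).hom ≫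
      (show (d ⟶[V] e) ⟶ natObj _ _ from S.map (op e) (op d)) ▷ natObj _ _ ≫
        eComp V (S.obj (op e)) (S.obj (op d)) X) ≫ natMap (S.obj (op e)) f =
      natMap (S.obj (op d)) f ▷ (d ⟶[V] e) ≫ (β_ (natObj _ Y) (d ⟶[V] e)).hom ≫
      (show (d ⟶[V] e) ⟶ natObj _ _ from S.map (op e) (op d)) ▷ natObj _ _ ≫
        eComp V (S.obj (op e)) (S.obj (op d)) Y
    rw [Category.assoc, Category.assoc, eComp_natMap, ← whisker_exchange_assoc,
      BraidedCategory.braiding_naturality_left_assoc])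

/-- The ordinary functor `[A, V] ⥤ [D, V]` sending `X` to `[A, V](S-, X)`. -/
def homFromFunctor : EnrichedFunctor V A V ⥤ EnrichedFunctor V D V where
  obj X := homFrom S X
  map f := homFromMap S f
  map_id X := copresheaf_hom_ext fun d => (natFunctor (S.obj (op d))).map_id X
  map_comp f g := copresheaf_hom_ext fun d => (natFunctor (S.obj (op d))).map_comp f g

variable {S}

theorem coconeComparison_natural {G : EnrichedFunctor V D V} {C : EnrichedFunctor V A V}
    (c : WeightedCocone G S C) {X Y : EnrichedFunctor V A V} (f : X ⟶ Y) :
    natMap C f ≫ coconeComparison c Y = coconeComparison c X ≫ natMap G (homFromMap S f) := by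
  apply natObj_ext
  intro d
  rw [comp_whiskerRight, comp_whiskerRight, Category.assoc, Category.assoc, natMap_ev,
    coconeComparison, coconeComparison, natLift_ev, natLift_ev_assoc]
  change natMap C f ▷ G.obj d ≫ (β_ (natObj C Y) (G.obj d)).hom ≫
      (show G.obj d ⟶ natObj _ _ from c.app d) ▷ natObj _ _ ≫ eComp V _ C Y =
    ((β_ (natObj C X) (G.obj d)).hom ≫
      (show G.obj d ⟶ natObj _ _ from c.app d) ▷ natObj _ _ ≫ eComp V _ C X) ≫
        natMap (S.obj (op d)) f
  rw [Category.assoc, Category.assoc, eComp_natMap, ← whisker_exchange_assoc,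
    BraidedCategory.braiding_naturality_left_assoc]

/-- For a colimit `C = G * S` in `[A, V]`, the functor `[A, V](C, -)` is the composite of
`[A, V](S-, -)` and `[D, V](G, -)`. -/
def natFunctorColimit {G : EnrichedFunctor V D V} {C : EnrichedFunctor V A V}
    (c : WeightedCocone G S C) (hc : c.IsColimit) :
    natFunctor C ≅ homFromFunctor S ⋙ natFunctor G :=
  NatIso.ofComponents
    (fun X => @asIso _ _ _ _ (coconeComparison c X) (isIso_coconeComparison c X hc))
    (fun f => coconeComparison_natural c f)

end

end HomFrom

/-! ### Weights whose limits commute with sifted colimits -/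

section PreservesSifted

variable {V : Type v} [Category.{u} V] [MonoidalCategory V] [SymmetricCategory V]
  [MonoidalClosed V] [HasLimits V]

/-- The functor `[A, V](W, -)` preserves pointwise sifted colimits. -/
def PreservesSiftedColimits {A : Type u} [EnrichedCategory V A] (W : EnrichedFunctor V A V) :
    Prop :=
  ∀ (J : Type u) [SmallCategory J] [IsSifted J] (X : J ⥤ EnrichedFunctor V A V) (c : Cocone X),
    (∀ a, Nonempty (IsColimit ((evalAt V a).mapCocone c))) →
      Nonempty (IsColimit ((natFunctor W).mapCocone c))

/-- A representable weight gives evaluation. For `C = F * S` the functor `[A, V](C, -)` first forms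
`d ↦ [A, V](S d, -)`, which keeps the colimit pointwise by the assumption on each `S d`, and then
applies `[D, V](F, -)`. -/
theorem isSaturated_preservesSiftedColimits :
    IsSaturated (V := V) (fun A _ W => PreservesSiftedColimits (A := A) W) := by
  refine ⟨fun A _ a J _ _ X c hc => ?_, fun A _ D _ S F C c hS hF hc J _ _ X t ht => ?_⟩
  · exact (hc a).map fun h => IsColimit.mapCoconeEquiv (natFunctorRepresentable a).symm h
  · have h1 := hF J (X ⋙ homFromFunctor S) ((homFromFunctor S).mapCocone t) (fun d => hS d J X t ht)
    exact h1.map fun h => IsColimit.mapCoconeEquiv (natFunctorColimit c hc).symm h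

end PreservesSifted

/-! ### Detection by strongly finitely presentable objects -/

section Presentable

variable {C : Type v} [Category.{u} C]

/-- A morphism is invertible if composition with it is bijective on morphisms out of strongly
finitely presentable objects. -/
theorem isIso_of_bijective_comp (hC : IsLocallyStronglyFinitelyPresentable C) {X Y : C} (f : X ⟶ Y)
    (hf : ∀ G : C, IsStronglyFinitelyPresentable G →
      Function.Bijective (fun g : G ⟶ X => g ≫ f)) : IsIso f := by
  obtain ⟨-, ι, G, hG, hS⟩ := hC
  -- An arbitrary test object `Z` is a colimit of objects isomorphic to generators, so bijectivity
  -- on maps out of `Z` is assembled from bijectivity on maps out of these.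
  rw [isIso_iff_yoneda_map_bijective]
  intro Z
  obtain ⟨D, _, _, S, c, hd, rfl, ⟨hc⟩⟩ := hS Z
  have hb : ∀ d, Function.Bijective (fun g : S.obj d ⟶ X => g ≫ f) := by
    intro d
    obtain ⟨i, ⟨e⟩⟩ := hd d
    refine ⟨fun g g' h => ?_, fun g => ?_⟩
    · rw [← cancel_epi e.inv]
      exact (hf _ (hG i)).1 (by simpa using e.inv ≫= h)
    · obtain ⟨g', hg'⟩ := (hf _ (hG i)).2 (e.inv ≫ g)
      refine ⟨e.hom ≫ g', ?_⟩
      dsimp only at hg' ⊢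
      rw [Category.assoc, hg', Iso.hom_inv_id_assoc]
  refine ⟨fun g g' h => hc.hom_ext fun d => (hb d).1 ?_, fun g => ?_⟩
  · simpa using c.ι.app d ≫= h
  · choose k hk using fun d => (hb d).2 (c.ι.app d ≫ g)
    refine ⟨hc.desc ⟨X, { app := k, naturality := fun d e φ => (hb d).1 ?_ }⟩,
      hc.hom_ext fun d => ?_⟩
    · have := hk d
      have := hk e
      dsimp only at *
      simp [*]
    · have := hk d
      simpa using this

/-- A sifted cocone is a colimit cocone if this is so after applying `C(G, -)` for each strongly
finitely presentable `G`. -/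
theorem isColimit_of_coyoneda (hC : IsLocallyStronglyFinitelyPresentable C) {J : Type u}
    [SmallCategory J] [IsSifted J] {X : J ⥤ C} (c : Cocone X)
    (hc : ∀ G : C, IsStronglyFinitelyPresentable G →
      Nonempty (IsColimit ((coyoneda.obj (op G)).mapCocone c))) : Nonempty (IsColimit c) := by
  have := hC.1
  -- The comparison from the chosen colimit is tested against each `G`. There it becomes the
  -- canonical isomorphism between two colimits of the same diagram of sets, because `C(G, -)`
  -- preserves the first and by assumption sends `c` to a colimit cocone.
  have : IsIso ((colimit.isColimit X).desc c) := by
    refine isIso_of_bijective_comp hC _ fun G hG => ?_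
    obtain ⟨h2⟩ := hc G hG
    have := hG J
    have h1 := isColimitOfPreserves (coyoneda.obj (op G)) (colimit.isColimit X)
    have h3 : (coyoneda.obj (op G)).map ((colimit.isColimit X).desc c) =
        (h1.coconePointUniqueUpToIso h2).hom := by
      refine h1.hom_ext fun j => ?_
      rw [IsColimit.comp_coconePointUniqueUpToIso_hom]
      change (coyoneda.obj (op G)).map _ ≫ (coyoneda.obj (op G)).map _ =
        (coyoneda.obj (op G)).map _
      rw [← Functor.map_comp, IsColimit.fac]
    have h4 : IsIso ((coyoneda.obj (op G)).map ((colimit.isColimit X).desc c)) :=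
      h3 ▸ inferInstance
    exact (isIso_iff_bijective _).1 h4
  exact ⟨IsColimit.ofPointIso (colimit.isColimit X)⟩

end Presentable

/-! ### Sifted colimits and finite products of sets -/

section FiniteProducts

variable {J : Type u} [SmallCategory J]

theorem bijective_of_isLimit_fan {ι : Type} {Y : ι → Type u} {P : Type u} (π : ∀ i, P ⟶ Y i)
    (h : IsLimit (Fan.mk P π)) : Function.Bijective (fun (x : P) i => π i x) := by
  refine ⟨fun x y hxy => ?_, fun y => ?_⟩
  · have : (↾fun _ : PUnit.{u+1} => x) = ↾fun _ => y :=
      h.hom_ext fun ⟨i⟩ => by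
        ext
        exact congrFun hxy i
    exact ConcreteCategory.congr_hom this PUnit.unit
  · refine ⟨h.lift (Fan.mk PUnit.{u+1} fun i => ↾fun _ => y i) PUnit.unit, ?_⟩
    funext i
    exact ConcreteCategory.congr_hom (h.fac (Fan.mk PUnit.{u+1} fun i => ↾fun _ => y i) ⟨i⟩)
      PUnit.unit

theorem isLimit_fan_of_bijective {ι : Type} {Y : ι → Type u} {P : Type u} (π : ∀ i, P ⟶ Y i)
    (h : Function.Bijective (fun (x : P) i => π i x)) : Nonempty (IsLimit (Fan.mk P π)) := by
  let e := Equiv.ofBijective _ h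
  have he : ∀ y i, π i (e.symm y) = y i := fun y i => congrFun (e.apply_symm_apply y) i
  refine ⟨Fan.IsLimit.mk _ (fun s => ↾fun x => e.symm fun i => s.proj i x) (fun s i => ?_)
    fun s m hm => ?_⟩
  · ext x
    exact he _ _
  · ext x
    apply h.1
    funext i
    refine Eq.trans ?_ (he _ _).symm
    exact ConcreteCategory.congr_hom (hm i) x

/-- Sifted colimits of sets commute with finite products. -/
theorem isColimit_of_finite_product [IsSifted J] {n : ℕ} {Y : Fin n → J ⥤ Type u}
    {c : ∀ i, Cocone (Y i)} (hc : ∀ i, IsColimit (c i)) {P : J ⥤ Type u} (π : ∀ i, P ⟶ Y i)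
    (hP : ∀ j, Function.Bijective (fun (x : P.obj j) i => (π i).app j x)) (d : Cocone P)
    (q : ∀ i, d.pt ⟶ (c i).pt) (hq : ∀ j i, d.ι.app j ≫ q i = (π i).app j ≫ (c i).ι.app j)
    (hb : Function.Bijective (fun (x : d.pt) i => q i x)) : Nonempty (IsColimit d) := by
  have hlim : IsLimit (Fan.mk P π) := by
    refine evaluationJointlyReflectsLimits _ fun j => ?_
    exact (isLimitMapConeFanMkEquiv ((CategoryTheory.evaluation J (Type u)).obj j) _ π).symm
      (isLimit_fan_of_bijective _ (hP j)).some
  -- Siftedness enters here: the functor `colim` preserves the finite product `P` of the diagrams `Y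
  -- i`.
  have hcol := bijective_of_isLimit_fan _
    (isLimitFanMkObjOfIsLimit (colim : (J ⥤ Type u) ⥤ Type u) _ π hlim)
  let e : ∀ i, colimit (Y i) ≅ (c i).pt := fun i =>
    (colimit.isColimit (Y i)).coconePointUniqueUpToIso (hc i)
  have hfac : ∀ i, colimit.desc P d ≫ q i = colim.map (π i) ≫ (e i).hom := by
    intro i
    refine colimit.hom_ext fun j => ?_
    rw [colimit.ι_desc_assoc, hq]
    simp [e]
  have : IsIso (colimit.desc P d) := by
    rw [isIso_iff_bijective]
    -- The comparison from `colimit P`, followed by the bijection of `d.pt` with the product of the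
    -- `(c i).pt`, is a composite of two bijections, hence is itself bijective.
    have h1 : (fun (x : d.pt) i => q i x) ∘ (colimit.desc P d) =
        (fun y i => (e i).hom (y i)) ∘ fun (x : (colim : (J ⥤ Type u) ⥤ Type u).obj P) i =>
          (colim : (J ⥤ Type u) ⥤ Type u).map (π i) x := by
      funext x i
      exact ConcreteCategory.congr_hom (hfac i) x
    have h2 : Function.Bijective (fun (y : ∀ i, colimit (Y i)) i => (e i).hom (y i)) :=
      Function.Bijective.piMap fun i => (isIso_iff_bijective _).1 inferInstance
    exact (hb.of_comp_iff' _).1 (h1 ▸ h2.comp hcol)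
  exact ⟨@IsColimit.ofPointIso _ _ _ _ _ _ _ (colimit.isColimit P) this⟩

end FiniteProducts

/-! ### Strongly finitely presentable objects as exponents -/

section Tensor

variable {V : Type v} [Category.{u} V] [MonoidalCategory V] [MonoidalClosed V]

/-- Since `V₀(H, [G, -]) ≅ V₀(G ⊗ H, -)` and `G ⊗ H` is again strongly finitely presentable, `[G,
-]` preserves sifted colimits as seen by every such `H`. This is the point where closure under `⊗`
is needed. -/
theorem IsStronglyFinitelyPresentable.isStronglyFinite
    (hV : IsLocallyStronglyFinitelyPresentableTensor V) {G : V}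
    (hG : IsStronglyFinitelyPresentable G) : IsStronglyFinite G := by
  intro D _ _
  refine ⟨fun {X} => ⟨fun {c} hc => isColimit_of_coyoneda hV.1 _ fun H hH => ?_⟩⟩
  have := hV.2 G H hG hH D
  let e : coyoneda.obj (op (G ⊗ H)) ≅ ihom G ⋙ coyoneda.obj (op H) :=
    NatIso.ofComponents (fun X => (((ihom.adjunction G).homEquiv H X)).toIso) fun {X Y} f => by
      ext g
      exact MonoidalClosed.curry_natural_right _ _
  exact ⟨IsColimit.mapCoconeEquiv e (isColimitOfPreserves (coyoneda.obj (op (G ⊗ H))) hc)⟩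

end Tensor

/-! ### The weights for powers and finite products -/

section BaseWeights

variable {V : Type v} [Category.{u} V] [MonoidalCategory V] [SymmetricCategory V]
  [MonoidalClosed V]

/-- The object of `UnitCat`. -/
def UnitCat.star : UnitCat.{u} := PUnit.unit

/-- The only hom-object is `I`, whose identity element is `𝟙`, so the unit law leaves no freedom in
the action. -/
theorem act_unitCat (X : EnrichedFunctor V UnitCat.{u} V) (a b : UnitCat.{u}) :
    act X a b = (ρ_ (X.obj a)).hom := by
  obtain rfl : b = a := rfl
  have h := act_id X b
  have h1 : eId V b = 𝟙 (𝟙_ V) := rfl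
  rw [h1] at h
  refine Eq.trans ?_ h
  exact ((congrArg (· ≫ act X b b) (whiskerLeft_id _ _)).trans (Category.id_comp _)).symm

theorem isEquivariant_unitCat (W X : EnrichedFunctor V UnitCat.{u} V) {Z : V}
    (ψ : ∀ a, Z ⊗ W.obj a ⟶ X.obj a) : IsEquivariant W X ψ := by
  intro a b
  obtain rfl : b = a := rfl
  rw [act_unitCat, act_unitCat]
  have key : Z ◁ (ρ_ (W.obj b)).hom ≫ ψ b =
      (α_ _ _ _).inv ≫ ψ b ▷ 𝟙_ V ≫ (ρ_ (X.obj b)).hom := by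
    rw [rightUnitor_naturality]
    monoidal
  exact key

/-- The hom-object from `a` to `b` is a coproduct of copies of `I` over the equalities `a = b`. It
is enough to check the condition on these, where it is the unit law of the actions. -/
theorem isEquivariant_discrete [HasColimits V] {I : Type u}
    (W X : EnrichedFunctor V (FreeCat (Discrete I)) V) {Z : V}
    (ψ : ∀ a, Z ⊗ W.obj a ⟶ X.obj a) : IsEquivariant W X ψ := by
  intro a b
  have key : ∀ (a b : Discrete I) (P : V),
      ∀ h k : P ⊗ FreeCat.Hom V a b ⟶ X.obj b,
      (∀ e : a = b, P ◁ (FreeCat.ι V (eqToHom e)) ≫ h = P ◁ (FreeCat.ι V (eqToHom e)) ≫ k) →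
        h = k := by
    intro a b P h k H
    refine FreeCat.hom_ext_right fun f => ?_
    rw [Subsingleton.elim f (eqToHom (Discrete.ext f.down.down))]
    exact H _
  rw [← cancel_epi (α_ Z (W.obj a) (a ⟶[V] b)).hom]
  refine key a b _ _ _ fun e => ?_
  obtain rfl : a = b := e
  have h1 : (Z ⊗ W.obj a) ◁ FreeCat.ι V (𝟙 (show Discrete I from a)) ≫ (α_ _ _ _).hom ≫
      Z ◁ act W a a ≫ ψ a = (ρ_ _).hom ≫ ψ a := by
    rw [associator_naturality_right_assoc, ← whiskerLeft_comp_assoc]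
    refine (congrArg (fun k => (α_ _ _ _).hom ≫ Z ◁ k ≫ ψ a) (act_id W a)).trans ?_
    monoidal
  have h2 : (Z ⊗ W.obj a) ◁ FreeCat.ι V (𝟙 (show Discrete I from a)) ≫
      ψ a ▷ _ ≫ act X a a = (ρ_ _).hom ≫ ψ a := by
    rw [whisker_exchange_assoc]
    refine (congrArg (fun k => ψ a ▷ 𝟙_ V ≫ k) (act_id X a)).trans ?_
    exact rightUnitor_naturality _
  refine h1.trans (h2.symm.trans ?_)
  exact congrArg (_ ≫ ·) (Iso.hom_inv_id_assoc _ _).symm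

variable [HasLimits V]

/-- The counit `[*, V](P, X) ⊗ P ⟶ X`. -/
def powerEv (P : V) (X : EnrichedFunctor V UnitCat.{u} V) :
    natObj (powerWeight.{u} P) X ⊗ P ⟶ X.obj UnitCat.star :=
  natEv (powerWeight.{u} P) X UnitCat.star

theorem powerEv_ext {P : V} {X : EnrichedFunctor V UnitCat.{u} V} {Z : V}
    {f g : Z ⟶ natObj (powerWeight.{u} P) X} (h : f ▷ P ≫ powerEv P X = g ▷ P ≫ powerEv P X) :
    f = g :=
  natObj_ext fun _ => h

theorem natMap_powerEv (P : V) {X Y : EnrichedFunctor V UnitCat.{u} V} (f : X ⟶ Y) :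
    natMap (powerWeight.{u} P) f ▷ P ≫ powerEv P Y = powerEv P X ≫ compo f UnitCat.star :=
  natMap_ev (powerWeight.{u} P) f UnitCat.star

/-- The morphism `Z ⟶ [*, V](P, X)` corresponding to `Z ⊗ P ⟶ X`. -/
def powerLift (P : V) (X : EnrichedFunctor V UnitCat.{u} V) {Z : V}
    (k : Z ⊗ P ⟶ X.obj UnitCat.star) : Z ⟶ natObj (powerWeight.{u} P) X :=
  natLift (powerWeight.{u} P) X (fun _ => k) (isEquivariant_unitCat _ _ _)

theorem powerLift_ev (P : V) (X : EnrichedFunctor V UnitCat.{u} V) {Z : V}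
    (k : Z ⊗ P ⟶ X.obj UnitCat.star) : powerLift P X k ▷ P ≫ powerEv P X = k :=
  natLift_ev (powerWeight.{u} P) X (fun _ => k) (isEquivariant_unitCat _ _ _) UnitCat.star

/-- Maps into `[*, V](P, X)` are maps into the internal hom `[P, X]`. -/
def powerIso (P : V) (X : EnrichedFunctor V UnitCat.{u} V) :
    natObj (powerWeight.{u} P) X ≅ (ihom P).obj (X.obj UnitCat.star) where
  hom := MonoidalClosed.curry ((β_ _ _).hom ≫ powerEv P X)
  inv := powerLift P X ((β_ _ _).hom ≫ MonoidalClosed.uncurry (𝟙 _))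
  hom_inv_id := by
    apply powerEv_ext
    rw [comp_whiskerRight, Category.assoc, powerLift_ev,
      BraidedCategory.braiding_naturality_left_assoc, ← MonoidalClosed.uncurry_natural_left,
      Category.comp_id, MonoidalClosed.uncurry_curry, SymmetricCategory.symmetry_assoc,
      id_whiskerRight, Category.id_comp]
  inv_hom_id := by
    apply MonoidalClosed.uncurry_injective
    rw [MonoidalClosed.uncurry_natural_left, MonoidalClosed.uncurry_curry,
      BraidedCategory.braiding_naturality_right_assoc, powerLift_ev,
      SymmetricCategory.symmetry_assoc]

/-- The functor `[*, V](P, -)` is the internal hom `[P, -]`. -/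
def natFunctorPowerWeight (P : V) :
    natFunctor (powerWeight.{u} P) ≅ evalAt V UnitCat.star ⋙ ihom P :=
  NatIso.ofComponents (powerIso P) fun {X Y} f => by
    change natMap (powerWeight.{u} P) f ≫ MonoidalClosed.curry ((β_ _ _).hom ≫ powerEv P Y) =
      MonoidalClosed.curry ((β_ _ _).hom ≫ powerEv P X) ≫ (ihom P).map (compo f UnitCat.star)
    rw [← MonoidalClosed.curry_natural_left, BraidedCategory.braiding_naturality_right_assoc,
      natMap_powerEv, ← MonoidalClosed.curry_natural_right, Category.assoc]

theorem preservesSiftedColimits_powerWeight {P : V} (hP : IsStronglyFinite P) :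
    PreservesSiftedColimits (powerWeight.{u} P) := by
  intro J _ _ X c hc
  obtain ⟨h⟩ := hc UnitCat.star
  have := hP J
  exact ⟨IsColimit.mapCoconeEquiv (natFunctorPowerWeight P).symm
    (isColimitOfPreserves (ihom P) h)⟩

section

variable [HasColimits V]

/-- The projections of the product `[D, V](Δ1, X)`, for `D` discrete. -/
def conicalProj {D : Type u} [SmallCategory D] (X : EnrichedFunctor V (FreeCat D) V)
    (d : FreeCat D) : natObj (conicalWeight V D) X ⟶ X.obj d :=
  (ρ_ _).inv ≫ (show natObj (conicalWeight V D) X ⊗ 𝟙_ V ⟶ X.obj d from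
    natEv (conicalWeight V D) X d)

theorem comp_conicalProj {D : Type u} [SmallCategory D] (X : EnrichedFunctor V (FreeCat D) V)
    {Z : V} (g : Z ⟶ natObj (conicalWeight V D) X) (d : FreeCat D) :
    g ≫ conicalProj X d = (ρ_ _).inv ≫ (show Z ⊗ 𝟙_ V ⟶ X.obj d from
      g ▷ (conicalWeight V D).obj d ≫ natEv (conicalWeight V D) X d) := by
  rw [conicalProj, rightUnitor_inv_naturality_assoc]
  rfl

theorem natMap_conicalProj {D : Type u} [SmallCategory D] {X Y : EnrichedFunctor V (FreeCat D) V}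
    (f : X ⟶ Y) (d : FreeCat D) :
    natMap (conicalWeight V D) f ≫ conicalProj Y d = conicalProj X d ≫ compo f d := by
  rw [comp_conicalProj, conicalProj, Category.assoc]
  exact congrArg (fun k : _ ⊗ 𝟙_ V ⟶ Y.obj d => (ρ_ _).inv ≫ k) (natMap_ev _ f d)

/-- On a discrete shape every family is equivariant, so `[D, V](Δ1, X)` is the product of the
objects `X d`. -/
theorem bijective_comp_conicalProj {I : Type u} (X : EnrichedFunctor V (FreeCat (Discrete I)) V)
    (Z : V) : Function.Bijective
      (fun (g : Z ⟶ natObj (conicalWeight V (Discrete I)) X) (d : FreeCat (Discrete I)) =>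
        g ≫ conicalProj X d) := by
  refine ⟨fun g g' h => natObj_ext fun d => ?_, fun y => ?_⟩
  · have := congrFun h d
    dsimp only at this
    rw [comp_conicalProj, comp_conicalProj, cancel_epi] at this
    exact this
  · refine ⟨natLift (conicalWeight V (Discrete I)) X (Z := Z)
      (fun d => (show Z ⊗ 𝟙_ V ⟶ X.obj d from (ρ_ Z).hom ≫ y d)) (isEquivariant_discrete _ _ _), ?_⟩
    funext d
    dsimp only
    refine (comp_conicalProj _ _ _).trans ?_
    refine (congrArg (fun k : Z ⊗ 𝟙_ V ⟶ X.obj d => (ρ_ _).inv ≫ k)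
      (natLift_ev (conicalWeight V (Discrete I)) X _ _ d)).trans ?_
    exact Iso.inv_hom_id_assoc _ _

/-- Applying `V₀(G, -)` with `G` strongly finitely presentable preserves the product and the given
colimits, which reduces the claim to sets. -/
theorem preservesSiftedColimits_finiteProduct (hV : IsLocallyStronglyFinitelyPresentable V)
    (n : ℕ) : PreservesSiftedColimits (conicalWeight V (Discrete (ULift.{u} (Fin n)))) := by
  intro J _ _ X c hc
  refine isColimit_of_coyoneda hV _ fun G hG => ?_
  have := hG J
  let a : Fin n → FreeCat (Discrete (ULift.{u} (Fin n))) := fun i => Discrete.mk (ULift.up i)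
  have hbij : ∀ Y : EnrichedFunctor V (FreeCat (Discrete (ULift.{u} (Fin n)))) V,
      Function.Bijective (fun (g : G ⟶ natObj (conicalWeight V _) Y) (i : Fin n) =>
        g ≫ (conicalProj Y (a i) : _ ⟶ Y.obj (a i))) := by
    intro Y
    have h := bijective_comp_conicalProj Y G
    refine ⟨fun g g' hg => h.1 (funext fun d => congrFun hg (Discrete.as d).down), fun y => ?_⟩
    obtain ⟨g, hg⟩ := h.2 fun d => y (Discrete.as d).down
    exact ⟨g, funext fun i => congrFun hg (a i)⟩
  refine isColimit_of_finite_product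
    (c := fun i => (coyoneda.obj (op G)).mapCocone ((evalAt V (a i)).mapCocone c))
    (fun i => isColimitOfPreserves (coyoneda.obj (op G)) (hc (a i)).some)
    (P := (X ⋙ natFunctor (conicalWeight V _)) ⋙ coyoneda.obj (op G))
    (fun i =>
      { app := fun j => (coyoneda.obj (op G)).map (conicalProj (X.obj j) (a i))
        naturality := fun j k f => ?_ })
    (fun j => hbij (X.obj j)) _
    (fun i => (coyoneda.obj (op G)).map (conicalProj c.pt (a i))) (fun j i => ?_) (hbij c.pt)
  · exact ((coyoneda.obj (op G)).map_comp _ _).symm.trans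
      ((congrArg _ (natMap_conicalProj (X.map f) (a i))).trans
        ((coyoneda.obj (op G)).map_comp _ _))
  · exact ((coyoneda.obj (op G)).map_comp _ _).symm.trans
      ((congrArg _ (natMap_conicalProj (c.ι.app j) (a i))).trans
        ((coyoneda.obj (op G)).map_comp _ _))

/-- By minimality of the saturation, it suffices that the saturated class of weights preserving
sifted colimits contains the generating weights. -/
theorem preservesSiftedColimits_of_stronglyFiniteWeights
    (hV : IsLocallyStronglyFinitelyPresentable V) {A : Type u} [EnrichedCategory V A]
    (W : EnrichedFunctor V A V) (hW : stronglyFiniteWeights V A W) :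
    PreservesSiftedColimits W := by
  refine hW (fun A _ W => PreservesSiftedColimits (A := A) W)
    isSaturated_preservesSiftedColimits fun B _ W' hW' => ?_
  cases hW' with
  | finiteProduct n => exact preservesSiftedColimits_finiteProduct hV n
  | power X hX => exact preservesSiftedColimits_powerWeight hX

end

end BaseWeights

/-! ### Weighted colimits in `V` as functors of the weight -/

section CoendFunctor

variable {V : Type v} [Category.{u} V] [MonoidalCategory V] [SymmetricCategory V]
  [MonoidalClosed V] [HasColimits V]
variable {T : Type u} [EnrichedCategory V T]

theorem coend_hom_ext_right (F : EnrichedFunctor V T V) (H : EnrichedFunctor V Tᵒᵖ V) {N X : V}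
    {f g : coendObj F H ⊗ N ⟶ X} (h : ∀ t, coendι F H t ▷ N ≫ f = coendι F H t ▷ N ≫ g) :
    f = g := by
  rw [← cancel_epi (β_ N (coendObj F H)).hom]
  apply MonoidalClosed.curry_injective
  apply coend_hom_ext
  intro t
  rw [← MonoidalClosed.curry_natural_left, ← MonoidalClosed.curry_natural_left,
    BraidedCategory.braiding_naturality_right_assoc,
    BraidedCategory.braiding_naturality_right_assoc, h]

/-- Morphisms out of a coend. -/
def coendDesc (F : EnrichedFunctor V T V) (H : EnrichedFunctor V Tᵒᵖ V) {X : V}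
    (φ : ∀ t, H.obj (op t) ⊗ F.obj t ⟶ X)
    (h : ∀ s t, H.obj (op t) ◁ act F s t ≫ φ t =
      H.obj (op t) ◁ (β_ (F.obj s) (s ⟶[V] t)).hom ≫ (α_ _ _ _).inv ≫
        opAct H s t ▷ F.obj s ≫ φ s) : coendObj F H ⟶ X :=
  (coend_desc F H φ h).choose

@[simp]
theorem coendι_desc (F : EnrichedFunctor V T V) (H : EnrichedFunctor V Tᵒᵖ V) {X : V}
    (φ : ∀ t, H.obj (op t) ⊗ F.obj t ⟶ X) (h) (t : T) :
    coendι F H t ≫ coendDesc F H φ h = φ t :=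
  (coend_desc F H φ h).choose_spec t

/-- The morphism `F * H ⟶ F' * H` induced by `f : F ⟶ F'`. -/
def coendMap {F F' : EnrichedFunctor V T V} (f : F ⟶ F') (H : EnrichedFunctor V Tᵒᵖ V) :
    coendObj F H ⟶ coendObj F' H :=
  coendDesc F H (fun t => H.obj (op t) ◁ compo f t ≫ coendι F' H t) (fun s t => by
    rw [← whiskerLeft_comp_assoc, compo_naturality, whiskerLeft_comp, Category.assoc,
      coend_condition, ← whisker_exchange_assoc, ← associator_inv_naturality_right_assoc,
      ← whiskerLeft_comp_assoc, ← whiskerLeft_comp_assoc,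
      BraidedCategory.braiding_naturality_left])

@[simp]
theorem coendι_map {F F' : EnrichedFunctor V T V} (f : F ⟶ F') (H : EnrichedFunctor V Tᵒᵖ V)
    (t : T) : coendι F H t ≫ coendMap f H = H.obj (op t) ◁ compo f t ≫ coendι F' H t :=
  coendι_desc _ _ _ _ _

@[simp]
theorem coendι_map_assoc {F F' : EnrichedFunctor V T V} (f : F ⟶ F')
    (H : EnrichedFunctor V Tᵒᵖ V) (t : T) {Q : V} (k : coendObj F' H ⟶ Q) :
    coendι F H t ≫ coendMap f H ≫ k = H.obj (op t) ◁ compo f t ≫ coendι F' H t ≫ k := by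
  rw [← Category.assoc, coendι_map, Category.assoc]

/-- The ordinary functor `- * H : [T, V] ⥤ V`. -/
def coendFunctor (H : EnrichedFunctor V Tᵒᵖ V) : EnrichedFunctor V T V ⥤ V where
  obj F := coendObj F H
  map f := coendMap f H
  map_id F := by
    apply coend_hom_ext
    intro t
    simp
  map_comp f g := by
    apply coend_hom_ext
    intro t
    simp

/-- The transposed action on `[H-, Z]` is the second leg of the coend relation, so maps out of the
coend correspond to equivariant families. -/
theorem uncurry_act_homFrom (H : EnrichedFunctor V Tᵒᵖ V) (Z : V) (s t : T) {P : V}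
    (k : P ⟶ (homFrom H Z).obj s) :
    MonoidalClosed.uncurry (A := H.obj (op t)) (X := Z) (k ▷ (s ⟶[V] t) ≫ act (homFrom H Z) s t) =
      H.obj (op t) ◁ (β_ P (s ⟶[V] t)).hom ≫ (α_ _ _ _).inv ≫ opAct H s t ▷ P ≫
        MonoidalClosed.uncurry (A := H.obj (op s)) (X := Z) k := by
  rw [act_homFrom]
  have key : ∀ (k : P ⟶ (ihom (H.obj (op s))).obj Z) (l : (s ⟶[V] t) ⟶
      (ihom (H.obj (op t))).obj (H.obj (op s))), MonoidalClosed.uncurry (k ▷ (s ⟶[V] t) ≫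
      (β_ ((ihom (H.obj (op s))).obj Z) (s ⟶[V] t)).hom ≫ l ▷ _ ≫
        eComp V (H.obj (op t)) (H.obj (op s)) Z) =
      H.obj (op t) ◁ (β_ P (s ⟶[V] t)).hom ≫ (α_ _ _ _).inv ≫
        MonoidalClosed.uncurry l ▷ P ≫ MonoidalClosed.uncurry k := by
    intro k l
    rw [BraidedCategory.braiding_naturality_left_assoc, ← tensorHom_def'_assoc,
      MonoidalClosed.uncurry_natural_left, uncurry_tensorHom_eComp]
  exact key k (H.map (op t) (op s))

/-- Morphisms `F * H ⟶ Z` correspond to morphisms `F ⟶ [H-, Z]`. -/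
def coendHomEquiv (H : EnrichedFunctor V Tᵒᵖ V) (F : EnrichedFunctor V T V) (Z : V) :
    (coendObj F H ⟶ Z) ≃ (F ⟶ homFrom H Z) where
  toFun k := mkHom (fun t => MonoidalClosed.curry (coendι F H t ≫ k)) fun s t => by
    apply MonoidalClosed.uncurry_injective (A := H.obj (op t)) (X := Z)
    refine Eq.trans ?_ (uncurry_act_homFrom H Z s t _).symm
    have h := coend_condition F H s t =≫ k
    simp only [Category.assoc] at h
    refine (MonoidalClosed.uncurry_natural_left (act F s t) _).trans ?_
    rw [MonoidalClosed.uncurry_curry, MonoidalClosed.uncurry_curry]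
    exact h
  invFun f := coendDesc F H (fun t => MonoidalClosed.uncurry (compo f t)) fun s t => by
    refine (MonoidalClosed.uncurry_natural_left (A := H.obj (op t)) (Y := Z) (act F s t)
      (compo f t)).symm.trans ?_
    exact (congrArg MonoidalClosed.uncurry (compo_naturality f s t)).trans
      (uncurry_act_homFrom H Z s t _)
  left_inv k := by
    apply coend_hom_ext
    intro t
    exact (coendι_desc _ _ _ _ _).trans (MonoidalClosed.uncurry_curry _)
  right_inv f := copresheaf_hom_ext fun t =>
    (congrArg MonoidalClosed.curry (coendι_desc _ _ _ _ _)).trans (MonoidalClosed.curry_uncurry _)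

/-- The right adjoint sends `Z` to the `V`-functor `[H-, Z]`. -/
instance preservesColimits_coendFunctor (H : EnrichedFunctor V Tᵒᵖ V) :
    PreservesColimits (coendFunctor H) :=
  (Adjunction.adjunctionOfEquivRight (F := coendFunctor H) (coendHomEquiv H)
    fun F' F Z f k => copresheaf_hom_ext fun t => by
      change MonoidalClosed.curry (coendι F' H t ≫ coendMap f H ≫ k) =
        compo f t ≫ MonoidalClosed.curry (coendι F H t ≫ k)
      exact (congrArg MonoidalClosed.curry (coendι_map_assoc f H t k)).trans
        (MonoidalClosed.curry_natural_left _ _)).leftAdjoint_preservesColimits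

variable [HasLimits V]

/-- The action `H t ⊗ [A, V](H, H') ⟶ H' t`. -/
def natEvRight {A : Type u} [EnrichedCategory V A] (H H' : EnrichedFunctor V A V) (a : A) :
    H.obj a ⊗ natObj H H' ⟶ H'.obj a :=
  MonoidalClosed.uncurry (evalπ H H' a)

/-- The action `(F * H) ⊗ [Tᵒᵖ, V](H, H') ⟶ F * H'`. -/
def coendAct (F : EnrichedFunctor V T V) (H H' : EnrichedFunctor V Tᵒᵖ V) :
    coendObj F H ⊗ natObj H H' ⟶ coendObj F H' :=
  MonoidalClosed.uncurry ((weightedColimit F).map H H')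

/-- The action of `F * -` on hom-objects is obtained by choice from a universal property; this
formula on coprojections is what makes it computable. -/
theorem coendι_coendAct (F : EnrichedFunctor V T V) (H H' : EnrichedFunctor V Tᵒᵖ V) (t : T) :
    coendι F H t ▷ natObj H H' ≫ coendAct F H H' = (α_ _ _ _).hom ≫
      H.obj (op t) ◁ (β_ (F.obj t) (natObj H H')).hom ≫ (α_ _ _ _).inv ≫
        natEvRight H H' (op t) ▷ F.obj t ≫ coendι F H' t := by
  have h := congrArg MonoidalClosed.uncurry
    (colimitFunctor_aux' F (coendCocone F) (coendCocone_isColimit F) H H' t)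
  rw [uncurry_tensorHom_eComp, MonoidalClosed.uncurry_natural_left, uncurry_tensorHom_eComp,
    Iso.inv_comp_eq] at h
  have h1 : ∀ H, MonoidalClosed.uncurry ((coendCocone F H).app t) = coendι F H t := fun H =>
    MonoidalClosed.uncurry_curry _
  rw [h1, h1] at h
  exact h

theorem coendAct_map {F F' : EnrichedFunctor V T V} (f : F ⟶ F') (H H' : EnrichedFunctor V Tᵒᵖ V) :
    coendAct F H H' ≫ coendMap f H' = coendMap f H ▷ natObj H H' ≫ coendAct F' H H' := by
  apply coend_hom_ext_right
  intro t
  rw [reassoc_of% (coendι_coendAct F H H' t), ← comp_whiskerRight_assoc, coendι_map, coendι_map,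
    comp_whiskerRight_assoc, coendι_coendAct, associator_naturality_middle_assoc,
    ← whiskerLeft_comp_assoc, BraidedCategory.braiding_naturality_left, ← whisker_exchange_assoc,
    whiskerLeft_comp_assoc, associator_inv_naturality_right_assoc]

theorem whiskerLeft_coendAct_map {F F' : EnrichedFunctor V T V} (f : F ⟶ F')
    {H H' : EnrichedFunctor V Tᵒᵖ V} {P : V} (g : P ⟶ natObj H H') :
    (coendObj F H ◁ g ≫ coendAct F H H') ≫ coendMap f H' =
      coendMap f H ▷ P ≫ coendObj F' H ◁ g ≫ coendAct F' H H' := by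
  rw [Category.assoc, coendAct_map, whisker_exchange_assoc]

variable {A : Type u} [EnrichedCategory V A]

/-- The structure morphisms `A(a, b) ⟶ [T, V](S a, S b)` of a `V`-functor `S : A ⟶ [T, V]`. -/
def natHom (S : EnrichedFunctor V A (EnrichedFunctor V T V)) (a b : A) :
    (a ⟶[V] b) ⟶ natObj (S.obj a) (S.obj b) :=
  S.map a b

theorem act_comp_weightedColimit (S : EnrichedFunctor V A (EnrichedFunctor V Tᵒᵖ V))
    (F : EnrichedFunctor V T V) (a b : A) :
    act (S.comp V (weightedColimit F)) a b =
      coendObj F (S.obj a) ◁ natHom S a b ≫ coendAct F (S.obj a) (S.obj b) :=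
  act_comp_functor _ _ _ _

/-- The morphism `F * S- ⟶ F' * S-` of `V`-functors `A ⟶ V` induced by `f : F ⟶ F'`. -/
def compWeightedColimitMap (S : EnrichedFunctor V A (EnrichedFunctor V Tᵒᵖ V))
    {F F' : EnrichedFunctor V T V} (f : F ⟶ F') :
    S.comp V (weightedColimit F) ⟶ S.comp V (weightedColimit F') :=
  mkHom (fun a => coendMap f (S.obj a)) fun a b => by
    rw [act_comp_weightedColimit, act_comp_weightedColimit]
    exact whiskerLeft_coendAct_map f (natHom S a b)

/-- The functor sending `F` to the `V`-functor `F * S-`. -/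
def compWeightedColimitFunctor (S : EnrichedFunctor V A (EnrichedFunctor V Tᵒᵖ V)) :
    EnrichedFunctor V T V ⥤ EnrichedFunctor V A V where
  obj F := S.comp V (weightedColimit F)
  map f := compWeightedColimitMap S f
  map_id F := copresheaf_hom_ext fun a => (coendFunctor (S.obj a)).map_id F
  map_comp f g := copresheaf_hom_ext fun a => (coendFunctor (S.obj a)).map_comp f g

section

variable {W : EnrichedFunctor V A V} {S : EnrichedFunctor V A (EnrichedFunctor V Tᵒᵖ V)}
  {M : EnrichedFunctor V Tᵒᵖ V} (c : WeightedCone W S M)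

/-- The components `W a ⟶ [T, V](M, S a)` of a weighted cone in `[T, V]`. -/
def coneHom (a : A) : W.obj a ⟶ natObj M (S.obj a) :=
  c.app a

theorem coneAct_map_weightedColimit (F : EnrichedFunctor V T V) (a : A) :
    coneAct (c.map (weightedColimit F)) a =
      coendObj F M ◁ coneHom c a ≫ coendAct F M (S.obj a) :=
  coneAct_map _ _ _

/-- The comparison `F * M ⟶ {W, F * S}` for a weighted cone with vertex `M` over `S`. -/
def limitComparison (F : EnrichedFunctor V T V) :
    coendObj F M ⟶ natObj W (S.comp V (weightedColimit F)) :=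
  natLift W _ (coneAct (c.map (weightedColimit F))) (coneAct_isEquivariant _)

/-- Naturality in the weight `F` is what allows invertibility to pass from representables to their
sifted colimits. -/
theorem limitComparison_natural {F F' : EnrichedFunctor V T V} (f : F ⟶ F') :
    coendMap f M ≫ limitComparison c F' =
      limitComparison c F ≫ natMap W (compWeightedColimitMap S f) := by
  apply natObj_ext
  intro a
  rw [comp_whiskerRight, comp_whiskerRight, Category.assoc, Category.assoc, natMap_ev,
    limitComparison, limitComparison, natLift_ev, natLift_ev_assoc]
  refine (congrArg (coendMap f M ▷ W.obj a ≫ ·) (coneAct_map_weightedColimit c F' a)).trans ?_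
  refine Eq.trans ?_ (congrArg (· ≫ coendMap f (S.obj a)) (coneAct_map_weightedColimit c F a).symm)
  exact (whiskerLeft_coendAct_map f (coneHom c a)).symm

/-- The weights `F` for which `F * -` sends a given weighted cone to a limit cone are closed under
sifted colimits if the weight of the cone preserves these. -/
theorem isLimit_map_weightedColimit_of_isColimit (hW : PreservesSiftedColimits W) {J : Type u}
    [SmallCategory J] [IsSifted J] {X : J ⥤ EnrichedFunctor V T V} (t : Cocone X)
    (ht : IsColimit t) (h : ∀ j, (c.map (weightedColimit (X.obj j))).IsLimit) :
    (c.map (weightedColimit t.pt)).IsLimit := by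
  -- Both ends of the comparison preserve the colimit `t`: `- * M` is a left adjoint, while each `-
  -- * S a` is one too and `[A, V](W, -)` preserves the resulting pointwise sifted colimit.
  have h1 := isColimitOfPreserves (coendFunctor M) ht
  obtain ⟨h2⟩ := hW J (X ⋙ compWeightedColimitFunctor S) ((compWeightedColimitFunctor S).mapCocone t)
    fun a => ⟨isColimitOfPreserves (coendFunctor (S.obj a)) ht⟩
  let κ : X ⋙ coendFunctor M ≅ (X ⋙ compWeightedColimitFunctor S) ⋙ natFunctor W :=
    NatIso.ofComponents
      (fun j => @asIso _ _ _ _ (limitComparison c (X.obj j)) ((isLimit_iff_isIso _).1 (h j)))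
      (fun f => limitComparison_natural c (X.map f))
  rw [isLimit_iff_isIso]
  -- By naturality the comparison at the vertex is the map of colimits induced by the invertible
  -- comparisons `κ`.
  have h3 : limitComparison c t.pt = (h1.coconePointsIsoOfNatIso h2 κ).hom := by
    refine h1.hom_ext fun j => ?_
    exact (limitComparison_natural c (t.ι.app j)).trans
      (h1.comp_coconePointsIsoOfNatIso_hom h2 κ j).symm
  change IsIso (limitComparison c t.pt)
  rw [h3]
  exact Iso.isIso_hom _

end

end CoendFunctor

/-! ### Colimits weighted by a representable -/

section RepresentableCoend

variable {V : Type v} [Category.{u} V] [MonoidalCategory V] [SymmetricCategory V]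
  [MonoidalClosed V]
variable {T : Type u} [EnrichedCategory V T]

theorem opAct_id (H : EnrichedFunctor V Tᵒᵖ V) (t : T) :
    H.obj (op t) ◁ eId V t ≫ opAct H t t = (ρ_ _).hom :=
  act_id H (op t)

theorem opAct_comp (H : EnrichedFunctor V Tᵒᵖ V) (r s t : T) :
    H.obj (op t) ◁ (β_ (r ⟶[V] s) (s ⟶[V] t)).hom ≫ (α_ _ _ _).inv ≫
      opAct H s t ▷ (r ⟶[V] s) ≫ opAct H r s =
    H.obj (op t) ◁ eComp V r s t ≫ opAct H r t := by
  have h := act_comp H (op t) (op s) (op r)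
  rw [eComp_op_eq] at h
  have h' : H.obj (op t) ◁ ((β_ (s ⟶[V] t) (r ⟶[V] s)).hom ≫ eComp V r s t) ≫ opAct H r t =
      (α_ _ _ _).inv ≫ opAct H s t ▷ (r ⟶[V] s) ≫ opAct H r s := h
  rw [← h', ← whiskerLeft_comp_assoc, SymmetricCategory.symmetry_assoc]

variable [HasColimits V]

/-- The morphism `T(t, -) * H ⟶ H t`. -/
def repCoendDesc (t : T) (H : EnrichedFunctor V Tᵒᵖ V) :
    coendObj (representable t) H ⟶ H.obj (op t) :=
  coendDesc (representable t) H (fun s => opAct H t s) fun r s => by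
    rw [act_representable]
    exact (opAct_comp H t r s).symm

theorem coendι_repCoendDesc (t : T) (H : EnrichedFunctor V Tᵒᵖ V) (s : T) :
    coendι (representable t) H s ≫ repCoendDesc t H = opAct H t s :=
  coendι_desc _ _ _ _ _

/-- The coprojection `H s ⊗ T(t, s) ⟶ T(t, -) * H`. -/
def repCoendι (t : T) (H : EnrichedFunctor V Tᵒᵖ V) (s : T) :
    H.obj (op s) ⊗ (t ⟶[V] s) ⟶ coendObj (representable t) H :=
  coendι (representable t) H s

/-- Co-Yoneda: the inverse inserts the identity, `h ↦ h ⊗ 𝟙 t`. -/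
theorem isIso_repCoendDesc (t : T) (H : EnrichedFunctor V Tᵒᵖ V) : IsIso (repCoendDesc t H) := by
  have h1 : ∀ s, repCoendι t H s ≫ repCoendDesc t H = opAct H t s := coendι_repCoendDesc t H
  have h2 : ∀ s, H.obj (op s) ◁ eComp V t t s ≫ repCoendι t H s =
      H.obj (op s) ◁ (β_ (t ⟶[V] t) (t ⟶[V] s)).hom ≫ (α_ _ _ _).inv ≫
        opAct H t s ▷ (t ⟶[V] t) ≫ repCoendι t H t := by
    intro s
    have h := coend_condition (representable t) H t s
    rw [act_representable] at h
    exact h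
  refine ⟨(ρ_ _).inv ≫ H.obj (op t) ◁ eId V t ≫ repCoendι t H t, ?_, ?_⟩
  · apply coend_hom_ext
    intro s
    change repCoendι t H s ≫ repCoendDesc t H ≫ _ = repCoendι t H s ≫ 𝟙 _
    rw [reassoc_of% (h1 s), Category.comp_id, rightUnitor_inv_naturality_assoc,
      ← whisker_exchange_assoc]
    have h3 := e_id_comp V t s
    rw [Iso.inv_comp_eq, Category.comp_id] at h3
    -- The coend relation applied to `f = 𝟙 t · f` gives `h ⊗ f = (h · f) ⊗ 𝟙 t`.
    have h4 : H.obj (op s) ◁ eId V t ▷ (t ⟶[V] s) ≫ H.obj (op s) ◁ eComp V t t s ≫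
        repCoendι t H s = H.obj (op s) ◁ (λ_ _).hom ≫ repCoendι t H s := by
      rw [← whiskerLeft_comp_assoc, h3]
    rw [h2, ← whiskerLeft_comp_assoc, BraidedCategory.braiding_naturality_left,
      whiskerLeft_comp_assoc, associator_inv_naturality_right_assoc] at h4
    rw [← cancel_epi (H.obj (op s) ◁ (λ_ (t ⟶[V] s)).hom), ← h4]
    have h5 : ∀ {P Q Y : V} (k : (P ⊗ Q) ⊗ 𝟙_ V ⟶ Y), P ◁ (λ_ Q).hom ≫ (ρ_ _).inv ≫ k =
        P ◁ (β_ (𝟙_ V) Q).hom ≫ (α_ _ _ _).inv ≫ k := by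
      intro P Q Y k
      rw [braiding_tensorUnit_left, whiskerLeft_comp_assoc]
      congr 1
      simp
    exact h5 _
  · rw [Category.assoc, Category.assoc, h1, opAct_id, Iso.inv_hom_id]

theorem opAct_natEvRight [HasLimits V] (H H' : EnrichedFunctor V Tᵒᵖ V) (t s : T) :
    opAct H t s ▷ natObj H H' ≫ natEvRight H H' (op t) =
      (α_ _ _ _).hom ≫ H.obj (op s) ◁ (β_ _ _).hom ≫ (α_ _ _ _).inv ≫
        natEvRight H H' (op s) ▷ (t ⟶[V] s) ≫ opAct H' t s := by
  have h := congrArg MonoidalClosed.uncurry (evalπ_natural H H' (op s) (op t))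
  rw [uncurry_tensorHom_eComp, MonoidalClosed.uncurry_natural_left, uncurry_tensorHom_eComp,
    Iso.inv_comp_eq] at h
  exact h

/-- `V`-naturality in `H` of the isomorphism `T(t, -) * H ≅ H t`; limit cones can then be compared
under the two functors. -/
theorem coendAct_repCoendDesc [HasLimits V] (t : T) (H H' : EnrichedFunctor V Tᵒᵖ V) :
    coendAct (representable t) H H' ≫ repCoendDesc t H' =
      repCoendDesc t H ▷ natObj H H' ≫ natEvRight H H' (op t) := by
  apply coend_hom_ext_right
  intro s
  rw [reassoc_of% (coendι_coendAct (representable t) H H' s), coendι_repCoendDesc,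
    ← comp_whiskerRight_assoc, coendι_repCoendDesc]
  exact (opAct_natEvRight H H' t s).symm

/-- Weighted colimits with representable weight commute with all pointwise weighted limits. -/
theorem isLimit_map_weightedColimit_representable [HasLimits V] {A : Type u} [EnrichedCategory V A]
    {W : EnrichedFunctor V A V} {S : EnrichedFunctor V A (EnrichedFunctor V Tᵒᵖ V)}
    {M : EnrichedFunctor V Tᵒᵖ V} (c : WeightedCone W S M) (t : T)
    (hc : (c.map (evaluation (op t))).IsLimit) :
    (c.map (weightedColimit (representable t))).IsLimit := by
  have h : ∀ M : EnrichedFunctor V Tᵒᵖ V, @IsIso V _ ((weightedColimit (representable t)).obj M)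
      ((evaluation (op t)).obj M) (repCoendDesc t M) := isIso_repCoendDesc t
  have h' : ∀ M : EnrichedFunctor V Tᵒᵖ V, @IsIso V _ ((evaluation (op t)).obj M)
      ((weightedColimit (representable t)).obj M) (@inv _ _ _ _ _ (h M)) :=
    fun M => @IsIso.inv_isIso _ _ _ _ _ (h M)
  refine isLimit_map_of_natIso c (Q := evaluation (op t)) (Q' := weightedColimit (representable t))
    (fun M => @inv _ _ _ _ _ (h M)) (fun M N => ?_) hc
  have key := coendAct_repCoendDesc t M N
  have := isIso_repCoendDesc t M
  have := isIso_repCoendDesc t N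
  have key2 : natEvRight M N (op t) ≫ inv (repCoendDesc t N) =
      inv (repCoendDesc t M) ▷ natObj M N ≫ coendAct (representable t) M N := by
    rw [IsIso.comp_inv_eq, Category.assoc, key, ← comp_whiskerRight_assoc, IsIso.inv_hom_id,
      id_whiskerRight, Category.id_comp]
  exact key2

end RepresentableCoend

/-! ### The Yoneda embedding and density -/

section YonedaFunctor

variable {V : Type v} [Category.{u} V] [MonoidalCategory V] [SymmetricCategory V]
  [MonoidalClosed V] [HasLimits V]
variable {T : Type u} [EnrichedCategory V T]

theorem eId_natEv {A : Type u} [EnrichedCategory V A] (F : EnrichedFunctor V A V) (a : A) :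
    (show 𝟙_ V ⟶ natObj F F from eId V F) ▷ F.obj a ≫ natEv F F a = (λ_ _).hom := by
  have h : (show 𝟙_ V ⟶ natObj F F from eId V F) ≫ natObjπ F F a = eId V (F.obj a) :=
    eId_evalπ F a
  rw [natEv, BraidedCategory.braiding_naturality_left_assoc, ← MonoidalClosed.uncurry_natural_left,
    h, uncurry_eId, braiding_rightUnitor]

theorem yonedaHom_isEquivariant (s t : T) :
    IsEquivariant (representable (V := V) (op s)) (representable (op t))
      (Z := (s ⟶[V] t)) (fun q => (β_ _ _).hom ≫ eComp V q.unop s t) := by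
  intro a b
  have key : ∀ q q' : T, (s ⟶[V] t) ◁ ((β_ (q ⟶[V] s) (q' ⟶[V] q)).hom ≫ eComp V q' q s) ≫
      (β_ _ _).hom ≫ eComp V q' s t =
      (α_ _ _ _).inv ≫ ((β_ (s ⟶[V] t) (q ⟶[V] s)).hom ≫ eComp V q s t) ▷ (q' ⟶[V] q) ≫
        (β_ _ _).hom ≫ eComp V q' q t := by
    intro q q'
    rw [BraidedCategory.braiding_naturality_right_assoc, comp_whiskerRight_assoc,
      comp_whiskerRight_assoc, BraidedCategory.braiding_naturality_left_assoc,
      reassoc_of% (braiding_shuffle (s ⟶[V] t) (q ⟶[V] s) (q' ⟶[V] q)), ← e_assoc']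
  rw [act_representable, act_representable]
  exact key a.unop b.unop

/-- The action `T(s, t) ⟶ [Tᵒᵖ, V](T(-, s), T(-, t))` of the Yoneda embedding. -/
def yonedaHom (s t : T) :
    (s ⟶[V] t) ⟶ natObj (representable (V := V) (op s)) (representable (op t)) :=
  natLift _ _ _ (yonedaHom_isEquivariant s t)

/-- The counit `[Tᵒᵖ, V](T(-, s), T(-, t)) ⊗ T(q, s) ⟶ T(q, t)`. -/
def yonedaNatEv (q s t : T) :
    natObj (representable (V := V) (op s)) (representable (op t)) ⊗ (q ⟶[V] s) ⟶ (q ⟶[V] t) :=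
  natEv (representable (V := V) (op s)) (representable (op t)) (op q)

theorem yonedaHom_ev (q s t : T) :
    yonedaHom (V := V) s t ▷ (q ⟶[V] s) ≫ yonedaNatEv q s t = (β_ _ _).hom ≫ eComp V q s t :=
  natLift_ev _ _ _ (yonedaHom_isEquivariant s t) (op q)

theorem yonedaNatEv_ext {s t : T} {Z : V}
    {f g : Z ⟶ natObj (representable (V := V) (op s)) (representable (op t))}
    (h : ∀ q, f ▷ (q ⟶[V] s) ≫ yonedaNatEv q s t = g ▷ (q ⟶[V] s) ≫ yonedaNatEv q s t) : f = g :=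
  natObj_ext fun q => h q.unop

/-- Both sides are the permutation of three factors taking `(P, Q, X)` to `(X, P, Q)`; the hexagons
express them by the same elementary braidings. -/
theorem braiding_cycle (P Q X : V) : (β_ (P ⊗ Q) X).hom ≫ (α_ _ _ _).inv =
    (β_ P Q).hom ▷ X ≫ (α_ _ _ _).hom ≫ Q ◁ (β_ P X).hom ≫ (β_ Q (X ⊗ P)).hom := by
  rw [BraidedCategory.braiding_naturality_right, BraidedCategory.braiding_tensor_left_hom,
    BraidedCategory.braiding_tensor_right_hom]
  simp only [Category.assoc, Iso.hom_inv_id_assoc, Iso.hom_inv_id, Category.comp_id]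
  rw [← comp_whiskerRight_assoc, SymmetricCategory.symmetry, id_whiskerRight, Category.id_comp]

variable (V T) in
/-- The Yoneda embedding `T ⟶ [Tᵒᵖ, V]`. -/
def yonedaFunctor : EnrichedFunctor V T (EnrichedFunctor V Tᵒᵖ V) where
  obj t := representable (op t)
  map s t := yonedaHom s t
  map_id t := by
    refine yonedaNatEv_ext fun q => ?_
    refine Eq.trans ?_ (eId_natEv (representable (V := V) (op t)) (op q)).symm
    rw [comp_whiskerRight, Category.assoc, yonedaHom_ev,
      BraidedCategory.braiding_naturality_left_assoc]
    have h := e_comp_id V q t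
    rw [Iso.inv_comp_eq, Category.comp_id] at h
    rw [h]
    exact braiding_rightUnitor _
  map_comp r s t := by
    refine yonedaNatEv_ext fun q => ?_
    have h0 : eComp V (representable (V := V) (op r)) (representable (op s))
        (representable (op t)) ▷ (q ⟶[V] r) ≫ yonedaNatEv q r t =
      (β_ _ _).hom ▷ (q ⟶[V] r) ≫ (α_ _ _ _).hom ≫ _ ◁ yonedaNatEv q r s ≫ yonedaNatEv q s t :=
      eComp_natEv (representable (V := V) (op r)) (representable (op s)) (representable (op t))
        (op q)
    have h1 : ((yonedaHom (V := V) r s ⊗ₘ yonedaHom s t) ≫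
        (β_ _ _).hom) ▷ (q ⟶[V] r) ≫ (α_ _ _ _).hom ≫ _ ◁ yonedaNatEv q r s ≫ yonedaNatEv q s t =
        (β_ _ _).hom ▷ _ ≫ (α_ _ _ _).hom ≫ (s ⟶[V] t) ◁ ((β_ _ _).hom ≫ eComp V q r s) ≫
          (β_ _ _).hom ≫ eComp V q s t := by
      rw [BraidedCategory.braiding_naturality, comp_whiskerRight_assoc,
        MonoidalCategory.tensorHom_def', comp_whiskerRight_assoc,
        associator_naturality_left_assoc, associator_naturality_middle_assoc,
        ← whisker_exchange_assoc, ← whiskerLeft_comp_assoc, yonedaHom_ev, yonedaHom_ev]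
    refine Eq.trans ?_ ((comp_whiskerRight_assoc _ _ _ _).trans
      ((congrArg _ h0).trans ((comp_whiskerRight_assoc _ _ _ _).symm.trans h1))).symm
    rw [comp_whiskerRight_assoc, yonedaHom_ev, BraidedCategory.braiding_naturality_left_assoc,
      ← e_assoc, reassoc_of% (braiding_cycle (r ⟶[V] s) (s ⟶[V] t) (q ⟶[V] r)),
      whiskerLeft_comp_assoc, BraidedCategory.braiding_naturality_right_assoc,
      BraidedCategory.braiding_naturality_right_assoc,
      BraidedCategory.braiding_naturality_right_assoc]

theorem opAct_yoneda (r s t : T) :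
    opAct (representable (V := V) (op t)) r s = (β_ _ _).hom ≫ eComp V r s t := by
  have h : opAct (representable (V := V) (op t)) r s = eComp V (op t) (op s) (op r) :=
    act_representable _ _ _
  rw [h, eComp_op_eq]

variable [HasColimits V]

section

variable (F : EnrichedFunctor V T V)

/-- The coprojection `T(s, t) ⊗ F s ⟶ F * T(-, t)`. -/
def yonedaCoendι (s t : T) :
    (s ⟶[V] t) ⊗ F.obj s ⟶ coendObj F (representable (op t)) :=
  coendι F (representable (op t)) s

theorem yonedaCoend_condition (r s t : T) :
    (s ⟶[V] t) ◁ act F r s ≫ yonedaCoendι F s t =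
      (s ⟶[V] t) ◁ (β_ (F.obj r) (r ⟶[V] s)).hom ≫ (α_ _ _ _).inv ≫
        ((β_ _ _).hom ≫ eComp V r s t) ▷ F.obj r ≫ yonedaCoendι F r t := by
  have h := coend_condition F (representable (op t)) r s
  rw [opAct_yoneda] at h
  exact h

/-- The morphism `F * T(-, t) ⟶ F t`. -/
def yonedaCoendDesc (t : T) : coendObj F (representable (op t)) ⟶ F.obj t :=
  coendDesc F (representable (op t)) (fun s => (β_ (s ⟶[V] t) _).hom ≫ act F s t) fun r s => by
    rw [opAct_yoneda]
    have key : (s ⟶[V] t) ◁ act F r s ≫ (β_ _ _).hom ≫ act F s t =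
        (s ⟶[V] t) ◁ (β_ (F.obj r) (r ⟶[V] s)).hom ≫ (α_ _ _ _).inv ≫
          ((β_ _ _).hom ≫ eComp V r s t) ▷ F.obj r ≫ (β_ _ _).hom ≫ act F r t := by
      rw [BraidedCategory.braiding_naturality_right_assoc, comp_whiskerRight_assoc,
        BraidedCategory.braiding_naturality_left_assoc, act_comp,
        reassoc_of% (braiding_shuffle (s ⟶[V] t) (r ⟶[V] s) (F.obj r)),
        BraidedCategory.braiding_naturality_right_assoc, ← comp_whiskerRight_assoc,
        SymmetricCategory.symmetry, id_whiskerRight, Category.id_comp, Iso.hom_inv_id_assoc]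
    exact key

theorem yonedaCoendι_desc (s t : T) :
    yonedaCoendι F s t ≫ yonedaCoendDesc F t = (β_ _ _).hom ≫ act F s t :=
  coendι_desc _ _ _ _ _

/-- Density of the representables: the inverse sends `x` to `𝟙 t ⊗ x`, and the coend relation moves
any other element `f ⊗ x` to `𝟙 t ⊗ (x · f)`. -/
theorem isIso_yonedaCoendDesc (t : T) : IsIso (yonedaCoendDesc F t) := by
  refine ⟨(λ_ _).inv ≫ eId V t ▷ F.obj t ≫ yonedaCoendι F t t, ?_, ?_⟩
  · apply coend_hom_ext
    intro s
    change yonedaCoendι F s t ≫ yonedaCoendDesc F t ≫ _ = yonedaCoendι F s t ≫ 𝟙 _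
    have h := e_comp_id V s t
    rw [Iso.inv_comp_eq, Category.comp_id] at h
    have h1 : eId V t ▷ (s ⟶[V] t) ≫ (β_ _ _).hom ≫ eComp V s t t = (λ_ _).hom := by
      rw [BraidedCategory.braiding_naturality_left_assoc, h, braiding_rightUnitor]
    rw [reassoc_of% (yonedaCoendι_desc F s t), Category.comp_id, leftUnitor_inv_naturality_assoc,
      whisker_exchange_assoc, yonedaCoend_condition, ← whisker_exchange_assoc,
      associator_inv_naturality_left_assoc, ← comp_whiskerRight_assoc, h1,
      leftUnitor_whiskerRight_assoc]
    simp
  · rw [Category.assoc, Category.assoc, yonedaCoendι_desc,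
      BraidedCategory.braiding_naturality_left_assoc, act_id, braiding_rightUnitor,
      Iso.inv_hom_id]

/-- The action `T(q, s) ⊗ [Tᵒᵖ, V](T(-, s), T(-, t)) ⟶ T(q, t)`. -/
def yonedaNatEvRight (q s t : T) :
    (q ⟶[V] s) ⊗ natObj (representable (V := V) (op s)) (representable (op t)) ⟶ (q ⟶[V] t) :=
  natEvRight (representable (V := V) (op s)) (representable (op t)) (op q)

theorem whiskerLeft_yonedaHom (q s t : T) :
    (q ⟶[V] s) ◁ yonedaHom (V := V) s t ≫ yonedaNatEvRight q s t = eComp V q s t := by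
  have h : yonedaNatEv (V := V) q s t = (β_ _ _).hom ≫ yonedaNatEvRight q s t := rfl
  have h1 := yonedaHom_ev (V := V) q s t
  rw [h, BraidedCategory.braiding_naturality_left_assoc, cancel_epi] at h1
  exact h1

/-- The isomorphisms `F * T(-, t) ≅ F t` are `V`-natural in `t`, so `F * Y-` and `F` preserve the
same limits. -/
theorem coendAct_yonedaCoendDesc (s t : T) :
    coendObj F (representable (op s)) ◁ yonedaHom s t ≫
      coendAct F (representable (op s)) (representable (op t)) ≫ yonedaCoendDesc F t =
    yonedaCoendDesc F s ▷ (s ⟶[V] t) ≫ act F s t := by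
  apply coend_hom_ext_right
  intro q
  have h : yonedaCoendι F q s ▷ natObj _ _ ≫ coendAct F (representable (op s))
      (representable (op t)) = (α_ _ _ _).hom ≫ (q ⟶[V] s) ◁ (β_ _ _).hom ≫ (α_ _ _ _).inv ≫
        yonedaNatEvRight q s t ▷ F.obj q ≫ yonedaCoendι F q t :=
    coendι_coendAct F (representable (op s)) (representable (op t)) q
  change yonedaCoendι F q s ▷ (s ⟶[V] t) ≫ _ = yonedaCoendι F q s ▷ (s ⟶[V] t) ≫ _
  rw [← whisker_exchange_assoc, reassoc_of% h, associator_naturality_right_assoc,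
    ← whiskerLeft_comp_assoc, BraidedCategory.braiding_naturality_right, whiskerLeft_comp_assoc,
    associator_inv_naturality_middle_assoc, ← comp_whiskerRight_assoc, whiskerLeft_yonedaHom,
    yonedaCoendι_desc, ← comp_whiskerRight_assoc, yonedaCoendι_desc, comp_whiskerRight_assoc,
    BraidedCategory.braiding_naturality_left_assoc, act_comp,
    BraidedCategory.braiding_tensor_left_hom]
  simp only [Category.assoc, Iso.hom_inv_id_assoc, Iso.inv_hom_id_assoc]
  rw [← whiskerLeft_comp_assoc (q ⟶[V] s) (β_ _ _).hom, SymmetricCategory.symmetry]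
  simp

end

end YonedaFunctor

/-! ### Flat functors are continuous -/

section Flat

variable {V : Type v} [Category.{u} V] [MonoidalCategory V] [SymmetricCategory V]
  [MonoidalClosed V] [HasLimits V]

/-- The two iterated composites differ by associativity of their structure maps, so the cones are
matched through natural isomorphisms with identity components. -/
theorem isLimit_map_map_iff {A : Type u} [EnrichedCategory V A] {K : Type w} [EnrichedCategory V K]
    {K' : Type w'} [EnrichedCategory V K'] {W : EnrichedFunctor V A V} {S : EnrichedFunctor V A K}
    {L : K} (c : WeightedCone W S L) (Q : EnrichedFunctor V K K') (R : EnrichedFunctor V K' V) :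
    ((c.map Q).map R).IsLimit ↔ (c.map (Q.comp V R)).IsLimit := by
  have h1 : ∀ a b, ((S.comp V Q).comp V R).map a b = (S.comp V (Q.comp V R)).map a b :=
    fun a b => Category.assoc _ _ _
  have h2 : ∀ a, coneAct ((c.map Q).map R) a = coneAct (c.map (Q.comp V R)) a := fun a =>
    congrArg MonoidalClosed.uncurry (Category.assoc _ _ _)
  have h3 : ∀ a b, act ((S.comp V Q).comp V R) a b = act (S.comp V (Q.comp V R)) a b :=
    fun a b => congrArg MonoidalClosed.uncurry (h1 a b)
  let f : (S.comp V Q).comp V R ⟶ S.comp V (Q.comp V R) := mkHom (fun a => 𝟙 _) fun a b =>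
    (Category.comp_id _).trans ((h3 a b).trans
      ((congrArg (· ≫ _) (id_whiskerRight _ _)).trans (Category.id_comp _)).symm)
  let g : S.comp V (Q.comp V R) ⟶ (S.comp V Q).comp V R := mkHom (fun a => 𝟙 _) fun a b =>
    (Category.comp_id _).trans ((h3 a b).symm.trans
      ((congrArg (· ≫ _) (id_whiskerRight _ _)).trans (Category.id_comp _)).symm)
  have : ∀ a, IsIso (compo f a) := fun a => IsIso.id _
  have : ∀ a, IsIso (compo g a) := fun a => IsIso.id _
  have := copresheaf_isIso f
  have := copresheaf_isIso g
  let e : R.obj (Q.obj L) ⟶ (Q.comp V R).obj L := 𝟙 (R.obj (Q.obj L))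
  let e' : (Q.comp V R).obj L ⟶ R.obj (Q.obj L) := 𝟙 (R.obj (Q.obj L))
  have : IsIso e := IsIso.id _
  have : IsIso e' := IsIso.id _
  constructor
  · refine isLimit_of_iso ((c.map Q).map R) (c.map (Q.comp V R)) e f fun a => ?_
    exact ((congrArg (· ≫ _) (id_whiskerRight _ _)).trans (Category.id_comp _)).trans
      ((h2 a).symm.trans (Category.comp_id _).symm)
  · refine isLimit_of_iso (c.map (Q.comp V R)) ((c.map Q).map R) e' g fun a => ?_
    exact ((congrArg (· ≫ _) (id_whiskerRight _ _)).trans (Category.id_comp _)).trans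
      ((h2 a).trans (Category.comp_id _).symm)

variable [HasColimits V] {T : Type u} [EnrichedCategory V T]

/-- The Yoneda embedding followed by evaluation at `q` is the hom functor `T(q, -)`, which preserves
limits. -/
theorem isLimit_map_yonedaFunctor {A : Type u} [EnrichedCategory V A] {W : EnrichedFunctor V A V}
    {S : EnrichedFunctor V A T} {L : T} (c : WeightedCone W S L) (hc : c.IsLimit) (q : Tᵒᵖ) :
    ((c.map (yonedaFunctor V T)).map (evaluation q)).IsLimit := by
  rw [isLimit_map_map_iff]
  have : ∀ t : T, @IsIso V _ ((homFunctor q.unop).obj t)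
      (((yonedaFunctor V T).comp V (evaluation q)).obj t) (𝟙 (q.unop ⟶[V] t)) := fun t => IsIso.id _
  refine isLimit_map_of_natIso c (Q := homFunctor q.unop)
    (Q' := (yonedaFunctor V T).comp V (evaluation q)) (fun t => 𝟙 (q.unop ⟶[V] t)) (fun s t => ?_)
    (isLimit_map_homFunctor c hc q.unop)
  have h1 : MonoidalClosed.uncurry (((yonedaFunctor V T).comp V (evaluation q)).map s t) =
      eComp V q.unop s t :=
    (MonoidalClosed.uncurry_natural_left _ _).trans (whiskerLeft_yonedaHom q.unop s t)
  have h2 : MonoidalClosed.uncurry ((homFunctor (V := V) q.unop).map s t) = eComp V q.unop s t :=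
    MonoidalClosed.uncurry_curry _
  refine (Category.comp_id _).trans (h2.trans ?_)
  exact ((congrArg (· ≫ _) (id_whiskerRight _ _)).trans ((Category.id_comp _).trans h1)).symm

/-- Flatness is used on the image of the cone under the Yoneda embedding, which is a pointwise limit
cone; `F * Y- ≅ F` then returns to `F`. -/
theorem IsFlat.isContinuous {Φ : WeightClass V} {F : EnrichedFunctor V T V} (hF : IsFlat Φ F) :
    IsContinuous Φ F := by
  intro A _ W hW S L c hc
  have h1 := (commutesInV_iff W F).1 (hF A W hW) _ _ (c.map (yonedaFunctor V T))
    (isLimit_map_yonedaFunctor c hc)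
  rw [isLimit_map_map_iff] at h1
  have : ∀ t : T, @IsIso V _ (((yonedaFunctor V T).comp V (weightedColimit F)).obj t) (F.obj t)
      (yonedaCoendDesc F t) := isIso_yonedaCoendDesc F
  refine isLimit_map_of_natIso c (Q := (yonedaFunctor V T).comp V (weightedColimit F)) (Q' := F)
    (yonedaCoendDesc F) (fun s t => ?_) h1
  have h2 : MonoidalClosed.uncurry (((yonedaFunctor V T).comp V (weightedColimit F)).map s t) =
      coendObj F (representable (op s)) ◁ yonedaHom s t ≫
        coendAct F (representable (op s)) (representable (op t)) :=
    MonoidalClosed.uncurry_natural_left _ _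
  exact ((congrArg (· ≫ yonedaCoendDesc F t) h2).trans (Category.assoc _ _ _)).trans
    (coendAct_yonedaCoendDesc F s t)

end Flat

/-! ### Conical colimits and the underlying category -/

section Conical

variable {V : Type v} [Category.{u} V] [MonoidalCategory V] [SymmetricCategory V]
  [MonoidalClosed V] [HasLimits V]
variable {T : Type u} [EnrichedCategory V T]

theorem natPoint_isEquivariant {F G : EnrichedFunctor V T V} (f : F ⟶ G) :
    IsEquivariant F G (Z := 𝟙_ V) (fun a => (λ_ _).hom ≫ compo f a) := by
  intro a b
  dsimp only
  rw [leftUnitor_naturality_assoc, compo_naturality]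
  simp

/-- Morphisms `I ⟶ [T, V](F, G)` are the morphisms `F ⟶ G`. -/
def natPoints (F G : EnrichedFunctor V T V) : (𝟙_ V ⟶ natObj F G) ≃ (F ⟶ G) where
  toFun f := mkHom (fun a => (λ_ _).inv ≫ f ▷ F.obj a ≫ natEv F G a) fun a b => by
    have h := (natEv_isEquivariant F G).whiskerRight_comp f a b
    dsimp only at h
    rw [leftUnitor_inv_naturality_assoc, h]
    simp
  invFun f := natLift F G (fun a => (λ_ _).hom ≫ compo f a) (natPoint_isEquivariant f)
  left_inv f := by
    apply natObj_ext
    intro a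
    rw [natLift_ev, compo_mkHom, Iso.hom_inv_id_assoc]
  right_inv f := copresheaf_hom_ext fun a => by
    dsimp only
    rw [compo_mkHom, natLift_ev, Iso.inv_hom_id_assoc]

theorem compo_natPoints {F G : EnrichedFunctor V T V} (f : 𝟙_ V ⟶ natObj F G) (a : T) :
    compo (natPoints F G f) a = (λ_ _).inv ≫ f ▷ F.obj a ≫ natEv F G a := rfl

/-- Precomposition `[T, V](G, X) ⟶ [T, V](F, X)`. -/
def natPre {F G : EnrichedFunctor V T V} (f : 𝟙_ V ⟶ natObj F G) (X : EnrichedFunctor V T V) :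
    natObj G X ⟶ natObj F X :=
  (λ_ _).inv ≫ f ▷ _ ≫ eComp V F G X

theorem natPre_ev {F G : EnrichedFunctor V T V} (f : 𝟙_ V ⟶ natObj F G)
    (X : EnrichedFunctor V T V) (a : T) : natPre f X ▷ F.obj a ≫ natEv F X a =
      natObj G X ◁ compo (natPoints F G f) a ≫ natEv G X a := by
  have h : natPre f X ▷ F.obj a ≫ natEv F X a = (λ_ _).inv ▷ F.obj a ≫
      f ▷ natObj G X ▷ F.obj a ≫ eComp V F G X ▷ F.obj a ≫ natEv F X a := by
    rw [natPre, comp_whiskerRight_assoc, comp_whiskerRight_assoc]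
  rw [h, eComp_natEv, ← comp_whiskerRight_assoc (f ▷ _),
    BraidedCategory.braiding_naturality_left, comp_whiskerRight_assoc,
    associator_naturality_middle_assoc, ← whiskerLeft_comp_assoc, compo_natPoints,
    whiskerLeft_comp_assoc, braiding_tensorUnit_left]
  simp

/-- Composition in the underlying category of `[T, V]` is composition of natural maps, and the
transition maps in the definition of a conical colimit are precompositions. -/
theorem natPoints_comp_natPre {F G X : EnrichedFunctor V T V} (f : 𝟙_ V ⟶ natObj F G)
    (g : 𝟙_ V ⟶ natObj G X) :
    natPoints F X (g ≫ natPre f X) = natPoints F G f ≫ natPoints G X g := by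
  apply copresheaf_hom_ext
  intro a
  rw [compo_comp, compo_natPoints, comp_whiskerRight_assoc, natPre_ev, ← whisker_exchange_assoc,
    ← leftUnitor_inv_naturality_assoc, compo_natPoints g]

variable (V T) in
/-- The functor from the underlying category of the `V`-category `[T, V]`. -/
def underlyingFunctor :
    ForgetEnrichment V (EnrichedFunctor V T V) ⥤ EnrichedFunctor V T V where
  obj F := ForgetEnrichment.to V F
  map {F G} f := natPoints _ _ (ForgetEnrichment.homTo V f)
  map_id F := copresheaf_hom_ext fun a => by
    rw [ForgetEnrichment.homTo_id, compo_natPoints]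
    refine (congrArg (_ ≫ ·) (eId_natEv (ForgetEnrichment.to V F) a)).trans ?_
    exact Iso.inv_hom_id _
  map_comp {F G H} f g := by
    refine Eq.trans (congrArg _ ?_) (natPoints_comp_natPre (ForgetEnrichment.homTo V f)
      (ForgetEnrichment.homTo V g))
    have key : ∀ (f : 𝟙_ V ⟶ natObj (ForgetEnrichment.to V F) (ForgetEnrichment.to V G))
        (g : 𝟙_ V ⟶ natObj (ForgetEnrichment.to V G) (ForgetEnrichment.to V H)),
        ((λ_ (𝟙_ V)).inv ≫ (f ⊗ₘ g)) ≫ eComp V (ForgetEnrichment.to V F) (ForgetEnrichment.to V G)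
          (ForgetEnrichment.to V H) = g ≫ natPre f (ForgetEnrichment.to V H) := by
      intro f g
      rw [natPre, leftUnitor_inv_naturality_assoc, tensorHom_def', Category.assoc, Category.assoc]
    exact key (ForgetEnrichment.homTo V f) (ForgetEnrichment.homTo V g)

/-- A conical colimit turns `[T, V](-, X)` into a limit in `V`; evaluating this limit on maps out of
`I` gives the ordinary universal property. -/
theorem IsConicalColimit.isColimit_underlyingFunctor {D : Type u} [SmallCategory D]
    {S : D ⥤ ForgetEnrichment V (EnrichedFunctor V T V)} {c : Cocone S} (hc : IsConicalColimit c) :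
    Nonempty (IsColimit ((underlyingFunctor V T).mapCocone c)) := by
  have key : ∀ (d : D) (X : EnrichedFunctor V T V)
      (l : 𝟙_ V ⟶ natObj (ForgetEnrichment.to V c.pt) X),
      (underlyingFunctor V T).map (c.ι.app d) ≫ natPoints (ForgetEnrichment.to V c.pt) X l =
        natPoints (ForgetEnrichment.to V (S.obj d)) X
          (l ≫ natPre (ForgetEnrichment.homTo V (c.ι.app d)) X) := fun d X l =>
    (natPoints_comp_natPre _ _).symm
  have hL := fun X : EnrichedFunctor V T V => (hc (ForgetEnrichment.of V X)).some
  -- A cocone `s` of natural maps is encoded as a cone with vertex `I` over the hom-objects into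
  -- `s.pt`.
  let K : ∀ s : Cocone (S ⋙ underlyingFunctor V T),
      Cone (S.op ⋙ (eHomFunctor V (ForgetEnrichment V _)).flip.obj (ForgetEnrichment.of V s.pt)) :=
    fun s =>
      { pt := 𝟙_ V
        π :=
          { app := fun d => (natPoints (ForgetEnrichment.to V (S.obj d.unop)) s.pt).symm
              (s.ι.app d.unop)
            naturality := fun d e f => by
              refine (Category.id_comp _).trans ?_
              apply (natPoints (ForgetEnrichment.to V (S.obj e.unop)) s.pt).injective
              refine ((Equiv.apply_symm_apply _ _).trans (s.w f.unop).symm).trans ?_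
              refine Eq.trans ?_ (natPoints_comp_natPre (ForgetEnrichment.homTo V (S.map f.unop))
                _).symm
              exact congrArg (natPoints (ForgetEnrichment.to V (S.obj e.unop))
                (ForgetEnrichment.to V (S.obj d.unop)) (ForgetEnrichment.homTo V (S.map f.unop)) ≫ ·)
                (Equiv.apply_symm_apply (natPoints (ForgetEnrichment.to V (S.obj d.unop)) s.pt)
                  (s.ι.app d.unop)).symm } }
  refine ⟨{ desc := fun s => natPoints (ForgetEnrichment.to V c.pt) s.pt ((hL s.pt).lift (K s)),
            fac := fun s d => ?_, uniq := fun s m hm => ?_ }⟩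
  · refine (key d s.pt _).trans ?_
    have h := (hL s.pt).fac (K s) (op d)
    exact (congrArg (natPoints _ _) h).trans (Equiv.apply_symm_apply _ _)
  · obtain ⟨m, rfl⟩ := (natPoints (ForgetEnrichment.to V c.pt) s.pt).surjective m
    refine congrArg (natPoints (ForgetEnrichment.to V c.pt) s.pt) ((hL s.pt).hom_ext fun d => ?_)
    refine Eq.trans ?_ ((hL s.pt).fac (K s) d).symm
    apply (natPoints (ForgetEnrichment.to V (S.obj d.unop)) s.pt).injective
    refine ((key d.unop s.pt m).symm.trans (hm d.unop)).trans ?_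
    exact (Equiv.apply_symm_apply _ _).symm

end Conical

/-! ### Sifted colimits of representables are flat -/

section SiftedColimit

variable {V : Type v} [Category.{u} V] [MonoidalCategory V] [SymmetricCategory V]
  [MonoidalClosed V] [HasLimits V] [HasColimits V]
variable {T : Type u} [EnrichedCategory V T]

theorem isLimit_map_weightedColimit_of_iso {A : Type u} [EnrichedCategory V A]
    {W : EnrichedFunctor V A V} {S : EnrichedFunctor V A (EnrichedFunctor V Tᵒᵖ V)}
    {M : EnrichedFunctor V Tᵒᵖ V} (c : WeightedCone W S M) {F F' : EnrichedFunctor V T V}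
    (e : F ≅ F') (h : (c.map (weightedColimit F)).IsLimit) :
    (c.map (weightedColimit F')).IsLimit := by
  have h1 : IsIso (limitComparison c F) := (isLimit_iff_isIso _).1 h
  have h2 := limitComparison_natural c e.hom
  have h3 : IsIso (coendMap e.hom M) := inferInstanceAs (IsIso ((coendFunctor M).map e.hom))
  have h4 : IsIso (natMap W (compWeightedColimitMap S e.hom)) :=
    inferInstanceAs (IsIso ((natFunctor W).map ((compWeightedColimitFunctor S).map e.hom)))
  refine (isLimit_iff_isIso _).2 ?_
  change IsIso (limitComparison c F')
  rw [← IsIso.eq_inv_comp] at h2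
  rw [h2]
  infer_instance

/-- Sifted colimits of representables commute with pointwise limits whose weight preserves
sifted colimits. -/
theorem IsSiftedColimitOfRepresentables.isLimit_map_weightedColimit {F : EnrichedFunctor V T V}
    (hF : IsSiftedColimitOfRepresentables F) {A : Type u} [EnrichedCategory V A]
    {W : EnrichedFunctor V A V} (hW : PreservesSiftedColimits W)
    {S : EnrichedFunctor V A (EnrichedFunctor V Tᵒᵖ V)} {M : EnrichedFunctor V Tᵒᵖ V}
    (c : WeightedCone W S M) (hc : ∀ t : Tᵒᵖ, (c.map (evaluation t)).IsLimit) :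
    (c.map (weightedColimit F)).IsLimit := by
  obtain ⟨D, _, _, R, k, hR, hk, hcol⟩ := hF
  have hk' : F = ForgetEnrichment.to V k.pt := hk.symm
  subst hk'
  obtain ⟨h⟩ := hcol.isColimit_underlyingFunctor
  refine isLimit_map_weightedColimit_of_isColimit c hW ((underlyingFunctor V T).mapCocone k) h
    fun d => ?_
  obtain ⟨t, ⟨e⟩⟩ := hR d
  exact isLimit_map_weightedColimit_of_iso c ((underlyingFunctor V T).mapIso e.symm)
    (isLimit_map_weightedColimit_representable c t (hc (op t)))

theorem IsSiftedColimitOfRepresentables.isFlat (hV : IsLocallyStronglyFinitelyPresentable V)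
    {F : EnrichedFunctor V T V} (hF : IsSiftedColimitOfRepresentables F) :
    IsFlat (stronglyFiniteWeights V) F := fun _ _ W hW =>
  (commutesInV_iff W F).2 fun _ _ c hc => hF.isLimit_map_weightedColimit
    (preservesSiftedColimits_of_stronglyFiniteWeights hV W hW) c hc

/-- A limit cone in `[Tᵒᵖ, V]` is a pointwise one, so the argument for flatness applies to it. -/
theorem IsSiftedColimitOfRepresentables.isContinuous_weightedColimit
    (hV : IsLocallyStronglyFinitelyPresentable V) {F : EnrichedFunctor V T V}
    (hF : IsSiftedColimitOfRepresentables F) :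
    IsContinuous (stronglyFiniteWeights V) (weightedColimit F) := fun _ _ W hW _ _ c hc =>
  hF.isLimit_map_weightedColimit (preservesSiftedColimits_of_stronglyFiniteWeights hV W hW) c
    fun t => isLimit_map_evaluation c hc t

end SiftedColimit

/-! ### Pointwise colimits are conical -/

section PointwiseColimits

variable {V : Type v} [Category.{u} V] [MonoidalCategory V] [SymmetricCategory V]
  [MonoidalClosed V] [HasLimits V]
variable {T : Type u} [EnrichedCategory V T]

variable (V T) in
/-- The functor to the underlying category of the `V`-category `[T, V]`. -/
def toUnderlyingFunctor :
    EnrichedFunctor V T V ⥤ ForgetEnrichment V (EnrichedFunctor V T V) where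
  obj F := ForgetEnrichment.of V F
  map {F G} f := ForgetEnrichment.homOf V
    (show 𝟙_ V ⟶ (F ⟶[V] G) from (natPoints F G).symm f)
  map_id F := by
    apply (natPoints F F).injective
    refine (Equiv.apply_symm_apply (natPoints F F) (𝟙 F)).trans ?_
    exact ((underlyingFunctor V T).map_id (ForgetEnrichment.of V F)).symm
  map_comp {F G H} f g := by
    apply (natPoints F H).injective
    refine (Equiv.apply_symm_apply (natPoints F H) (f ≫ g)).trans ?_
    refine Eq.trans ?_ ((underlyingFunctor V T).map_comp
      (X := ForgetEnrichment.of V F) (Y := ForgetEnrichment.of V G) (Z := ForgetEnrichment.of V H)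
      (ForgetEnrichment.homOf V (show 𝟙_ V ⟶ (F ⟶[V] G) from (natPoints F G).symm f))
      (ForgetEnrichment.homOf V (show 𝟙_ V ⟶ (G ⟶[V] H) from (natPoints G H).symm g))).symm
    exact congrArg₂ (· ≫ ·) (Equiv.apply_symm_apply (natPoints F G) f).symm
      (Equiv.apply_symm_apply (natPoints G H) g).symm

theorem natPre_symm_ev {F G : EnrichedFunctor V T V} (f : F ⟶ G)
    (X : EnrichedFunctor V T V) (a : T) :
    natPre ((natPoints F G).symm f) X ▷ F.obj a ≫ natEv F X a =
      natObj G X ◁ compo f a ≫ natEv G X a := by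
  rw [natPre_ev, Equiv.apply_symm_apply]

/-- Pointwise colimits in `[T, V]` are conical colimits. -/
theorem isConicalColimit_of_pointwise {D : Type u} [SmallCategory D]
    {R : D ⥤ EnrichedFunctor V T V} (k : Cocone R)
    (hk : ∀ a, Nonempty (IsColimit ((evalAt V a).mapCocone k))) :
    IsConicalColimit ((toUnderlyingFunctor V T).mapCocone k) := by
  intro X
  -- Since `V` is closed, `Z ⊗ -` preserves the pointwise colimits, and generalized elements with
  -- any parameter `Z` can be glued.
  have hZ : ∀ (Z : V) (a : T),
      Nonempty (IsColimit ((tensorLeft Z).mapCocone ((evalAt V a).mapCocone k))) := fun Z a =>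
    ⟨isColimitOfPreserves (tensorLeft Z) (hk a).some⟩
  let i : ∀ d, R.obj d ⟶ k.pt := fun d => k.ι.app d
  have hext : ∀ (Z Y : V) (a : T) (f g : Z ⊗ k.pt.obj a ⟶ Y),
      (∀ d, Z ◁ compo (i d) a ≫ f = Z ◁ compo (i d) a ≫ g) → f = g :=
    fun Z Y a f g h => (hZ Z a).some.hom_ext h
  have key : ∀ (Z : V) (ψ : ∀ d, Z ⟶ natObj (R.obj d) (ForgetEnrichment.to V X)),
      (∀ (d e : D) (f : d ⟶ e), ψ e ≫ natPre ((natPoints _ _).symm (R.map f)) _ = ψ d) →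
      ∃! l : Z ⟶ natObj k.pt (ForgetEnrichment.to V X),
        ∀ d, l ≫ natPre ((natPoints _ _).symm (i d)) _ = ψ d := by
    intro Z ψ hψ
    have hw : ∀ (a : T) (d e : D) (f : d ⟶ e), Z ◁ compo (R.map f) a ≫
        ψ e ▷ (R.obj e).obj a ≫ natEv _ (ForgetEnrichment.to V X) a =
        ψ d ▷ (R.obj d).obj a ≫ natEv _ (ForgetEnrichment.to V X) a := by
      intro a d e f
      rw [← hψ d e f, comp_whiskerRight_assoc, natPre_symm_ev, whisker_exchange_assoc]
    have hex : ∀ a, ∃ φ : Z ⊗ k.pt.obj a ⟶ (ForgetEnrichment.to V X).obj a, ∀ d,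
        Z ◁ compo (i d) a ≫ φ =
          ψ d ▷ (R.obj d).obj a ≫ natEv _ (ForgetEnrichment.to V X) a := by
      intro a
      refine ⟨(hZ Z a).some.desc
        { pt := (ForgetEnrichment.to V X).obj a
          ι :=
            { app := fun d => ψ d ▷ (R.obj d).obj a ≫ natEv _ (ForgetEnrichment.to V X) a
              naturality := fun d e f => (hw a d e f).trans (Category.comp_id _).symm } },
        fun d => (hZ Z a).some.fac _ d⟩
    choose φ hφ using hex
    have hφ' : IsEquivariant k.pt (ForgetEnrichment.to V X) φ := by
      intro a b
      -- The factors are rearranged to `(A(a, b) ⊗ Z) ⊗ k.pt a`, so that `hext` applies with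
      -- parameter `A(a, b) ⊗ Z` and equivariance is checked on each `R d`.
      rw [← cancel_epi (α_ Z (k.pt.obj a) (a ⟶[V] b)).hom, Iso.hom_inv_id_assoc,
        ← cancel_epi (β_ (a ⟶[V] b) _).hom, ← cancel_epi (α_ (a ⟶[V] b) Z _).hom]
      apply hext
      intro d
      have h := (natEv_isEquivariant (R.obj d) (ForgetEnrichment.to V X)).whiskerRight_comp (ψ d) a b
      dsimp only at h
      rw [associator_naturality_right_assoc, associator_naturality_right_assoc,
        BraidedCategory.braiding_naturality_right_assoc,
        BraidedCategory.braiding_naturality_right_assoc, associator_naturality_middle_assoc,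
        ← whiskerLeft_comp_assoc, ← compo_naturality, whiskerLeft_comp_assoc, hφ,
        ← comp_whiskerRight_assoc, hφ, h, Iso.hom_inv_id_assoc]
    refine ⟨natLift _ _ φ hφ', fun d => ?_, fun l hl => ?_⟩
    · apply natObj_ext
      intro a
      rw [comp_whiskerRight_assoc, natPre_symm_ev, ← whisker_exchange_assoc, natLift_ev, hφ]
    · apply natObj_ext
      intro a
      rw [natLift_ev]
      apply hext
      intro d
      rw [hφ, ← hl d, comp_whiskerRight_assoc, natPre_symm_ev, whisker_exchange_assoc]
  have key' := fun s : Cone ((R ⋙ toUnderlyingFunctor V T).op ⋙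
      (eHomFunctor V (ForgetEnrichment V (EnrichedFunctor V T V))).flip.obj X) =>
    key s.pt (fun d => s.π.app (op d)) (fun d e f => s.w f.op)
  choose l hl hu using key'
  exact ⟨{ lift := l, fac := fun s d => hl s d.unop, uniq := fun s m hm => hu s m fun d => hm (op d) }⟩

end PointwiseColimits

/-! ### Maps out of the representable at a limit -/

section RepresentableHoms

variable {V : Type v} [Category.{u} V] [MonoidalCategory V] [SymmetricCategory V]
  [MonoidalClosed V] [HasLimits V]
variable {T : Type u} [EnrichedCategory V T]

/-- The Yoneda lemma for morphisms `T(p, -) ⟶ N`. -/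
def repHomEquiv (p : T) (N : EnrichedFunctor V T V) :
    (representable p ⟶ N) ≃ (𝟙_ V ⟶ N.obj p) :=
  (natPoints (representable p) N).symm.trans
    { toFun := fun f => f ≫ yonedaEv p N
      invFun := fun x => x ≫ yonedaInv p N
      left_inv := fun f => by
        dsimp only
        rw [Category.assoc, yonedaEv_inv, Category.comp_id]
      right_inv := fun f => by
        dsimp only
        rw [Category.assoc, yonedaInv_ev, Category.comp_id] }

theorem compo_repHomEquiv_symm {p : T} {N : EnrichedFunctor V T V} (x : 𝟙_ V ⟶ N.obj p) (s : T) :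
    compo ((repHomEquiv p N).symm x) s =
      (λ_ ((representable p).obj s)).inv ≫ x ▷ (representable p).obj s ≫ repAct p N s := by
  refine (compo_natPoints _ s).trans ?_
  have h := natLift_ev (representable p) N _ (repAct_isEquivariant p N) s
  refine congrArg (_ ≫ ·) ?_
  refine (congrArg (· ≫ _) (comp_whiskerRight x (yonedaInv p N) _)).trans ?_
  exact (Category.assoc _ _ _).trans (congrArg (_ ≫ ·) h)

variable {A : Type u} [EnrichedCategory V A]

/-- The components `W a ⟶ T(L, S a)` of a weighted cone. -/
def repCone {W : EnrichedFunctor V A V} {S : EnrichedFunctor V A T} {L : T}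
    (c : WeightedCone W S L) (a : A) : W.obj a ⟶ (representable L).obj (S.obj a) :=
  c.app a

/-- The universal property of the object representing a weighted limit `L` in `T`, for morphisms out
of `T(L, -)`. -/
theorem existsUnique_repHom {W : EnrichedFunctor V A V} {S : EnrichedFunctor V A T} {L : T}
    (c : WeightedCone W S L) (N : EnrichedFunctor V T V) (hc : (c.map N).IsLimit)
    (y : ∀ a, W.obj a ⟶ N.obj (S.obj a))
    (hy : IsEquivariant W (S.comp V N) (Z := 𝟙_ V) fun a => (λ_ _).hom ≫ y a) :
    ∃! φ : representable L ⟶ N, ∀ a,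
      repCone c a ≫ compo φ (S.obj a) = y a := by
  -- At `Z = I` the limit property produces a point of `N L`, which is a map `T(L, -) ⟶ N` by
  -- Yoneda.
  have h := (isLimit_iff _).1 hc (𝟙_ V) _ hy
  have key : ∀ x : 𝟙_ V ⟶ N.obj L,
      (∀ a, repCone c a ≫
        compo ((repHomEquiv L N).symm x) (S.obj a) = y a) ↔
      ∀ a, x ▷ W.obj a ≫ coneAct (c.map N) a = (λ_ _).hom ≫ y a := by
    intro x
    refine forall_congr' fun a => ?_
    have h1 : repCone c a ≫
        compo ((repHomEquiv L N).symm x) (S.obj a) =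
        (λ_ _).inv ≫ x ▷ W.obj a ≫ coneAct (c.map N) a := by
      rw [compo_repHomEquiv_symm, leftUnitor_inv_naturality_assoc, whisker_exchange_assoc]
      exact congrArg (fun k => (λ_ _).inv ≫ x ▷ W.obj a ≫ k) (coneAct_map c N a).symm
    rw [h1]
    exact Iso.inv_comp_eq _
  obtain ⟨x, hx, hu⟩ := h
  refine ⟨(repHomEquiv L N).symm x, (key x).2 hx, fun φ hφ => ?_⟩
  obtain ⟨x', rfl⟩ := (repHomEquiv L N).symm.surjective φ
  rw [hu x' ((key x').1 hφ)]

end RepresentableHoms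

/-! ### The category of representables over `F` -/

section RepOver

variable {V : Type v} [Category.{u} V] [MonoidalCategory V] [SymmetricCategory V]
  [MonoidalClosed V] [HasLimits V]
variable {T : Type u} [EnrichedCategory V T]

theorem natPoints_symm_comp {F G H : EnrichedFunctor V T V} (f : F ⟶ G) (g : G ⟶ H) :
    (natPoints F H).symm (f ≫ g) = (natPoints F G).symm f ≫ natMap F g := by
  apply (natPoints F H).injective
  rw [Equiv.apply_symm_apply]
  apply copresheaf_hom_ext
  intro a
  rw [compo_natPoints, comp_whiskerRight_assoc, natMap_ev, compo_comp]
  have h : compo f a = (λ_ _).inv ≫ (natPoints F G).symm f ▷ F.obj a ≫ natEv F G a := by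
    rw [← compo_natPoints, Equiv.apply_symm_apply]
  rw [h]
  simp only [Category.assoc]

theorem repHomEquiv_comp {p : T} {M N : EnrichedFunctor V T V} (f : representable p ⟶ M)
    (g : M ⟶ N) : repHomEquiv p N (f ≫ g) = repHomEquiv p M f ≫ compo g p := by
  change (natPoints (representable p) N).symm (f ≫ g) ≫ yonedaEv p N =
    ((natPoints (representable p) M).symm f ≫ yonedaEv p M) ≫ compo g p
  rw [natPoints_symm_comp, Category.assoc, natMap_yonedaEv, Category.assoc]

/-- The objects of the category of representables over `F`. -/
structure RepOver (F : EnrichedFunctor V T V) where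
  /-- The representing object. -/
  left : T
  /-- The morphism to `F`. -/
  hom : representable left ⟶ F

/-- Morphisms follow the natural transformations and so run opposite to those of `T`: products in
`T` that `F` preserves become coproducts here. -/
instance (F : EnrichedFunctor V T V) : SmallCategory (RepOver F) where
  Hom p q := { φ : (representable p.left : EnrichedFunctor V T V) ⟶ representable q.left //
    φ ≫ q.hom = p.hom }
  id p := ⟨𝟙 _, Category.id_comp _⟩
  comp φ χ := ⟨φ.1 ≫ χ.1, by rw [Category.assoc, χ.2, φ.2]⟩
  id_comp φ := Subtype.ext (Category.id_comp _)
  comp_id φ := Subtype.ext (Category.comp_id _)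
  assoc φ χ ξ := Subtype.ext (Category.assoc _ _ _)

/-- A cocone of sets is a colimit if each fibre of it over its vertex has an initial element. -/
theorem isColimit_of_initial {D : Type u} [SmallCategory D]
    {P : D ⥤ Type u} (c : Cocone P)
    (h : ∀ y : c.pt, ∃ (d : D) (p : P.obj d), c.ι.app d p = y ∧
      ∀ (e : D) (q : P.obj e), c.ι.app e q = y → ∃ f : d ⟶ e, P.map f p = q) :
    Nonempty (IsColimit c) := by
  choose d p hp hu using h
  -- Every element over `y` is the image of `p y` under a map of the diagram, so a cocone is
  -- determined on the fibre by its value at `p y`.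
  refine ⟨{ desc := fun s => ↾fun y => s.ι.app (d y) (p y), fac := fun s e => ?_,
            uniq := fun s m hm => ?_ }⟩
  · ext q
    obtain ⟨f, hf⟩ := hu _ e q rfl
    have h1 := ConcreteCategory.congr_hom (s.w f) (p (c.ι.app e q))
    refine Eq.trans h1.symm ?_
    exact congrArg (s.ι.app e) hf
  · ext y
    have h1 := ConcreteCategory.congr_hom (hm (d y)) (p y)
    refine Eq.trans ?_ h1
    exact congrArg m (hp y).symm

namespace RepOver

/-- The forgetful functor from the category of representables over `F`. -/
def forget (F : EnrichedFunctor V T V) : RepOver F ⥤ EnrichedFunctor V T V where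
  obj p := representable p.left
  map φ := φ.1

/-- The canonical cocone with vertex `F`. -/
def cocone (F : EnrichedFunctor V T V) : Cocone (forget F) where
  pt := F
  ι :=
    { app := fun p => p.hom
      naturality := fun _ _ φ => φ.2.trans (Category.comp_id _).symm }

/-- The hypothesis is the universal property of a product of the `t i`, stated for the targets that
matter: representables, for coproducts of the underlying objects, and `F`, for the structure map and
for compatibility with it. Non-emptiness and binary coproducts imply siftedness. -/
theorem isSifted (F : EnrichedFunctor V T V)
    (h : ∀ (n : ℕ) (t : Fin n → T), ∃ (p : T)
      (c : ∀ i, 𝟙_ V ⟶ (representable (V := V) p).obj (t i)),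
      ∀ N : EnrichedFunctor V T V, (N = F ∨ ∃ r, N = representable r) →
        ∀ y : ∀ i, 𝟙_ V ⟶ N.obj (t i),
          ∃! φ : representable p ⟶ N, ∀ i, c i ≫ compo φ (t i) = y i) :
    IsSifted (RepOver F) := by
  -- The empty product supplies an object.
  have hne : Nonempty (RepOver F) := by
    obtain ⟨p, c, hc⟩ := h 0 Fin.elim0
    obtain ⟨φ, -⟩ := hc F (Or.inl rfl) fun i => Fin.elim0 i
    exact ⟨⟨p, φ⟩⟩
  -- By Yoneda the points `c i` become coprojections `T(t i, -) ⟶ T(p, -)`.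
  have h' : ∀ (n : ℕ) (t : Fin n → T), ∃ (p : T)
      (j : ∀ i, representable (V := V) (t i) ⟶ representable p),
      ∀ N : EnrichedFunctor V T V, (N = F ∨ ∃ r, N = representable r) →
        ∀ y : ∀ i, representable (t i) ⟶ N, ∃! φ : representable p ⟶ N, ∀ i, j i ≫ φ = y i := by
    intro n t
    obtain ⟨p, c, hc⟩ := h n t
    refine ⟨p, fun i => (repHomEquiv (t i) _).symm (c i), fun N hN y => ?_⟩
    have h1 : ∀ (φ : representable p ⟶ N) i, (repHomEquiv (t i) _).symm (c i) ≫ φ = y i ↔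
        c i ≫ compo φ (t i) = repHomEquiv (t i) N (y i) := by
      intro φ i
      rw [← (repHomEquiv (t i) N).injective.eq_iff, repHomEquiv_comp, Equiv.apply_symm_apply]
    simpa only [h1] using hc N hN fun i => repHomEquiv (t i) N (y i)
  have h2 : ∀ s t : T, ∃ (p : T) (j : representable (V := V) s ⟶ representable p)
      (k : representable (V := V) t ⟶ representable p),
      ∀ N : EnrichedFunctor V T V, (N = F ∨ ∃ r, N = representable r) →
        ∀ (y : representable s ⟶ N) (z : representable t ⟶ N),
          ∃! φ : representable p ⟶ N, j ≫ φ = y ∧ k ≫ φ = z := by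
    intro s t
    obtain ⟨p, j, hj⟩ := h' 2 ![s, t]
    refine ⟨p, j 0, j 1, fun N hN y z => ?_⟩
    have h3 := hj N hN (fun i => match i with
      | 0 => y
      | 1 => z)
    exact (existsUnique_congr fun φ => Fin.forall_fin_two).1 h3
  have : HasBinaryCoproducts (RepOver F) := by
    have : ∀ x y : RepOver F, HasBinaryCoproduct x y := by
      intro x y
      obtain ⟨p, j, k, hjk⟩ := h2 x.left y.left
      obtain ⟨φ, ⟨hφ, hφ'⟩, hu⟩ := hjk F (Or.inl rfl) x.hom y.hom
      have hd : ∀ (r : RepOver F) (f : x ⟶ r) (g : y ⟶ r),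
          ∃! l : (RepOver.mk p φ) ⟶ r, j ≫ l.1 = f.1 ∧ k ≫ l.1 = g.1 := by
        intro r f g
        -- Universality against the representable gives the copairing `χ`; uniqueness against `F`
        -- shows that `χ` lies over `F`.
        obtain ⟨χ, ⟨h3, h4⟩, h5⟩ := hjk (representable r.left) (Or.inr ⟨_, rfl⟩) f.1 g.1
        refine ⟨⟨χ, hu _ ⟨?_, ?_⟩⟩, ⟨h3, h4⟩, fun l hl => Subtype.ext (h5 l.1 hl)⟩
        · rw [reassoc_of% h3, f.2]
        · rw [reassoc_of% h4, g.2]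
      choose l hl hlu using hd
      exact ⟨⟨BinaryCofan.mk (P := RepOver.mk p φ) ⟨j, hφ⟩ ⟨k, hφ'⟩,
        BinaryCofan.IsColimit.mk _ (fun {r} f g => l r f g)
          (fun {r} f g => Subtype.ext (hl r f g).1) (fun {r} f g => Subtype.ext (hl r f g).2)
          fun {r} f g m hf hg => hlu r f g m
            ⟨congrArg Subtype.val hf, congrArg Subtype.val hg⟩⟩⟩
    exact hasBinaryCoproducts_of_hasColimit_pair _
  exact IsSifted.isSifted_of_hasBinaryCoproducts_and_nonempty

end RepOver

variable [HasColimits V]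

/-- The canonical cocone is tested at each `s` by `V₀(G, -)`. A map `y : G ⟶ F s` corresponds to
some `φ : T(L, -) ⟶ F`, and the universal map `c`, placed at the object `(L, φ)`, reaches every
other element of the fibre over `y`. -/
theorem isSiftedColimitOfRepresentables_of (hV : IsLocallyStronglyFinitelyPresentable V)
    (F : EnrichedFunctor V T V) [IsSifted (RepOver F)]
    (h : ∀ (G : V), IsStronglyFinitelyPresentable G → ∀ s : T, ∃ (L : T)
      (c : G ⟶ (representable (V := V) L).obj s),
      ∀ N : EnrichedFunctor V T V, (N = F ∨ ∃ r, N = representable r) →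
        ∀ y : G ⟶ N.obj s, ∃! φ : representable L ⟶ N, c ≫ compo φ s = y) :
    IsSiftedColimitOfRepresentables F := by
  refine ⟨RepOver F, inferInstance, inferInstance, RepOver.forget F ⋙ toUnderlyingFunctor V T,
    (toUnderlyingFunctor V T).mapCocone (RepOver.cocone F), fun p => ⟨p.left, ⟨Iso.refl _⟩⟩, rfl,
    isConicalColimit_of_pointwise _ fun s => isColimit_of_coyoneda hV _ fun G hG =>
      isColimit_of_initial _ fun y => ?_⟩
  obtain ⟨L, c, hc⟩ := h G hG s
  obtain ⟨φ, hφ, hu⟩ := hc F (Or.inl rfl) y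
  refine ⟨⟨L, φ⟩, c, hφ, fun p q hq => ?_⟩
  -- The element `q` of the fibre induces `χ`; since `χ ≫ p.hom` and `φ` both restrict to `y` along
  -- `c`, they agree, so `χ` is a morphism over `F`.
  obtain ⟨χ, hχ, -⟩ := hc (representable p.left) (Or.inr ⟨_, rfl⟩) q
  refine ⟨⟨χ, hu _ (Eq.trans ?_ hq)⟩, hχ⟩
  exact (Category.assoc c (compo χ s) (compo p.hom s)).symm.trans
    (congrArg (fun k : G ⟶ (representable p.left).obj s => k ≫ compo p.hom s) hχ)

end RepOver

/-! ### Continuous functors are sifted colimits of representables -/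

section Continuous

variable {V : Type v} [Category.{u} V] [MonoidalCategory V] [SymmetricCategory V]
  [MonoidalClosed V] [HasLimits V] [HasColimits V]
variable {T : Type u} [EnrichedCategory V T]

theorem stronglyFiniteWeights_of_isFiniteProductOrPower {A : Type u} [EnrichedCategory V A]
    (W : EnrichedFunctor V A V) (hW : IsFiniteProductOrPower A W) : stronglyFiniteWeights V A W :=
  fun _ _ h => h A W hW

theorem isContinuous_representable (Φ : WeightClass V) (r : T) :
    IsContinuous Φ (representable (V := V) r) :=
  fun _ _ _ _ _ _ c hc => isLimit_map_homFunctor c hc r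

/-- Here `L` is the power of `s` by `G` in `T` and `c` is its counit. Both `F` and the
representables preserve this power, so Yoneda turns its universal property into one for maps out of
`T(L, -)`. -/
theorem exists_power (hT : IsComplete (stronglyFiniteWeights V) T) {F : EnrichedFunctor V T V}
    (hF : IsContinuous (stronglyFiniteWeights V) F) {G : V} (hG : IsStronglyFinite G) (s : T) :
    ∃ (L : T) (c : G ⟶ (representable (V := V) L).obj s),
      ∀ N : EnrichedFunctor V T V, (N = F ∨ ∃ r, N = representable r) →
        ∀ y : G ⟶ N.obj s, ∃! φ : representable L ⟶ N, c ≫ compo φ s = y := by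
  have hW := stronglyFiniteWeights_of_isFiniteProductOrPower (V := V) _
    (IsFiniteProductOrPower.power G hG)
  let S : EnrichedFunctor V UnitCat.{u} T :=
    { obj := fun _ => s
      map := fun _ _ => eId V s
      map_id := fun _ => Category.id_comp _
      map_comp := fun _ _ _ => (eId_tensorHom_eComp _).symm }
  obtain ⟨L, c, hc⟩ := hT _ _ hW S
  refine ⟨L, repCone c UnitCat.star, fun N hN y => ?_⟩
  have hcN : (c.map N).IsLimit := by
    obtain rfl | ⟨r, rfl⟩ := hN
    · exact hF _ _ hW _ _ c hc
    · exact isContinuous_representable _ r _ _ hW _ _ c hc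
  have h := existsUnique_repHom c N hcN (fun _ => y) (isEquivariant_unitCat _ _ _)
  refine (existsUnique_congr fun φ => ?_).1 h
  exact ⟨fun h => h UnitCat.star, fun h _ => h⟩

/-- The transport of `eId` along an equality of objects of a discrete category. -/
def discretePoint {I : Type u} (t : I → T) (a b : Discrete I) (h : a ⟶ b) :
    𝟙_ V ⟶ (t a.as ⟶[V] t b.as) :=
  Discrete.eq_of_hom h ▸ eId V (t a.as)

theorem discretePoint_id {I : Type u} (t : I → T) (a : Discrete I) (h : a ⟶ a) :
    discretePoint (V := V) t a a h = eId V (t a.as) := rfl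

/-- A family of objects, as a `V`-functor on the free `V`-category on a discrete category. -/
def discreteFunctor {I : Type u} (t : I → T) : EnrichedFunctor V (FreeCat (Discrete I)) T where
  obj a := t (Discrete.as a)
  map a b := FreeCat.desc (D := Discrete I) (discretePoint t a b)
  map_id a := FreeCat.ι_desc (D := Discrete I) (discretePoint t a a) _
  map_comp a b c := by
    have key : ∀ a b c : Discrete I, FreeCat.comp V a b c ≫ FreeCat.desc (discretePoint t a c) =
        (FreeCat.desc (discretePoint t a b) ⊗ₘ FreeCat.desc (discretePoint t b c)) ≫
          eComp V (t a.as) (t b.as) (t c.as) := by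
      intro a b c
      apply FreeCat.hom_ext_tensor
      intro f g
      rw [← Category.assoc, FreeCat.ι_comp, Category.assoc, FreeCat.ι_desc,
        tensorHom_comp_tensorHom_assoc, FreeCat.ι_desc, FreeCat.ι_desc]
      obtain ⟨a⟩ := a
      obtain ⟨b⟩ := b
      obtain ⟨c⟩ := c
      obtain rfl : a = b := Discrete.eq_of_hom f
      obtain rfl : a = c := Discrete.eq_of_hom g
      rw [discretePoint_id, discretePoint_id, discretePoint_id, eId_tensorHom_eComp]
    exact key a b c

/-- The same argument with the product of the `t i`: its projections, seen as points of `T(p, t i)`,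
are the universal family. -/
theorem exists_product (hT : IsComplete (stronglyFiniteWeights V) T) {F : EnrichedFunctor V T V}
    (hF : IsContinuous (stronglyFiniteWeights V) F) (n : ℕ) (t : Fin n → T) :
    ∃ (p : T) (c : ∀ i, 𝟙_ V ⟶ (representable (V := V) p).obj (t i)),
      ∀ N : EnrichedFunctor V T V, (N = F ∨ ∃ r, N = representable r) →
        ∀ y : ∀ i, 𝟙_ V ⟶ N.obj (t i),
          ∃! φ : representable p ⟶ N, ∀ i, c i ≫ compo φ (t i) = y i := by
  have hW := stronglyFiniteWeights_of_isFiniteProductOrPower (V := V) _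
    (IsFiniteProductOrPower.finiteProduct n)
  obtain ⟨L, c, hc⟩ := hT _ _ hW (discreteFunctor fun i => t i.down)
  refine ⟨L, fun i => repCone c (Discrete.mk (ULift.up i)), fun N hN y => ?_⟩
  have hcN : (c.map N).IsLimit := by
    obtain rfl | ⟨r, rfl⟩ := hN
    · exact hF _ _ hW _ _ c hc
    · exact isContinuous_representable _ r _ _ hW _ _ c hc
  have h := existsUnique_repHom c N hcN (fun a => y (Discrete.as a).down)
    (isEquivariant_discrete _ _ _)
  refine (existsUnique_congr fun φ => ?_).1 h
  exact ⟨fun h i => h (Discrete.mk (ULift.up i)), fun h a => h (Discrete.as a).down⟩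

theorem IsContinuous.isSiftedColimitOfRepresentables
    (hV : IsLocallyStronglyFinitelyPresentableTensor V)
    (hT : IsComplete (stronglyFiniteWeights V) T) {F : EnrichedFunctor V T V}
    (hF : IsContinuous (stronglyFiniteWeights V) F) : IsSiftedColimitOfRepresentables F := by
  have := RepOver.isSifted F (exists_product hT hF)
  exact isSiftedColimitOfRepresentables_of hV.1 F fun G hG s =>
    exists_power hT hF (hG.isStronglyFinite hV) s

end Continuous

end

end EnrichedTheories

theorem mainTheorem4 {V : Type v} [Category.{u} V] [MonoidalCategory V] [SymmetricCategory V]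
    [MonoidalClosed V] [HasLimits V] [HasColimits V]
    (hV : EnrichedTheories.IsLocallyStronglyFinitelyPresentableTensor V) :
    (∀ (T : Type u) [EnrichedCategory V T],
      EnrichedTheories.IsComplete (EnrichedTheories.stronglyFiniteWeights V) T →
      ∀ F : EnrichedFunctor V T V,
        List.TFAE [EnrichedTheories.IsSiftedColimitOfRepresentables F,
          EnrichedTheories.IsFlat (EnrichedTheories.stronglyFiniteWeights V) F,
          EnrichedTheories.IsContinuous (EnrichedTheories.stronglyFiniteWeights V) F]) ∧
    EnrichedTheories.AxiomA (EnrichedTheories.stronglyFiniteWeights V) := by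
  refine ⟨fun T _ hT F => ?_, fun T _ hT F hF => ?_⟩
  · tfae_have 1 → 2 := fun h => h.isFlat hV.1
    tfae_have 2 → 3 := fun h => h.isContinuous
    tfae_have 3 → 1 := fun h => h.isSiftedColimitOfRepresentables hV hT
    tfae_finish
  -- Continuity of `F` is first converted into a presentation as a sifted colimit of representables,
  -- which makes `F * -` commute with the pointwise limits of `[Tᵒᵖ, V]`.
  · exact (hF.isSiftedColimitOfRepresentables hV hT).isContinuous_weightedColimit hV.1
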